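/- **Setting.** Let $t=(t^{(1)},t^{(2)},t^{(3)})$ with $t^{(i)}=(t^{(i)}_1,t^{(i)}_2,\dots)$, write $\bm m=(m_1,m_2)\in\mathbb Z^2$, $\bm e_1=(1,0)$, $\bm e_2=(0,1)$, $\bm e=\bm e_1+\bm e_2$, $\xi(x,z)=\sum_{k\ge1}x_kz^k$, $[z]=(z,z^2/2,z^3/3,\dots)$, and let $t\pm[z]_i$ denote $t$ with $t^{(i)}$ replaced by $t^{(i)}\pm[z]$. Let $\widetilde\tau_{\bm m}\in\mathbb C[[t]]$ $(\bm m\in\mathbb Z^2)$ be nonzero formal power series that satisfy the bilinear equation of the 3-KP hierarchy: for all $\bm m,\bm m'$, $$\oint_{C_R}\frac{dz}{2\pi i}z^{m_1-m_1'}e^{\xi(t^{(1)}-t'^{(1)},z)}\widetilde\tau_{\bm m}(t-[z^{-1}]_1)\widetilde\tau_{\bm m'}(t'+[z^{-1}]_1)=\oint_{C_r}\frac{dz}{2\pi i}z^{m_2-m_2'}e^{\xi(t^{(2)}-t'^{(2)},z^{-1})}\widetilde\tau_{\bm m+\bm e}(t-[z]_2)\widetilde\tau_{\bm m'-\bm e}(t'+[z]_2)$$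 $$\qquad+\oint_{C_r}\frac{dz}{2\pi i}(-1)^{m_2+m_2'}z^{m_1-m_2-m_1'+m_2'}e^{\xi(t^{(3)}-t'^{(3)},z^{-1})}\widetilde\tau_{\bm m+\bm e_1}(t-[z]_3)\widetilde\tau_{\bm m'-\bm e_1}(t'+[z]_3),$$ where $\oint_{C_R}$ and $\oint_{C_r}$ denote the coefficient of $z^{-1}$ of the formal expansion at $z=\infty$ and at $z=0$ respectively. **Operators.** Let $\mathcal B$ be the ring of functions of $\bm m\in\mathbb Z^2$ with values in the fraction field of $\mathbb C[[t]]$, and let $\Lambda_i$ be the shift $f(\bm m)\mapsto f(\bm m+\bm e_i)$, so that $\Lambda_i f(\bm m)=f(\bm m+\bm e_i)\Lambda_i$ in products of operators. Time derivatives act on the coefficients of operators. Put $$S_1=\sum_{k\ge0}a^{(1)}_k\Lambda_1^{-k},\quad S_2=\sum_{k\ge0}a^{(2)}_k\Lambda_2^{k},\quad S_3(\Lambda_1)=\sum_{k\ge0}a_k^{(3)}\Lambda_1^k,\quad S_3(\Lambda_2^{-1})=\sum_{k\ge0}a_k^{(3)}\Lambda_2^{-k},$$ $$\sum_k a^{(1)}_kz^{-k}=\frac{\widetilde\tau_{\bm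 m}(t-[z^{-1}]_1)}{\widetilde\tau_{\bm m}(t)},\quad \sum_k a^{(2)}_kz^{k}=\frac{\widetilde\tau_{\bm m+\bm e}(t-[z]_2)}{\widetilde\tau_{\bm m}(t)},\quad \sum_k a^{(3)}_kz^{k}=(-1)^{m_2}\frac{\widetilde\tau_{\bm m+\bm e_1}(t-[z]_3)}{\widetilde\tau_{\bm m}(t)}.$$ For $\alpha=1,2$ let $\mathcal E^{0,\pm}_{(\alpha)}=\mathcal B((\Lambda_\alpha^{\mp1}))$ and let $\mathcal E^{\pm}_{(\alpha)}=\mathcal E^{0,\pm}_{(\alpha)}[\Lambda_{3-\alpha},\Lambda_{3-\alpha}^{-1}]$ (Laurent polynomials in the other shift). The Lax operators are $$L_1(\Lambda_1)=S_1\Lambda_1S_1^{-1},\quad L_2(\Lambda_2)=S_2\Lambda_2^{-1}S_2^{-1},\quad L_3(\Lambda_1)=S_3(\Lambda_1)\Lambda_1^{-1}S_3(\Lambda_1)^{-1},\quad L_3(\Lambda_2^{-1})=S_3(\Lambda_2^{-1})\Lambda_2S_3(\Lambda_2^{-1})^{-1},$$ with inverses taken in $\mathcal E^{0,+}_{(1)},\mathcal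 E^{0,-}_{(2)},\mathcal E^{0,-}_{(1)},\mathcal E^{0,+}_{(2)}$ respectively. For $k\ge1$ put $$B^{(1)}_k(\Lambda_1)=(L_1^k)_{\ge0},\quad B^{(3)}_k(\Lambda_1)=(L_3(\Lambda_1)^k)_{<0},\quad B_k^{(2)}(\Lambda_2)=(L_2^k)_{\Delta_2^*,\ge1},\quad B_k^{(3)}(\Lambda_2^{-1})=(L_3(\Lambda_2^{-1})^k)_{\Delta_2,\ge1}.$$ The first two are the parts of the indicated orders in $\Lambda_1$; the last two are the parts of order at least $1$ in the expansions in powers of $\Delta_2^*=\Lambda_2^{-1}-1$ and $\Delta_2=\Lambda_2-1$, in which negative powers of $\Delta+1$ are expanded in negative powers of $\Delta$. Finally let $$H=\Lambda_1\Delta_2+\rho,\qquad \rho=\frac{\widetilde\tau_{\bm m}}{\widetilde\tau_{\bm m+\bm e_1}}\frac{\widetilde\tau_{\bm m+\bm e+\bm e_1}}{\widetilde\tau_{\bm m+\bm e}}.$$ **Theorem.** The inverses above exist and are unique, the four operators $B$ are Laurent polynomials in the shifts, and $\mathcal E^{\pm}_{(\alpha)}=\mathcal E^{0,\pm}_{(\alpha)}\oplus\mathcal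 E^{\pm}_{(\alpha)}H$ for $\alpha=1,2$, which defines projections $\pi_\alpha^\pm:\mathcal E^{\pm}_{(\alpha)}\to\mathcal E^{0,\pm}_{(\alpha)}$. For every $k\ge1$ the following Lax equations hold. * $t^{(1)}_k$-flow: $$\partial_{t_k^{(1)}}L_1(\Lambda_1)=[B_k^{(1)}(\Lambda_1),L_1(\Lambda_1)],\qquad \partial_{t_k^{(1)}}L_2(\Lambda_2)=[\pi_2^-(B_k^{(1)}(\Lambda_1)),L_2(\Lambda_2)],$$ $$\partial_{t_k^{(1)}}L_3(\Lambda_1)=[B_k^{(1)}(\Lambda_1),L_3(\Lambda_1)],\qquad \partial_{t_k^{(1)}}L_3(\Lambda_2^{-1})=[\pi_2^+(B_k^{(1)}(\Lambda_1)),L_3(\Lambda_2^{-1})].$$ * $t^{(2)}_k$-flow: $$\partial_{t_k^{(2)}}L_1(\Lambda_1)=[\pi_1^+(B_k^{(2)}(\Lambda_2)),L_1(\Lambda_1)],\qquad \partial_{t_k^{(2)}}L_2(\Lambda_2)=[B_k^{(2)}(\Lambda_2),L_2(\Lambda_2)],$$ $$\partial_{t_k^{(2)}}L_3(\Lambda_1)=[\pi_1^-(B_k^{(2)}(\Lambda_2)),L_3(\Lambda_1)],\qquad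 \partial_{t_k^{(2)}}L_3(\Lambda_2^{-1})=[B_k^{(2)}(\Lambda_2),L_3(\Lambda_2^{-1})].$$ * $t^{(3)}_k$-flow, in terms of $\Lambda_1$: $$\partial_{t_k^{(3)}}L_1(\Lambda_1)=[B_k^{(3)}(\Lambda_1),L_1(\Lambda_1)],\qquad \partial_{t_k^{(3)}}L_2(\Lambda_2)=[\pi_2^-(B_k^{(3)}(\Lambda_1)),L_2(\Lambda_2)],$$ $$\partial_{t_k^{(3)}}L_3(\Lambda_1)=[B_k^{(3)}(\Lambda_1),L_3(\Lambda_1)],\qquad \partial_{t_k^{(3)}}L_3(\Lambda_2^{-1})=[\pi_2^+(B_k^{(3)}(\Lambda_1)),L_3(\Lambda_2^{-1})].$$ * $t^{(3)}_k$-flow, in terms of $\Lambda_2$: $$\partial_{t_k^{(3)}}L_1(\Lambda_1)=[\pi_1^+(B_k^{(3)}(\Lambda_2^{-1})),L_1(\Lambda_1)],\qquad \partial_{t_k^{(3)}}L_2(\Lambda_2)=[B_k^{(3)}(\Lambda_2^{-1}),L_2(\Lambda_2)],$$ $$\partial_{t_k^{(3)}}L_3(\Lambda_1)=[\pi_1^-(B_k^{(3)}(\Lambda_2^{-1})),L_3(\Lambda_1)],\qquad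 \partial_{t_k^{(3)}}L_3(\Lambda_2^{-1})=[B_k^{(3)}(\Lambda_2^{-1}),L_3(\Lambda_2^{-1})].$$ -/

import Mathlib

noncomputable section

namespace ThreeKP

/-! ### Times, formal functions of the times, and derivations

The three families of times `t^(1), t^(2), t^(3)` are numbered by `Fin 3` and the two discrete
variables `m_1, m_2` (and the shifts `Λ_1, Λ_2`) by `Fin 2`; in both cases the index `0` stands
for the first one. -/

/-- `(i, k)` is the index of the time variable `t_k^{(i+1)}`, `k ≥ 1`. -/
abbrev TimeIdx : Type := Fin 3 × ℕ+

/-- Formal power series in all the times `t = (t^(1), t^(2), t^(3))`. -/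
abbrev TSeries : Type := MvPowerSeries TimeIdx ℂ

/-- Formal power series in two independent copies `t`, `t'` of the times
(`Sum.inl` for `t`, `Sum.inr` for `t'`). -/
abbrev TSeries₂ : Type := MvPowerSeries (TimeIdx ⊕ TimeIdx) ℂ

/-- The field of fractions of the ring of formal power series in `t`. -/
abbrev TField : Type := FractionRing TSeries

/-- The embedding of power series in their field of fractions. -/
def ι : TSeries →+* TField := algebraMap TSeries TField

/-- `∂/∂t_s` on the field of fractions, by the quotient rule. -/
def dt (s : TimeIdx) (x : TField) : TField :=
  let p := IsLocalization.sec (nonZeroDivisors TSeries) x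
  (ι (MvPowerSeries.pderiv ℂ s p.1) * ι p.2 - ι p.1 * ι (MvPowerSeries.pderiv ℂ s p.2)) /
    ι p.2 ^ 2

/-- The quotient rule holds for every way of writing an element as a fraction, so `dt s` does not
depend on the choice made in its definition. -/
theorem dt_div (s : TimeIdx) (a b : TSeries) (hb : b ≠ 0) :
    dt s (ι a / ι b) =
      (ι (MvPowerSeries.pderiv ℂ s a) * ι b - ι a * ι (MvPowerSeries.pderiv ℂ s b)) /
        ι b ^ 2 := by
  have inj : Function.Injective ι := IsFractionRing.injective TSeries TField
  have ne : ∀ c : TSeries, c ≠ 0 → ι c ≠ 0 := fun c hc h => hc (inj (by simpa using h))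
  unfold dt
  obtain ⟨p, hp⟩ : ∃ p, p = IsLocalization.sec (nonZeroDivisors TSeries) (ι a / ι b) := ⟨_, rfl⟩
  simp only [← hp]
  have hs := IsLocalization.sec_spec (nonZeroDivisors TSeries) (ι a / ι b)
  rw [← hp] at hs
  change ι a / ι b * ι p.2 = ι p.1 at hs
  have hq0 : (p.2 : TSeries) ≠ 0 := nonZeroDivisors.ne_zero p.2.2
  have hq := ne _ hq0
  have hb' := ne _ hb
  have e : a * p.2 = b * p.1 := by
    apply inj
    rw [map_mul, map_mul, ← hs]
    field_simp
  have e2 := congrArg (fun f => ι (MvPowerSeries.pderiv ℂ s f)) e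
  have e1 := congrArg ι e
  simp only [Derivation.leibniz, smul_eq_mul, map_add, map_mul] at e2 e1
  rw [div_eq_div_iff (pow_ne_zero 2 hq) (pow_ne_zero 2 hb')]
  linear_combination (-ι b * ι p.2) * e2 +
    (ι b * ι (MvPowerSeries.pderiv ℂ s p.2) + ι p.2 * ι (MvPowerSeries.pderiv ℂ s b)) * e1

/-! ### The bilinear equation -/

/-- The series to be substituted for the times in order to form `f (t + c [w]_i)`, where
`[w] = (w, w²/2, w³/3, …)`. The variable `w` is `none`. -/
def miwaArg (i : Fin 3) (c : ℂ) (s : TimeIdx) : MvPowerSeries (Option TimeIdx) ℂ :=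
  MvPowerSeries.X (some s) +
    if s.1 = i then MvPowerSeries.C (c / ((s.2 : ℕ) : ℂ)) * MvPowerSeries.X none ^ (s.2 : ℕ)
    else 0

/-- This substitution is admissible for formal power series. -/
theorem miwaArg_hasSubst (i : Fin 3) (c : ℂ) : MvPowerSeries.HasSubst (miwaArg i c) where
  const_coeff s := by
    have h : (s.2 : ℕ) ≠ 0 := s.2.ne_zero
    unfold miwaArg
    split_ifs <;> simp [h]
  coeff_zero d := by
    classical
    refine Set.Finite.subset
      (s := {s | Finsupp.single (some s) 1 = d} ∪
        {s | s.1 = i ∧ Finsupp.single none (s.2 : ℕ) = d}) (Set.Finite.union ?_ ?_) ?_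
    · refine Set.Subsingleton.finite fun x hx y hy => ?_
      have hxy := (Set.mem_ofPred_eq ▸ hx).trans (Set.mem_ofPred_eq ▸ hy).symm
      simpa using Finsupp.single_left_injective one_ne_zero hxy
    · refine Set.Subsingleton.finite fun x hx y hy => ?_
      have hxy := Finsupp.single_injective _ (hx.2.trans hy.2.symm)
      exact Prod.ext (hx.1.trans hy.1.symm) (PNat.coe_injective hxy)
    · intro s hs
      by_contra hn
      simp only [Set.mem_union, Set.mem_ofPred_eq, not_or, not_and] at hn
      apply hs
      unfold miwaArg
      split_ifs with h
      · rw [map_add, MvPowerSeries.coeff_X, if_neg (Ne.symm hn.1), MvPowerSeries.coeff_C_mul,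
          MvPowerSeries.coeff_X_pow, if_neg (Ne.symm (hn.2 h))]
        simp
      · rw [add_zero, MvPowerSeries.coeff_X, if_neg (Ne.symm hn.1)]

/-- The coefficient of `w^n`, a power series in `t`, of a power series in `t` and `w`. -/
def wCoeff (n : ℕ) (F : MvPowerSeries (Option TimeIdx) ℂ) : TSeries := fun d =>
  MvPowerSeries.coeff (Finsupp.embDomain Function.Embedding.some d + Finsupp.single none n) F

/-- `f (t + c [w]_i)` as a power series in `w` whose coefficients are power series in `t`. -/
def miwa (i : Fin 3) (c : ℂ) (f : TSeries) : PowerSeries TSeries :=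
  PowerSeries.mk fun n => wCoeff n (MvPowerSeries.subst (miwaArg i c) f)

/-- `exp (ξ(t^{(i)} - t'^{(i)}, w))` with `ξ(x, w) = ∑_{k ≥ 1} x_k w^k`, as a power series
in `w`. -/
def expXi (i : Fin 3) : PowerSeries TSeries₂ :=
  (PowerSeries.exp ℂ).subst
    (PowerSeries.mk fun k : ℕ =>
      if h : 0 < k then
        (MvPowerSeries.X (Sum.inl (i, ⟨k, h⟩)) - MvPowerSeries.X (Sum.inr (i, ⟨k, h⟩)) : TSeries₂)
      else 0 : PowerSeries TSeries₂)

/-- `f (t - [w]_i) * g (t' + [w]_i)` as a power series in `w`. -/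
def miwaProd (i : Fin 3) (f g : TSeries) : PowerSeries TSeries₂ :=
  PowerSeries.map
      (MvPowerSeries.rename (R := ℂ)
        (Function.Embedding.inl : TimeIdx ↪ TimeIdx ⊕ TimeIdx)).toRingHom
      (miwa i (-1) f) *
    PowerSeries.map
      (MvPowerSeries.rename (R := ℂ)
        (Function.Embedding.inr : TimeIdx ↪ TimeIdx ⊕ TimeIdx)).toRingHom
      (miwa i 1 g)

/-- For `E(w) = ∑ E_a w^a` and `F(w) = ∑ F_b w^b`, the coefficient of `w^s` in `E(w) F(w⁻¹)`,
i.e. `∑_{a - b = s} E_a F_b`. The sum is taken coefficientwise in `t, t'`; it is locally finite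
for `E = expXi i`, because the coefficient of `w^a` in that series has only terms of weight `a`. -/
def laurentCoeff (s : ℤ) (E F : PowerSeries TSeries₂) : TSeries₂ :=
  fun d => ∑ᶠ p : ℕ × ℕ,
    if (p.1 : ℤ) - (p.2 : ℤ) = s then
      MvPowerSeries.coeff d (PowerSeries.coeff p.1 E * PowerSeries.coeff p.2 F)
    else 0

/-- `∮_{C_R} dz/(2πi) z^a E(z) F(z⁻¹)` (expansion at `z = ∞`). -/
def resInfty (a : ℤ) (E F : PowerSeries TSeries₂) : TSeries₂ := laurentCoeff (-1 - a) E F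

/-- `∮_{C_r} dz/(2πi) z^a E(z⁻¹) F(z)` (expansion at `z = 0`). -/
def resZero (a : ℤ) (E F : PowerSeries TSeries₂) : TSeries₂ := laurentCoeff (a + 1) E F

/-- The lattice `ℤ²` of the discrete variables `m = (m_1, m_2)`. -/
abbrev Lattice : Type := Fin 2 → ℤ

/-- `e_1 = (1, 0)`. -/
def e₁ : Lattice := ![1, 0]

/-- `e = e_1 + e_2 = (1, 1)`. -/
def e : Lattice := ![1, 1]

/-- The tau functions (in the sign convention of the functions `τ̃`) of the 3-KP hierarchy: nonzero
families of power series that satisfy the bilinear equation. -/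
structure IsTau (τ : Lattice → TSeries) : Prop where
  ne_zero : ∀ m, τ m ≠ 0
  bilinear : ∀ m m' : Lattice,
    resInfty (m 0 - m' 0) (expXi 0) (miwaProd 0 (τ m) (τ m')) =
      resZero (m 1 - m' 1) (expXi 1) (miwaProd 1 (τ (m + e)) (τ (m' - e))) +
      ((Int.negOnePow (m 1 + m' 1) : ℤ) : TSeries₂) *
        resZero (m 0 - m 1 - m' 0 + m' 1) (expXi 2) (miwaProd 2 (τ (m + e₁)) (τ (m' - e₁)))

/-! ### Formal operators in two shifts -/

/-- A formal operator `∑_{j ∈ ℤ²} a_j(m) Λ_1^{j_1} Λ_2^{j_2}`: `A j m` is the value at `m` of the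
coefficient of `Λ_1^{j_1} Λ_2^{j_2}`, an element of the field of fractions of the power series
in `t`. -/
def Op : Type := Lattice → Lattice → TField

namespace Op

instance : AddCommGroup Op := inferInstanceAs (AddCommGroup (Lattice → Lattice → TField))

/-- Multiplication by a function of `m` and `t`. -/
def ofFun (f : Lattice → TField) : Op := fun j m => if j = 0 then f m else 0

instance : One Op := ⟨ofFun fun _ => 1⟩

/-- The operator product, `(a Λ^k) (b Λ^l) = a(m) b(m + k) Λ^{k + l}`. All products that are used
below are products of two operators for which only finitely many terms contribute to each
coefficient. -/
instance : Mul Op := ⟨fun A B j m => ∑ᶠ k : Lattice, A k m * B (j - k) (m + k)⟩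

/-- The powers `A^n`. -/
def pow (A : Op) : ℕ → Op
  | 0 => 1
  | n + 1 => pow A n * A

/-- The commutator `[A, B] = A B - B A`. -/
def comm (A B : Op) : Op := A * B - B * A

/-- The shift power `Λ_{α+1}^n`. -/
def Lam (α : Fin 2) (n : ℤ) : Op := fun j _ => if j = Pi.single α n then 1 else 0

/-- The derivative with respect to the time `t_s` of the coefficients. -/
def deriv (s : TimeIdx) (A : Op) : Op := fun j m => dt s (A j m)

/-- The operator `∑_{n ≥ 0} a_n(m) Λ_{α+1}^{δ n}`, `δ = ±1`. -/
def series (α : Fin 2) (δ : ℤˣ) (a : ℕ → Lattice → TField) : Op := fun j m =>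
  if (∀ β, β ≠ α → j β = 0) ∧ 0 ≤ (δ : ℤ) * j α then a ((δ : ℤ) * j α).toNat m else 0

/-- The part `A_{α+1, P}` of `A` of the terms whose order in `Λ_{α+1}` has the property `P`. -/
def part (α : Fin 2) (P : ℤ → Prop) (A : Op) : Op :=
  open scoped Classical in fun j m => if P (j α) then A j m else 0

/-- The coefficient of `Δ^k`, `k ≥ 0`, in the expansion of an operator `A` in `Λ_{α+1}` alone in
powers of `Δ = Q - 1`, where `Q = Λ_{α+1}^δ`. Here `Q^n = ∑_k (n choose k) Δ^k` for `n ≥ 0`, while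
for `n < 0` the power `Q^n` is expanded in negative powers of `Δ` only. -/
def deltaCoeff (α : Fin 2) (δ : ℤˣ) (A : Op) (k : ℕ) (m : Lattice) : TField :=
  ∑ᶠ n : ℕ, ((n.choose k : ℕ) : TField) * A (Pi.single α ((δ : ℤ) * (n : ℤ))) m

/-- The part `A_{Δ, ≥ 1} = ∑_{k ≥ 1} d_k Δ^k` of `A = ∑_k d_k Δ^k`, where `Δ = Λ_{α+1}^δ - 1`,
written in powers of `Q = Λ_{α+1}^δ` by means of `Δ^k = ∑_l (-1)^{k-l} (k choose l) Q^l`. -/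
def deltaPartPos (α : Fin 2) (δ : ℤˣ) (A : Op) : Op :=
  series α δ fun l m => ∑ᶠ k : ℕ,
    if 1 ≤ k then (-1) ^ (k + l) * ((k.choose l : ℕ) : TField) * deltaCoeff α δ A k m else 0

/-- The Laurent polynomials in `Λ_1` and `Λ_2`. -/
def IsLaurentPoly (A : Op) : Prop := ∃ N : ℤ, ∀ j, A j ≠ 0 → ∀ α, |j α| ≤ N

/-- The ring `𝓔^{0,ε}_{(α+1)}` of the Laurent series in `Λ_{α+1}⁻¹` (for `ε = 1`) or in
`Λ_{α+1}` (for `ε = -1`), without the other shift. -/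
def IsSeries (α : Fin 2) (ε : ℤˣ) (A : Op) : Prop :=
  ∃ N : ℤ, ∀ j, A j ≠ 0 → (∀ β, β ≠ α → j β = 0) ∧ (ε : ℤ) * j α ≤ N

/-- The ring `𝓔^ε_{(α+1)}` of the Laurent polynomials in the other shift with coefficients in
`𝓔^{0,ε}_{(α+1)}`. -/
def IsMixed (α : Fin 2) (ε : ℤˣ) (A : Op) : Prop :=
  ∃ N : ℤ, ∀ j, A j ≠ 0 → (∀ β, β ≠ α → |j β| ≤ N) ∧ (ε : ℤ) * j α ≤ N

/-- `T` is the inverse of `S` in `𝓔^{0,ε}_{(α+1)}`. -/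
def IsInv (α : Fin 2) (ε : ℤˣ) (S T : Op) : Prop :=
  IsSeries α ε T ∧ S * T = 1 ∧ T * S = 1

/-- The inverse of `S` in `𝓔^{0,ε}_{(α+1)}`. -/
def inv (α : Fin 2) (ε : ℤˣ) (S : Op) : Op :=
  haveI : Nonempty Op := ⟨1⟩
  Classical.epsilon (IsInv α ε S)

end Op

open Op

/-! ### Wave operators, Lax operators and projections -/

section Lax

variable (τ : Lattice → TSeries)

/-- `S_1(Λ_1) = ∑_k a_k Λ_1^{-k}` with `∑_k a_k z^{-k} = τ_m(t - [z⁻¹]_1) / τ_m(t)`. -/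
def S₁ : Op := series 0 (-1) fun k m => ι (PowerSeries.coeff k (miwa 0 (-1) (τ m))) / ι (τ m)

/-- `S_2(Λ_2) = ∑_k a_k Λ_2^k` with `∑_k a_k z^k = τ_{m+e}(t - [z]_2) / τ_m(t)`. -/
def S₂ : Op := series 1 1 fun k m => ι (PowerSeries.coeff k (miwa 1 (-1) (τ (m + e)))) / ι (τ m)

/-- The coefficients `a_k` with `∑_k a_k z^k = (-1)^{m_2} τ_{m+e_1}(t - [z]_3) / τ_m(t)`. -/
def a₃ (k : ℕ) (m : Lattice) : TField :=
  ((Int.negOnePow (m 1) : ℤ) : TField) *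
    (ι (PowerSeries.coeff k (miwa 2 (-1) (τ (m + e₁)))) / ι (τ m))

/-- `S_3(Λ_1) = ∑_k a_k Λ_1^k`. -/
def S₃ : Op := series 0 1 (a₃ τ)

/-- `S_3(Λ_2⁻¹) = ∑_k a_k Λ_2^{-k}`, with the same coefficients. -/
def S₃' : Op := series 1 (-1) (a₃ τ)

/-- `L_1(Λ_1) = S_1 Λ_1 S_1⁻¹`. -/
def L₁ : Op := S₁ τ * Lam 0 1 * inv 0 1 (S₁ τ)

/-- `L_2(Λ_2) = S_2 Λ_2⁻¹ S_2⁻¹`. -/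
def L₂ : Op := S₂ τ * Lam 1 (-1) * inv 1 (-1) (S₂ τ)

/-- `L_3(Λ_1) = S_3(Λ_1) Λ_1⁻¹ S_3(Λ_1)⁻¹`. -/
def L₃ : Op := S₃ τ * Lam 0 (-1) * inv 0 (-1) (S₃ τ)

/-- `L_3(Λ_2⁻¹) = S_3(Λ_2⁻¹) Λ_2 S_3(Λ_2⁻¹)⁻¹`. -/
def L₃' : Op := S₃' τ * Lam 1 1 * inv 1 1 (S₃' τ)

/-- `B_k^{(1)}(Λ_1) = (L_1^k)_{1, ≥ 0}`. -/
def B₁ (k : ℕ+) : Op := part 0 (fun n => 0 ≤ n) (pow (L₁ τ) k)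

/-- `B_k^{(2)}(Λ_2) = (L_2^k)_{Δ_2^*, ≥ 1}`, where `Δ_2^* = Λ_2⁻¹ - 1`. -/
def B₂ (k : ℕ+) : Op := deltaPartPos 1 (-1) (pow (L₂ τ) k)

/-- `B_k^{(3)}(Λ_1) = (L_3(Λ_1)^k)_{1, < 0}`. -/
def B₃ (k : ℕ+) : Op := part 0 (fun n => n < 0) (pow (L₃ τ) k)

/-- `B_k^{(3)}(Λ_2⁻¹) = (L_3(Λ_2⁻¹)^k)_{Δ_2, ≥ 1}`, where `Δ_2 = Λ_2 - 1`. -/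
def B₃' (k : ℕ+) : Op := deltaPartPos 1 1 (pow (L₃' τ) k)

/-- `ρ(m) = τ_m τ_{m+e+e_1} / (τ_{m+e_1} τ_{m+e})`. -/
def ρ (m : Lattice) : TField :=
  ι (τ m) / ι (τ (m + e₁)) * (ι (τ (m + e + e₁)) / ι (τ (m + e)))

/-- `H = Λ_1 Δ_2 + ρ`, where `Δ_2 = Λ_2 - 1`. -/
def H : Op := Lam 0 1 * (Lam 1 1 - 1) + ofFun (ρ τ)

/-- `P` is the component of `A` in `𝓔^{0,ε}_{(α+1)}` for the decomposition
`𝓔^ε_{(α+1)} = 𝓔^{0,ε}_{(α+1)} ⊕ 𝓔^ε_{(α+1)} H`. -/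
def IsProj (α : Fin 2) (ε : ℤˣ) (A P : Op) : Prop :=
  IsSeries α ε P ∧ ∃ Q : Op, IsMixed α ε Q ∧ A = P + Q * H τ

/-- The projection `π_{α+1}^ε : 𝓔^ε_{(α+1)} → 𝓔^{0,ε}_{(α+1)}`. -/
def proj (α : Fin 2) (ε : ℤˣ) (A : Op) : Op :=
  haveI : Nonempty Op := ⟨1⟩
  Classical.epsilon (IsProj τ α ε A)

end Lax

end ThreeKP

end

noncomputable section
namespace ThreeKP

/-! Put Ψ₁ = z^{m₁} τ_m(t-[z⁻¹]₁)/τ_m, Ψ₂ = z^{m₂} τ_{m+e}(t-[z]₂)/τ_m and Ψ₃ = (-1)^{m₂} z^{m₁-m₂}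
τ_{m+e₁}(t-[z]₃)/τ_m (the cases j = 0, 1, 2 of `wave`), the exponential factors being left implicit.
The bilinear equation says that the residue pairing of Ψ₁(m) with a dual wave function at m' is the
sum of the corresponding pairings of Ψ₂ and Ψ₃. Only this equation and its first t-derivative, both
at t' = t, are needed (`IsTau.pairing`, `IsTau.pairing_flowD`): the freedom in m' replaces the
freedom in t'.

The relation is linear in the unprimed factor, so it persists when a Laurent polynomial in the
shifts or a time derivative acts there. Conversely, a triple of series that satisfies it for all m',
with the first of degree < M₁, the second of order ≥ M₂ and the third of order ≥ M₁ - M₂, is zero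
(`eq_zero_of_pairing`): suitable m' isolate one term at a time and leave a triangular system. Hence,
if the three series (∂ - B)Ψ_j have these orders, then ∂Ψ_j = BΨ_j for all j at once
(`IsTau.act_wave_eq_flowD`). The truncations that define the four operators B are made for these
order conditions. Since Ψ₁ has leading coefficient 1, an operator in Λ₂ alone has to annihilate
constants, whence the expansions in powers of Δ. The same uniqueness at M = m + e₁ gives HΨ_j = 0
(`IsTau.act_H_wave`); ρ is the factor that cancels the leading term of Ψ₃.

Finally Ψ_j = S z^{lead}, so ∂Ψ_j = BΨ_j becomes C S = ∂S + S M, where M is a power of the shift or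
zero. Here C = B if B contains only the shift of S, and otherwise C is the projection of B, which
acts on Ψ_j as B does because HΨ_j = 0. Differentiating S Λ^q S⁻¹ yields the Lax equation
(`lax_of_sato`). The projections exist because H has degree one in each shift, with coefficients
that are invertible series in the other shift, so that division with remainder works
(`decomposable_Lam`, `eq_zero_of_mul_isSeries`). -/

/-! ### Time derivatives on the field of fractions. -/

theorem ι_injective : Function.Injective ι := IsFractionRing.injective TSeries TField

theorem ι_ne_zero {a : TSeries} (ha : a ≠ 0) : ι a ≠ 0 := fun h => ha (ι_injective (by simpa using h))

theorem exists_eq_div (x : TField) : ∃ a b : TSeries, b ≠ 0 ∧ x = ι a / ι b := by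
  obtain ⟨a, b, hb, rfl⟩ := IsFractionRing.div_surjective (A := TSeries) x
  exact ⟨a, b, nonZeroDivisors.ne_zero hb, rfl⟩

theorem dt_ι (s : TimeIdx) (a : TSeries) : dt s (ι a) = ι (MvPowerSeries.pderiv ℂ s a) := by
  have h := dt_div s a 1 one_ne_zero
  simpa using h

theorem dt_add (s : TimeIdx) (x y : TField) : dt s (x + y) = dt s x + dt s y := by
  obtain ⟨a, b, hb, rfl⟩ := exists_eq_div x
  obtain ⟨c, d, hd, rfl⟩ := exists_eq_div y
  have hb' := ι_ne_zero hb
  have hd' := ι_ne_zero hd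
  have h : ι a / ι b + ι c / ι d = ι (a * d + b * c) / ι (b * d) := by
    simp only [map_add, map_mul]
    field_simp
  rw [h, dt_div s _ _ (mul_ne_zero hb hd), dt_div s _ _ hb, dt_div s _ _ hd]
  simp only [Derivation.leibniz, smul_eq_mul, map_add, map_mul]
  field_simp
  ring

theorem dt_mul (s : TimeIdx) (x y : TField) : dt s (x * y) = x * dt s y + y * dt s x := by
  obtain ⟨a, b, hb, rfl⟩ := exists_eq_div x
  obtain ⟨c, d, hd, rfl⟩ := exists_eq_div y
  have hb' := ι_ne_zero hb
  have hd' := ι_ne_zero hd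
  have h : ι a / ι b * (ι c / ι d) = ι (a * c) / ι (b * d) := by
    simp only [map_mul]
    field_simp
  rw [h, dt_div s _ _ (mul_ne_zero hb hd), dt_div s _ _ hb, dt_div s _ _ hd]
  simp only [Derivation.leibniz, smul_eq_mul, map_add, map_mul]
  field_simp
  ring

/-- The additive map `∂/∂t_s` of the field of fractions. -/
def dtHom (s : TimeIdx) : TField →+ TField := AddMonoidHom.mk' (dt s) (dt_add s)

theorem dtHom_apply (s : TimeIdx) (x : TField) : dtHom s x = dt s x := rfl

@[simp] theorem dt_zero (s : TimeIdx) : dt s 0 = 0 := map_zero (dtHom s)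

@[simp] theorem dt_one (s : TimeIdx) : dt s 1 = 0 := by
  simpa using dt_mul s 1 1

theorem dt_intCast_mul (s : TimeIdx) (c : ℤ) (x : TField) : dt s (c * x) = c * dt s x := by
  have h := map_zsmul (dtHom s) c x
  simpa only [zsmul_eq_mul, dtHom_apply] using h

theorem dt_finsum {κ : Type*} (s : TimeIdx) (f : κ → TField) (hf : f.support.Finite) :
    dt s (∑ᶠ k, f k) = ∑ᶠ k, dt s (f k) :=
  AddMonoidHom.map_finsum (dtHom s) hf

/-! ### Restriction to the diagonal -/

/-- Identifying t' with t is a renaming of variables with two-element fibres, hence admissible for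
power series in infinitely many variables. -/
instance : Filter.TendstoCofinite (Sum.elim id id : TimeIdx ⊕ TimeIdx → TimeIdx) := by
  rw [Filter.tendstoCofinite_iff_finite_preimage_singleton]
  refine fun s => Set.Finite.subset (Set.toFinite {Sum.inl s, Sum.inr s}) ?_
  rintro (x | x) hx <;> simpa using hx

/-- The restriction of a power series in `t`, `t'` to `t' = t`. -/
def diag : TSeries₂ →ₐ[ℂ] TSeries := MvPowerSeries.rename (Sum.elim id id)

/-- The derivative with respect to `t_s`, restricted to `t' = t`. -/
def diagDeriv (s : TimeIdx) : TSeries₂ →+ TSeries :=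
  (diag.toLinearMap ∘ₗ (MvPowerSeries.pderiv ℂ (Sum.inl s)).toLinearMap).toAddMonoidHom

theorem diagDeriv_apply (s : TimeIdx) (G : TSeries₂) :
    diagDeriv s G = diag (MvPowerSeries.pderiv ℂ (Sum.inl s) G) := rfl

theorem diagDeriv_mul (s : TimeIdx) (F G : TSeries₂) :
    diagDeriv s (F * G) = diag F * diagDeriv s G + diag G * diagDeriv s F := by
  simp [diagDeriv_apply, Derivation.leibniz]

/-- The power series `f (t)` as a series in `t`, `t'`. -/
abbrev inlHom : TSeries →ₐ[ℂ] TSeries₂ :=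
  MvPowerSeries.rename (R := ℂ) (Function.Embedding.inl : TimeIdx ↪ TimeIdx ⊕ TimeIdx)

/-- The power series `f (t')` as a series in `t`, `t'`. -/
abbrev inrHom : TSeries →ₐ[ℂ] TSeries₂ :=
  MvPowerSeries.rename (R := ℂ) (Function.Embedding.inr : TimeIdx ↪ TimeIdx ⊕ TimeIdx)

theorem diag_inlHom (f : TSeries) : diag (inlHom f) = f := by
  rw [diag, MvPowerSeries.rename_rename]
  exact MvPowerSeries.rename_id_apply f

theorem diag_inrHom (f : TSeries) : diag (inrHom f) = f := by
  rw [diag, MvPowerSeries.rename_rename]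
  exact MvPowerSeries.rename_id_apply f

theorem pderiv_inlHom (s : TimeIdx) (f : TSeries) :
    MvPowerSeries.pderiv ℂ (Sum.inl s) (inlHom f) = inlHom (MvPowerSeries.pderiv ℂ s f) := by
  ext d
  rw [MvPowerSeries.coeff_pderiv]
  by_cases hd : d ∈ Set.range (Finsupp.mapDomain (M := ℕ) (Sum.inl : TimeIdx → TimeIdx ⊕ TimeIdx))
  · obtain ⟨d, rfl⟩ := hd
    have h1 : Finsupp.mapDomain (Sum.inl : TimeIdx → TimeIdx ⊕ TimeIdx) d
        = Finsupp.embDomain Function.Embedding.inl d := (Finsupp.embDomain_eq_mapDomain Function.Embedding.inl d).symm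
    have h2 : Finsupp.embDomain (Function.Embedding.inl : TimeIdx ↪ TimeIdx ⊕ TimeIdx) d
        + Finsupp.single (Sum.inl s) 1
        = Finsupp.embDomain Function.Embedding.inl (d + Finsupp.single s 1) := by
      rw [Finsupp.embDomain_add, Finsupp.embDomain_single]; rfl
    have h3 : Finsupp.embDomain (Function.Embedding.inl : TimeIdx ↪ TimeIdx ⊕ TimeIdx) d (Sum.inl s)
        = d s := Finsupp.embDomain_apply_self Function.Embedding.inl d s
    rw [h1, h2, MvPowerSeries.coeff_embDomain_rename, MvPowerSeries.coeff_embDomain_rename,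
      MvPowerSeries.coeff_pderiv, h3]
  -- An exponent that involves t' still does so after t_s is added to it, so both coefficients
  -- vanish.
  · rw [MvPowerSeries.coeff_rename_eq_zero Function.Embedding.inl _ hd,
      MvPowerSeries.coeff_rename_eq_zero Function.Embedding.inl, zero_mul]
    rintro ⟨c, hc⟩
    apply hd
    refine ⟨c - Finsupp.single s 1, ?_⟩
    have hcs : Finsupp.single s 1 ≤ c := by
      rw [Finsupp.single_le_iff]
      have := DFunLike.congr_fun hc (Sum.inl s)
      have h5 : Finsupp.mapDomain (Function.Embedding.inl : TimeIdx ↪ TimeIdx ⊕ TimeIdx) c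
          (Sum.inl s) = c s :=
        Finsupp.mapDomain_apply Function.Embedding.inl.injective c s
      rw [h5] at this
      simp at this
      omega
    have h4 := congrArg (Finsupp.mapDomain (Sum.inl : TimeIdx → TimeIdx ⊕ TimeIdx))
      (tsub_add_cancel_of_le hcs)
    rw [Finsupp.mapDomain_add, Finsupp.mapDomain_single] at h4
    exact add_right_cancel (h4.trans hc)

theorem pderiv_inrHom (s : TimeIdx) (f : TSeries) :
    MvPowerSeries.pderiv ℂ (Sum.inl s) (inrHom f) = 0 := by
  ext d
  rw [MvPowerSeries.coeff_pderiv, MvPowerSeries.coeff_rename_eq_zero, zero_mul, map_zero]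
  rintro ⟨c, hc⟩
  have := DFunLike.congr_fun hc (Sum.inl s)
  rw [Finsupp.mapDomain_of_notMem_range _ _ (by simp)] at this
  simp at this

theorem diagDeriv_inlHom (s : TimeIdx) (f : TSeries) :
    diagDeriv s (inlHom f) = MvPowerSeries.pderiv ℂ s f := by
  rw [diagDeriv_apply, pderiv_inlHom, diag_inlHom]

theorem diagDeriv_inrHom (s : TimeIdx) (f : TSeries) : diagDeriv s (inrHom f) = 0 := by
  rw [diagDeriv_apply, pderiv_inrHom, map_zero]

/-! ### The Miwa shift at `w = 0` -/

theorem wCoeff_zero (F : MvPowerSeries (Option TimeIdx) ℂ) :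
    wCoeff 0 F = MvPowerSeries.killCompl Function.Embedding.some F := by
  ext d
  rw [MvPowerSeries.coeff_killCompl]
  change MvPowerSeries.coeff (_ + Finsupp.single none 0) F = _
  rw [Finsupp.single_zero, add_zero]

theorem killCompl_miwaArg (i : Fin 3) (c : ℂ) (s : TimeIdx) :
    MvPowerSeries.killCompl Function.Embedding.some (miwaArg i c s) = MvPowerSeries.X s := by
  have h1 : MvPowerSeries.killCompl (R := ℂ) Function.Embedding.some (MvPowerSeries.X (some s)) =
    MvPowerSeries.X s := MvPowerSeries.killCompl_X s
  have h2 : MvPowerSeries.killCompl (R := ℂ) (Function.Embedding.some : TimeIdx ↪ _)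
      (MvPowerSeries.X none) = 0 := MvPowerSeries.killCompl_X_eq_zero (by simp)
  unfold miwaArg
  split_ifs <;> simp [h1, h2]

/-- Extracting w^0 is setting w = 0, and this turns the Miwa shift into the identity substitution.
-/
theorem coeff_zero_miwa (i : Fin 3) (c : ℂ) (f : TSeries) :
    PowerSeries.coeff 0 (miwa i c f) = f := by
  classical
  rw [miwa, PowerSeries.coeff_mk, wCoeff_zero]
  ext d
  rw [MvPowerSeries.coeff_killCompl, MvPowerSeries.coeff_subst (miwaArg_hasSubst i c)]
  have h (n : TimeIdx →₀ ℕ) : MvPowerSeries.coeff (Finsupp.embDomain Function.Embedding.some d)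
      (n.prod fun s e => miwaArg i c s ^ e) = if d = n then 1 else 0 := by
    rw [← MvPowerSeries.coeff_killCompl, map_finsuppProd]
    simp only [map_pow, killCompl_miwaArg]
    rw [← MvPowerSeries.monomial_one_eq, MvPowerSeries.coeff_monomial]
  rw [finsum_eq_single _ d]
  · simp [h]
  · intro n hn
    simp [h, hn.symm]

/-! ### The exponential factor -/

/-- The weight of an exponent, where `t_k^{(i)}` and `t'_k^{(i)}` have weight `k`. -/
def wt : (TimeIdx ⊕ TimeIdx →₀ ℕ) →+ ℕ :=
  Finsupp.weight (Sum.elim (fun s : TimeIdx => (s.2 : ℕ)) fun s : TimeIdx => (s.2 : ℕ))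

/-- The coefficient of `w^a` has only terms of weight at least `a`. -/
def Decays (E : PowerSeries TSeries₂) : Prop :=
  ∀ a d, MvPowerSeries.coeff d (PowerSeries.coeff a E) ≠ 0 → a ≤ wt d

theorem Decays.mul {E F : PowerSeries TSeries₂} (hE : Decays E) (hF : Decays F) :
    Decays (E * F) := by
  classical
  intro a d h
  rw [PowerSeries.coeff_mul, map_sum] at h
  obtain ⟨p, hp, h⟩ := Finset.exists_ne_zero_of_sum_ne_zero h
  rw [MvPowerSeries.coeff_mul] at h
  obtain ⟨q, hq, h⟩ := Finset.exists_ne_zero_of_sum_ne_zero h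
  have h1 := hE _ _ (left_ne_zero_of_mul h)
  have h2 := hF _ _ (right_ne_zero_of_mul h)
  rw [Finset.HasAntidiagonal.mem_antidiagonal] at hp hq
  rw [← hp, ← hq, map_add]
  omega

theorem decays_one : Decays 1 := by
  intro a d h
  rw [PowerSeries.coeff_one] at h
  split_ifs at h with ha
  · omega
  · simp at h

theorem Decays.pow {E : PowerSeries TSeries₂} (hE : Decays E) (n : ℕ) : Decays (E ^ n) := by
  induction n with
  | zero => simpa using decays_one
  | succ n ih => rw [pow_succ]; exact ih.mul hE

/-- `ξ(t^{(i)} - t'^{(i)}, w)`. -/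
def xi (i : Fin 3) : PowerSeries TSeries₂ :=
  PowerSeries.mk fun k : ℕ =>
    if h : 0 < k then
      (MvPowerSeries.X (Sum.inl (i, ⟨k, h⟩)) - MvPowerSeries.X (Sum.inr (i, ⟨k, h⟩)) : TSeries₂)
    else 0

theorem decays_xi (i : Fin 3) : Decays (xi i) := by
  classical
  intro a d h
  rw [xi, PowerSeries.coeff_mk] at h
  split_ifs at h with ha
  · rw [map_sub, MvPowerSeries.coeff_X, MvPowerSeries.coeff_X] at h
    have : d = Finsupp.single (Sum.inl (i, ⟨a, ha⟩)) 1 ∨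
        d = Finsupp.single (Sum.inr (i, ⟨a, ha⟩)) 1 := by
      by_contra hn
      rw [not_or] at hn
      simp [hn.1, hn.2] at h
    rcases this with rfl | rfl <;> simp [wt, Finsupp.weight_single]
  · simp at h

theorem xi_hasSubst (i : Fin 3) : PowerSeries.HasSubst (xi i) :=
  PowerSeries.HasSubst.of_constantCoeff_zero' (by
    rw [← PowerSeries.coeff_zero_eq_constantCoeff_apply, xi, PowerSeries.coeff_mk]
    simp)

theorem coeff_expXi (i : Fin 3) (a : ℕ) : PowerSeries.coeff a (expXi i) =
    ∑ᶠ n : ℕ, PowerSeries.coeff n (PowerSeries.exp ℂ) • PowerSeries.coeff a (xi i ^ n) :=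
  PowerSeries.coeff_subst' (xi_hasSubst i) _ _

theorem coeff_expXi_finite (i : Fin 3) (a : ℕ) : (Function.support fun n : ℕ =>
    PowerSeries.coeff n (PowerSeries.exp ℂ) • PowerSeries.coeff a (xi i ^ n)).Finite :=
  PowerSeries.coeff_subst_finite' (xi_hasSubst i) _ _

/-- This makes the sums in `laurentCoeff` locally finite: only indices a ≤ `wt d` contribute to the
monomial d. -/
theorem decays_expXi (i : Fin 3) : Decays (expXi i) := by
  intro a d h
  rw [coeff_expXi, finsum_eq_sum _ (coeff_expXi_finite i a), map_sum] at h
  obtain ⟨n, -, h⟩ := Finset.exists_ne_zero_of_sum_ne_zero h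
  rw [MvPowerSeries.coeff_smul] at h
  exact (decays_xi i).pow n a d (right_ne_zero_of_mul h)

theorem diag_coeff_xi (i : Fin 3) (a : ℕ) : diag (PowerSeries.coeff a (xi i)) = 0 := by
  rw [xi, PowerSeries.coeff_mk]
  split_ifs
  · simp [diag]
  · simp

theorem diag_coeff_mul_xi (i : Fin 3) (a : ℕ) (F : PowerSeries TSeries₂) :
    diag (PowerSeries.coeff a (F * xi i)) = 0 := by
  rw [PowerSeries.coeff_mul, map_sum]
  exact Finset.sum_eq_zero fun p _ => by rw [map_mul, diag_coeff_xi, mul_zero]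

theorem diagDeriv_coeff_mul_xi (s : TimeIdx) (i : Fin 3) (a : ℕ) (F : PowerSeries TSeries₂)
    (hF : ∀ b, diag (PowerSeries.coeff b F) = 0) :
    diagDeriv s (PowerSeries.coeff a (F * xi i)) = 0 := by
  rw [PowerSeries.coeff_mul, map_sum]
  exact Finset.sum_eq_zero fun p _ => by
    rw [diagDeriv_mul, diag_coeff_xi, hF, zero_mul, zero_mul, add_zero]

theorem diagDeriv_coeff_xi (s : TimeIdx) (i : Fin 3) (a : ℕ) :
    diagDeriv s (PowerSeries.coeff a (xi i)) = if s.1 = i ∧ (s.2 : ℕ) = a then 1 else 0 := by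
  classical
  rw [xi, PowerSeries.coeff_mk, diagDeriv_apply]
  split_ifs with ha hs hs
  · obtain ⟨rfl, rfl⟩ := hs
    have h1 : MvPowerSeries.pderiv ℂ (Sum.inl s) (MvPowerSeries.X
        (Sum.inl (s.1, (⟨(s.2 : ℕ), ha⟩ : ℕ+))) : TSeries₂) = 1 := MvPowerSeries.pderiv_X_self
    rw [map_sub, MvPowerSeries.pderiv_X_of_ne (j := Sum.inr _) Sum.inr_ne_inl, h1]
    simp
  · rw [map_sub, MvPowerSeries.pderiv_X_of_ne (j := Sum.inr _) Sum.inr_ne_inl,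
      MvPowerSeries.pderiv_X_of_ne]
    · simp
    · intro h
      apply hs
      rw [Sum.inl.injEq] at h
      rw [← h]
      exact ⟨rfl, rfl⟩
  · exact absurd hs.2 (by have := s.2.pos; omega)
  · simp

/-- ξ vanishes at t' = t, so only the constant term of the exponential series survives. -/
theorem diag_coeff_expXi (i : Fin 3) (a : ℕ) :
    diag (PowerSeries.coeff a (expXi i)) = if a = 0 then 1 else 0 := by
  rw [coeff_expXi, ← AlgHom.coe_toAddMonoidHom, AddMonoidHom.map_finsum _ (coeff_expXi_finite i a),
    finsum_eq_single _ 0]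
  · simp only [AlgHom.coe_toAddMonoidHom, map_smul, pow_zero, PowerSeries.coeff_one]
    split_ifs <;> simp
  · intro n hn
    obtain ⟨n, rfl⟩ := Nat.exists_eq_succ_of_ne_zero hn
    simp only [AlgHom.coe_toAddMonoidHom, map_smul, pow_succ, diag_coeff_mul_xi, smul_zero]

/-- A single derivative removes one factor ξ and the others vanish at t' = t, so only the linear
term of the exponential series contributes. -/
theorem diagDeriv_coeff_expXi (s : TimeIdx) (i : Fin 3) (a : ℕ) :
    diagDeriv s (PowerSeries.coeff a (expXi i)) = if s.1 = i ∧ (s.2 : ℕ) = a then 1 else 0 := by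
  have smul (c : ℂ) (G : TSeries₂) : diagDeriv s (c • G) = c • diagDeriv s G := by
    simp [diagDeriv_apply]
  rw [coeff_expXi, AddMonoidHom.map_finsum _ (coeff_expXi_finite i a), finsum_eq_single _ 1]
  · rw [smul, pow_one, diagDeriv_coeff_xi]
    simp [PowerSeries.coeff_exp]
  · intro n hn
    rw [smul]
    rcases n with _ | _ | n
    · rw [pow_zero, PowerSeries.coeff_one]
      split_ifs <;> simp [diagDeriv_apply]
    · exact absurd rfl hn
    · rw [pow_succ, diagDeriv_coeff_mul_xi, smul_zero]
      intro b
      rw [pow_succ, diag_coeff_mul_xi]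

/-! ### Restriction of the bilinear residues to the diagonal -/

/-- The sum defining `laurentCoeff`, cut off. -/
def laurentTrunc (s : ℤ) (E F : PowerSeries TSeries₂) (N : ℕ) : TSeries₂ :=
  ∑ p ∈ Finset.range N ×ˢ Finset.range N,
    if (p.1 : ℤ) - (p.2 : ℤ) = s then PowerSeries.coeff p.1 E * PowerSeries.coeff p.2 F else 0

/-- A contributing pair has a ≤ `wt d` and b = a - s, so a box of side N contains all of them. -/
theorem coeff_laurentCoeff {E : PowerSeries TSeries₂} (hE : Decays E) (s : ℤ)
    (F : PowerSeries TSeries₂) (d : TimeIdx ⊕ TimeIdx →₀ ℕ) (N : ℕ) (hN : wt d + s.natAbs < N) :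
    MvPowerSeries.coeff d (laurentCoeff s E F) =
      MvPowerSeries.coeff d (laurentTrunc s E F N) := by
  classical
  have h : ∀ p : ℕ × ℕ, (if (p.1 : ℤ) - (p.2 : ℤ) = s then
      MvPowerSeries.coeff d (PowerSeries.coeff p.1 E * PowerSeries.coeff p.2 F) else 0) ≠ 0 →
      p ∈ Finset.range N ×ˢ Finset.range N := by
    intro p hp
    split_ifs at hp with hs
    · rw [MvPowerSeries.coeff_mul] at hp
      obtain ⟨q, hq, hp⟩ := Finset.exists_ne_zero_of_sum_ne_zero hp
      have h1 := hE _ _ (left_ne_zero_of_mul hp)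
      rw [Finset.HasAntidiagonal.mem_antidiagonal] at hq
      rw [← hq, map_add] at hN
      simp only [Finset.mem_product, Finset.mem_range]
      omega
    · exact absurd rfl hp
  have e : MvPowerSeries.coeff d (laurentCoeff s E F) = ∑ᶠ p : ℕ × ℕ,
      if (p.1 : ℤ) - (p.2 : ℤ) = s then
        MvPowerSeries.coeff d (PowerSeries.coeff p.1 E * PowerSeries.coeff p.2 F) else 0 := rfl
  rw [e, finsum_eq_sum_of_support_subset _ (s := Finset.range N ×ˢ Finset.range N) h,
    laurentTrunc, map_sum]
  refine Finset.sum_congr rfl fun p _ => ?_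
  split_ifs <;> simp

theorem exists_diag_laurentCoeff {E : PowerSeries TSeries₂} (hE : Decays E) (s : ℤ)
    (F : PowerSeries TSeries₂) (d : TimeIdx →₀ ℕ) : ∃ N₀, ∀ N, N₀ ≤ N →
      MvPowerSeries.coeff d (diag (laurentCoeff s E F)) =
        MvPowerSeries.coeff d (diag (laurentTrunc s E F N)) := by
  -- Finitely many monomials in t, t' restrict to d; one box has to serve all of them.
  refine ⟨(Filter.TendstoCofinite.finite_preimage_singleton
    (Finsupp.mapDomain (Sum.elim id id : TimeIdx ⊕ TimeIdx → TimeIdx)) d).toFinset.sup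
      (fun x => wt x + s.natAbs + 1), fun N hN => ?_⟩
  rw [diag, MvPowerSeries.coeff_rename, MvPowerSeries.coeff_rename]
  refine Finset.sum_congr rfl fun x hx => coeff_laurentCoeff hE s F x N ?_
  have := (Finset.le_sup (f := fun x => wt x + s.natAbs + 1) hx).trans hN
  omega

theorem exists_diagDeriv_laurentCoeff {E : PowerSeries TSeries₂} (hE : Decays E) (σ : TimeIdx)
    (s : ℤ) (F : PowerSeries TSeries₂) (d : TimeIdx →₀ ℕ) : ∃ N₀, ∀ N, N₀ ≤ N →
      MvPowerSeries.coeff d (diagDeriv σ (laurentCoeff s E F)) =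
        MvPowerSeries.coeff d (diagDeriv σ (laurentTrunc s E F N)) := by
  -- The coefficient of x in the derivative is read off at x + t_σ, whose weight is larger.
  refine ⟨(Filter.TendstoCofinite.finite_preimage_singleton
    (Finsupp.mapDomain (Sum.elim id id : TimeIdx ⊕ TimeIdx → TimeIdx)) d).toFinset.sup
      (fun x => wt (x + Finsupp.single (Sum.inl σ) 1) + s.natAbs + 1), fun N hN => ?_⟩
  rw [diagDeriv_apply, diagDeriv_apply, diag, MvPowerSeries.coeff_rename,
    MvPowerSeries.coeff_rename]
  refine Finset.sum_congr rfl fun x hx => ?_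
  have := (Finset.le_sup
    (f := fun x => wt (x + Finsupp.single (Sum.inl σ) 1) + s.natAbs + 1) hx).trans hN
  rw [MvPowerSeries.coeff_pderiv, MvPowerSeries.coeff_pderiv, coeff_laurentCoeff hE s F _ N]
  omega

/-- The coefficient of `z^n`, `n ∈ ℤ`, as an element of the field of fractions. -/
def zCoeff (P : PowerSeries TSeries) (n : ℤ) : TField :=
  if 0 ≤ n then ι (PowerSeries.coeff n.toNat P) else 0

theorem zCoeff_of_neg (P : PowerSeries TSeries) {n : ℤ} (hn : n < 0) : zCoeff P n = 0 :=
  if_neg (by omega)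

theorem zCoeff_natCast (P : PowerSeries TSeries) (n : ℕ) :
    zCoeff P n = ι (PowerSeries.coeff n P) := by
  simp [zCoeff]

/-- Extension by zero to negative degrees makes the product a convolution over all of ℤ, which any
bijection of ℤ can re-index. -/
theorem zCoeff_mul (P Q : PowerSeries TSeries) (n : ℤ) :
    zCoeff (P * Q) n = ∑ᶠ a : ℤ, zCoeff P a * zCoeff Q (n - a) := by
  rcases lt_or_ge n 0 with hn | hn
  · rw [zCoeff_of_neg _ hn, finsum_eq_zero_of_forall_eq_zero]
    intro a
    rcases lt_or_ge a 0 with ha | ha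
    · rw [zCoeff_of_neg _ ha, zero_mul]
    · rw [zCoeff_of_neg Q (by omega), mul_zero]
  · lift n to ℕ using hn
    rw [finsum_eq_sum_of_support_subset _ (s := (Finset.range (n + 1)).map Nat.castEmbedding)]
    · rw [zCoeff_natCast, PowerSeries.coeff_mul, Finset.Nat.sum_antidiagonal_eq_sum_range_succ_mk,
        map_sum, Finset.sum_map]
      refine Finset.sum_congr rfl fun k hk => ?_
      rw [Finset.mem_range] at hk
      rw [Nat.castEmbedding_apply, zCoeff_natCast, map_mul, ← Nat.cast_sub (by omega),
        zCoeff_natCast]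
    · intro a ha
      have h1 : 0 ≤ a := by
        by_contra h
        exact ha (by simp only; rw [zCoeff_of_neg _ (by omega), zero_mul])
      have h2 : a ≤ n := by
        by_contra h
        exact ha (by simp only; rw [zCoeff_of_neg Q (by omega), mul_zero])
      lift a to ℕ using h1
      simpa using h2

/-- The coefficientwise derivative. -/
def pderivCoeff (s : TimeIdx) (P : PowerSeries TSeries) : PowerSeries TSeries :=
  PowerSeries.mk fun n => MvPowerSeries.pderiv ℂ s (PowerSeries.coeff n P)

theorem dt_zCoeff (s : TimeIdx) (P : PowerSeries TSeries) (n : ℤ) :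
    dt s (zCoeff P n) = zCoeff (pderivCoeff s P) n := by
  unfold zCoeff
  split_ifs
  · rw [dt_ι, pderivCoeff, PowerSeries.coeff_mk]
  · exact dt_zero s

theorem diag_coeff_miwaProd (i : Fin 3) (f g : TSeries) (n : ℕ) :
    diag (PowerSeries.coeff n (miwaProd i f g)) =
      PowerSeries.coeff n (miwa i (-1) f * miwa i 1 g) := by
  rw [miwaProd, PowerSeries.coeff_mul, PowerSeries.coeff_mul, map_sum]
  refine Finset.sum_congr rfl fun p _ => ?_
  rw [PowerSeries.coeff_map, PowerSeries.coeff_map, map_mul]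
  exact congrArg₂ (· * ·) (diag_inlHom _) (diag_inrHom _)

theorem diagDeriv_coeff_miwaProd (s : TimeIdx) (i : Fin 3) (f g : TSeries) (n : ℕ) :
    diagDeriv s (PowerSeries.coeff n (miwaProd i f g)) =
      PowerSeries.coeff n (pderivCoeff s (miwa i (-1) f) * miwa i 1 g) := by
  rw [miwaProd, PowerSeries.coeff_mul, PowerSeries.coeff_mul, map_sum]
  refine Finset.sum_congr rfl fun p _ => ?_
  rw [PowerSeries.coeff_map, PowerSeries.coeff_map, diagDeriv_mul, pderivCoeff,
    PowerSeries.coeff_mk, mul_comm (MvPowerSeries.pderiv ℂ s _)]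
  refine (congrArg₂ (· + ·) (congrArg₂ (· * ·) (diag_inlHom _) (diagDeriv_inrHom s _))
    (congrArg₂ (· * ·) (diag_inrHom _) (diagDeriv_inlHom s _))).trans ?_
  rw [mul_zero, zero_add]

theorem sum_box_single (N : ℕ) (s : ℤ) (a : ℕ) (G : ℕ → TSeries) (hN : a + s.natAbs < N) :
    ∑ p ∈ Finset.range N ×ˢ Finset.range N,
      (if (p.1 : ℤ) - (p.2 : ℤ) = s then (if a = p.1 then G p.2 else 0) else 0) =
    if 0 ≤ a - s then G (a - s).toNat else 0 := by
  rw [Finset.sum_product, Finset.sum_eq_single a]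
  · simp only [if_true]
    split_ifs with h
    · rw [Finset.sum_eq_single ((a : ℤ) - s).toNat]
      · rw [if_pos (by omega)]
      · intro b _ hb
        rw [if_neg (by omega)]
      · intro hb
        rw [Finset.mem_range] at hb
        omega
    · exact Finset.sum_eq_zero fun b _ => if_neg (by omega)
  · intro b _ hb
    exact Finset.sum_eq_zero fun c _ => by rw [if_neg (Ne.symm hb), ite_self]
  · intro h
    rw [Finset.mem_range] at h
    omega

/-- The exponential is 1 on the diagonal, so a = 0 and b = -s. -/
theorem ι_diag_laurentCoeff (s : ℤ) (i : Fin 3) (f g : TSeries) :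
    ι (diag (laurentCoeff s (expXi i) (miwaProd i f g))) =
      zCoeff (miwa i (-1) f * miwa i 1 g) (-s) := by
  have key : diag (laurentCoeff s (expXi i) (miwaProd i f g)) =
      if 0 ≤ -s then PowerSeries.coeff (-s).toNat (miwa i (-1) f * miwa i 1 g) else 0 := by
    ext d
    obtain ⟨N₀, hN⟩ := exists_diag_laurentCoeff (decays_expXi i) s (miwaProd i f g) d
    rw [hN (N₀ + s.natAbs + 1) (by omega)]
    congr 1
    rw [laurentTrunc, map_sum]
    have := sum_box_single (N₀ + s.natAbs + 1) s 0
      (fun n => PowerSeries.coeff n (miwa i (-1) f * miwa i 1 g)) (by omega)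
    simp only [Nat.cast_zero, zero_sub] at this
    rw [← this]
    refine Finset.sum_congr rfl fun p _ => ?_
    rw [apply_ite diag, map_mul, diag_coeff_expXi, diag_coeff_miwaProd, map_zero]
    simp [eq_comm]
  rw [key, zCoeff]
  split_ifs <;> simp

/-- The derivative falls either on the factor in t, with a = 0 and b = -s, or on the exponential,
with a = k and b = k - s, where k is the number of the time. -/
theorem ι_diagDeriv_laurentCoeff (σ : TimeIdx) (s : ℤ) (i : Fin 3) (f g : TSeries) :
    ι (diagDeriv σ (laurentCoeff s (expXi i) (miwaProd i f g))) =
      zCoeff (pderivCoeff σ (miwa i (-1) f) * miwa i 1 g) (-s) +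
        if σ.1 = i then zCoeff (miwa i (-1) f * miwa i 1 g) (σ.2 - s) else 0 := by
  have key : diagDeriv σ (laurentCoeff s (expXi i) (miwaProd i f g)) =
      (if 0 ≤ -s then PowerSeries.coeff (-s).toNat (pderivCoeff σ (miwa i (-1) f) * miwa i 1 g)
        else 0) +
      if σ.1 = i then (if 0 ≤ ((σ.2 : ℕ) : ℤ) - s then
        PowerSeries.coeff (((σ.2 : ℕ) : ℤ) - s).toNat (miwa i (-1) f * miwa i 1 g) else 0)
      else 0 := by
    ext d
    obtain ⟨N₀, hN⟩ := exists_diagDeriv_laurentCoeff (decays_expXi i) σ s (miwaProd i f g) d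
    rw [hN (N₀ + s.natAbs + σ.2 + 1) (by omega)]
    congr 1
    rw [laurentTrunc, map_sum]
    have h0 := sum_box_single (N₀ + s.natAbs + σ.2 + 1) s 0
      (fun n => PowerSeries.coeff n (pderivCoeff σ (miwa i (-1) f) * miwa i 1 g)) (by omega)
    have h1 := sum_box_single (N₀ + s.natAbs + σ.2 + 1) s σ.2
      (fun n => PowerSeries.coeff n (miwa i (-1) f * miwa i 1 g)) (by omega)
    simp only [Nat.cast_zero, zero_sub] at h0
    rw [← h0, ← h1]
    have h2 (P : Prop) [Decidable P] (x : TSeries) : (if P then x else 0) =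
      (if P then (1 : TSeries) else 0) * x := by split_ifs <;> simp
    rw [h2 (σ.1 = i), Finset.mul_sum, ← Finset.sum_add_distrib]
    refine Finset.sum_congr rfl fun p _ => ?_
    rw [apply_ite (diagDeriv σ), diagDeriv_mul, diag_coeff_expXi, diagDeriv_coeff_expXi,
      diag_coeff_miwaProd, diagDeriv_coeff_miwaProd, map_zero]
    by_cases hi : σ.1 = i <;> by_cases hp : (p.1 : ℤ) - p.2 = s <;>
      simp [hi, hp, eq_comm (a := (0 : ℕ))]
  rw [key, map_add, zCoeff, zCoeff]
  congr 1
  · split_ifs <;> simp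
  · split_ifs <;> simp

/-! ### Wave functions and their duals -/

/-- The direction in which the three wave functions are expanded. -/
def dir : Fin 3 → ℤˣ := ![-1, 1, 1]

/-- The exponent of the leading power of `z` in the three wave functions. -/
def lead (j : Fin 3) (m : Lattice) : ℤ := ![m 0, m 1, m 0 - m 1] j

/-- The lattice shift in the three wave functions. -/
def latShift : Fin 3 → Lattice := ![0, e, e₁]

/-- The sign in the three wave functions. -/
def sgn (j : Fin 3) (m : Lattice) : ℤ := ![1, 1, (Int.negOnePow (m 1) : ℤ)] j

variable (τ : Lattice → TSeries)

/-- The coefficient of `z^n` in the `j`-th wave function at `m`. -/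
def wave (j : Fin 3) (n : ℤ) (m : Lattice) : TField :=
  sgn j m * (zCoeff (miwa j (-1) (τ (m + latShift j))) (dir j * (n - lead j m)) / ι (τ m))

/-- The coefficient of `z^(-1-n)` in the `j`-th dual wave function at `m`. -/
def dual (j : Fin 3) (m : Lattice) (n : ℤ) : TField :=
  sgn j m * zCoeff (miwa j 1 (τ (m - latShift j))) (- dir j * (1 + (n - lead j m)))

/-- The action of `∂/∂t_σ` on the `j`-th wave function, including the exponential factor. -/
def flowD (σ : TimeIdx) (j : Fin 3) (φ : ℤ → Lattice → TField) (n : ℤ) (m : Lattice) : TField :=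
  dt σ (φ n m) + if σ.1 = j then φ (n + dir j * (σ.2 : ℕ)) m else 0

variable {τ}

theorem sgn_cast_sq (j : Fin 3) (m : Lattice) : (sgn j m : TField) * (sgn j m : TField) = 1 := by
  rw [← Int.cast_mul]
  have h : sgn j m * sgn j m = 1 := by
    fin_cases j <;> simp [sgn]
  rw [h, Int.cast_one]

theorem sgn_cast_ne_zero (j : Fin 3) (m : Lattice) : (sgn j m : TField) ≠ 0 :=
  left_ne_zero_of_mul (by rw [sgn_cast_sq]; exact one_ne_zero)

theorem dir_mul_self (j : Fin 3) : (dir j : ℤ) * (dir j : ℤ) = 1 := by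
  rw [← Units.val_mul, Int.units_mul_self, Units.val_one]

theorem dir_cases (j : Fin 3) : (dir j : ℤ) = 1 ∨ (dir j : ℤ) = -1 := by
  rcases Int.units_eq_one_or (dir j) with h | h <;> simp [h]

theorem dt_div_of_ne (s : TimeIdx) (x : TField) {y : TField} (hy : y ≠ 0) :
    dt s (x / y) = dt s x / y - x * (dt s y / y ^ 2) := by
  have h := dt_mul s (x / y) y
  rw [div_mul_cancel₀ _ hy] at h
  rw [h]
  field_simp
  ring

theorem zCoeff_mul_support_finite (P Q : PowerSeries TSeries) (k n : ℤ) :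
    (Function.support fun a : ℤ => zCoeff P (a + k) * zCoeff Q (n - a)).Finite := by
  refine (Set.finite_Icc (-k) n).subset fun a ha => ⟨?_, ?_⟩
  · by_contra h
    exact ha (by simp only; rw [zCoeff_of_neg _ (by omega), zero_mul])
  · by_contra h
    exact ha (by simp only; rw [zCoeff_of_neg Q (by omega), mul_zero])

theorem zCoeff_mul_shift (P Q : PowerSeries TSeries) (k n : ℤ) :
    ∑ᶠ a : ℤ, zCoeff P (a + k) * zCoeff Q (n - a) = zCoeff (P * Q) (n + k) := by
  rw [zCoeff_mul]
  conv_rhs => rw [← finsum_comp_equiv (Equiv.addRight k)]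
  refine finsum_congr fun a => ?_
  rw [Equiv.coe_addRight, add_sub_add_right_eq_sub]

/-- The bijection `n ↦ δ (n - c)` of `ℤ`. -/
def affineEquiv (δ : ℤˣ) (c : ℤ) : ℤ ≃ ℤ where
  toFun n := δ * (n - c)
  invFun a := δ * a + c
  left_inv n := by
    have h : (δ : ℤ) * δ = 1 := by rw [← Units.val_mul, Int.units_mul_self, Units.val_one]
    linear_combination (n - c) * h
  right_inv a := by
    have h : (δ : ℤ) * δ = 1 := by rw [← Units.val_mul, Int.units_mul_self, Units.val_one]
    linear_combination a * h

/-- The argument of the residue of the product of the wave function at `m` with the dual wave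
function at `m'`. -/
def resArg (j : Fin 3) (m m' : Lattice) : ℤ := -dir j * (1 + lead j m - lead j m')

/-- The product of the two tau functions in the `j`-th term of the bilinear equation. -/
def tauProd (τ : Lattice → TSeries) (j : Fin 3) (m m' : Lattice) : PowerSeries TSeries :=
  miwa j (-1) (τ (m + latShift j)) * miwa j 1 (τ (m' - latShift j))

/-- The same product, with the first factor differentiated. -/
def tauProdDeriv (τ : Lattice → TSeries) (σ : TimeIdx) (j : Fin 3) (m m' : Lattice) :
    PowerSeries TSeries :=
  pderivCoeff σ (miwa j (-1) (τ (m + latShift j))) * miwa j 1 (τ (m' - latShift j))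

/-- The sign in the `j`-th term of the bilinear equation. -/
def sgnProd (j : Fin 3) (m m' : Lattice) : TField := sgn j m * sgn j m'

theorem dual_eq (j : Fin 3) (m m' : Lattice) (n : ℤ) : dual τ j m' n =
    sgn j m' * zCoeff (miwa j 1 (τ (m' - latShift j))) (resArg j m m' - dir j * (n - lead j m)) := by
  rw [dual, resArg]
  congr 2
  ring

/-- The substitution a = `dir j` (n - `lead j m`) turns the residue pairing into one coefficient of
a product of two power series. -/
theorem finsum_wave_mul_dual (j : Fin 3) (m m' : Lattice) :
    ∑ᶠ n, wave τ j n m * dual τ j m' n =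
      sgnProd j m m' * (zCoeff (tauProd τ j m m') (resArg j m m') / ι (τ m)) := by
  rw [tauProd, zCoeff_mul, div_eq_mul_inv, mul_comm _ (ι (τ m))⁻¹, ← mul_assoc, ← smul_eq_mul,
    smul_finsum]
  conv_rhs => rw [← finsum_comp_equiv (affineEquiv (dir j) (lead j m))]
  refine finsum_congr fun n => ?_
  rw [dual_eq j m, wave, sgnProd, smul_eq_mul]
  simp only [affineEquiv, Equiv.coe_fn_mk]
  ring

theorem flowD_wave (hτ : ∀ m, τ m ≠ 0) (σ : TimeIdx) (j : Fin 3) (n : ℤ) (m : Lattice) :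
    flowD σ j (wave τ j) n m = sgn j m *
      (zCoeff (pderivCoeff σ (miwa j (-1) (τ (m + latShift j)))) (dir j * (n - lead j m)) / ι (τ m)
      - zCoeff (miwa j (-1) (τ (m + latShift j))) (dir j * (n - lead j m)) *
        (dt σ (ι (τ m)) / ι (τ m) ^ 2)
      + if σ.1 = j then zCoeff (miwa j (-1) (τ (m + latShift j)))
        (dir j * (n - lead j m) + (σ.2 : ℕ)) / ι (τ m) else 0) := by
  rw [flowD, wave, dt_intCast_mul, dt_div_of_ne _ _ (ι_ne_zero (hτ m)), dt_zCoeff, mul_add]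
  congr 1
  rw [mul_ite, mul_zero, wave]
  have : (dir j : ℤ) * (n + dir j * (σ.2 : ℕ) - lead j m) =
      dir j * (n - lead j m) + (σ.2 : ℕ) := by
    have := dir_mul_self j
    linear_combination ((σ.2 : ℕ) : ℤ) * this
  rw [this]

/-- The three terms come from differentiating the numerator, the denominator τ_m and the exponential
factor. -/
theorem finsum_flowD_wave_mul_dual (hτ : ∀ m, τ m ≠ 0) (σ : TimeIdx) (j : Fin 3)
    (m m' : Lattice) : ∑ᶠ n, flowD σ j (wave τ j) n m * dual τ j m' n =
      sgnProd j m m' * (zCoeff (tauProdDeriv τ σ j m m') (resArg j m m') / ι (τ m)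
        - zCoeff (tauProd τ j m m') (resArg j m m') * (dt σ (ι (τ m)) / ι (τ m) ^ 2)
        + if σ.1 = j then zCoeff (tauProd τ j m m') (resArg j m m' + (σ.2 : ℕ)) / ι (τ m)
          else 0) := by
  have f1 := zCoeff_mul_support_finite (pderivCoeff σ (miwa j (-1) (τ (m + latShift j))))
    (miwa j 1 (τ (m' - latShift j))) 0 (resArg j m m')
  have f2 := zCoeff_mul_support_finite (miwa j (-1) (τ (m + latShift j)))
    (miwa j 1 (τ (m' - latShift j))) 0 (resArg j m m')
  have f3 := zCoeff_mul_support_finite (miwa j (-1) (τ (m + latShift j)))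
    (miwa j 1 (τ (m' - latShift j))) (σ.2 : ℕ) (resArg j m m')
  have g1 := zCoeff_mul_shift (pderivCoeff σ (miwa j (-1) (τ (m + latShift j))))
    (miwa j 1 (τ (m' - latShift j))) 0 (resArg j m m')
  have g2 := zCoeff_mul_shift (miwa j (-1) (τ (m + latShift j)))
    (miwa j 1 (τ (m' - latShift j))) 0 (resArg j m m')
  have g3 := zCoeff_mul_shift (miwa j (-1) (τ (m + latShift j)))
    (miwa j 1 (τ (m' - latShift j))) (σ.2 : ℕ) (resArg j m m')
  simp only [add_zero] at f1 f2 g1 g2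
  rw [tauProdDeriv, tauProd, ← g1, ← g2, ← g3]
  have scal (c : TField) (f : ℤ → TField) : (∑ᶠ a, f a) * c = ∑ᶠ a, c * f a := by
    rw [mul_comm, ← smul_eq_mul, smul_finsum]; simp only [smul_eq_mul]
  have sfin (c : TField) {f : ℤ → TField} (hf : f.support.Finite) :
      (Function.support fun a => c * f a).Finite :=
    hf.subset fun a ha => right_ne_zero_of_mul ha
  have h3 : (if σ.1 = j then (∑ᶠ a, zCoeff (miwa j (-1) (τ (m + latShift j))) (a + (σ.2 : ℕ)) *
      zCoeff (miwa j 1 (τ (m' - latShift j))) (resArg j m m' - a)) / ι (τ m) else 0) =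
      (∑ᶠ a, zCoeff (miwa j (-1) (τ (m + latShift j))) (a + (σ.2 : ℕ)) *
      zCoeff (miwa j 1 (τ (m' - latShift j))) (resArg j m m' - a)) *
        (if σ.1 = j then (ι (τ m))⁻¹ else 0) := by
    split_ifs <;> simp [div_eq_mul_inv]
  rw [h3, div_eq_mul_inv, scal, scal, scal, ← finsum_sub_distrib (sfin _ f1) (sfin _ f2),
    ← finsum_add_distrib (((sfin _ f1).union (sfin _ f2)).subset (Function.support_sub _ _))
      (sfin _ f3), mul_comm, scal]
  conv_rhs => rw [← finsum_comp_equiv (affineEquiv (dir j) (lead j m))]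
  refine finsum_congr fun n => ?_
  rw [flowD_wave hτ, dual_eq j m, sgnProd]
  simp only [affineEquiv, Equiv.coe_fn_mk]
  split_ifs <;> ring

theorem IsTau.zCoeff_bilinear (hτ : IsTau τ) (m m' : Lattice) :
    sgnProd 0 m m' * zCoeff (tauProd τ 0 m m') (resArg 0 m m') =
      sgnProd 1 m m' * zCoeff (tauProd τ 1 m m') (resArg 1 m m') +
      sgnProd 2 m m' * zCoeff (tauProd τ 2 m m') (resArg 2 m m') := by
  have h := congrArg (fun G => ι (diag G)) (hτ.bilinear m m')
  simp only [map_add, map_mul, map_intCast, resInfty, resZero, ι_diag_laurentCoeff,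
    Int.negOnePow_add, Units.val_mul, Int.cast_mul] at h
  simp only [sgnProd, tauProd, resArg, sgn, dir, lead, latShift, Matrix.cons_val, add_zero, sub_zero,
    Int.cast_one, one_mul, Units.val_neg, Units.val_one]
  refine Eq.trans (congrArg _ ?_) (h.trans (congrArg₂ _ (congrArg _ ?_) (congrArg _ (congrArg _ ?_))))
    <;> ring

theorem IsTau.zCoeff_bilinear_deriv (hτ : IsTau τ) (σ : TimeIdx) (m m' : Lattice) :
    sgnProd 0 m m' * (zCoeff (tauProdDeriv τ σ 0 m m') (resArg 0 m m') +
      if σ.1 = 0 then zCoeff (tauProd τ 0 m m') (resArg 0 m m' + (σ.2 : ℕ)) else 0) =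
    sgnProd 1 m m' * (zCoeff (tauProdDeriv τ σ 1 m m') (resArg 1 m m') +
      if σ.1 = 1 then zCoeff (tauProd τ 1 m m') (resArg 1 m m' + (σ.2 : ℕ)) else 0) +
    sgnProd 2 m m' * (zCoeff (tauProdDeriv τ σ 2 m m') (resArg 2 m m') +
      if σ.1 = 2 then zCoeff (tauProd τ 2 m m') (resArg 2 m m' + (σ.2 : ℕ)) else 0) := by
  have h := congrArg (fun G => ι (diagDeriv σ G)) (hτ.bilinear m m')
  simp only [← zsmul_eq_mul, map_add, map_zsmul, resInfty, resZero] at h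
  simp only [ι_diagDeriv_laurentCoeff, zsmul_eq_mul,
    Int.negOnePow_add, Units.val_mul, Int.cast_mul] at h
  have a0 : resArg 0 m m' = -(-1 - (m 0 - m' 0)) := by simp [resArg, lead, dir]; ring
  have a1 : resArg 1 m m' = -(m 1 - m' 1 + 1) := by simp [resArg, lead, dir]; ring
  have a2 : resArg 2 m m' = -(m 0 - m 1 - m' 0 + m' 1 + 1) := by simp [resArg, lead, dir]; ring
  rw [a0, a1, a2]
  simp only [neg_add_eq_sub]
  simp only [sgnProd, tauProd, tauProdDeriv, sgn, latShift, Matrix.cons_val, add_zero, sub_zero,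
    Int.cast_one, one_mul]
  exact h

theorem IsTau.pairing (hτ : IsTau τ) (m m' : Lattice) :
    ∑ᶠ n, wave τ 0 n m * dual τ 0 m' n =
      ∑ᶠ n, wave τ 1 n m * dual τ 1 m' n + ∑ᶠ n, wave τ 2 n m * dual τ 2 m' n := by
  simp only [finsum_wave_mul_dual]
  linear_combination hτ.zCoeff_bilinear m m' / ι (τ m)

theorem IsTau.pairing_flowD (hτ : IsTau τ) (σ : TimeIdx) (m m' : Lattice) :
    ∑ᶠ n, flowD σ 0 (wave τ 0) n m * dual τ 0 m' n =
      ∑ᶠ n, flowD σ 1 (wave τ 1) n m * dual τ 1 m' n +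
        ∑ᶠ n, flowD σ 2 (wave τ 2) n m * dual τ 2 m' n := by
  simp only [finsum_flowD_wave_mul_dual hτ.ne_zero]
  have h0 := hτ.zCoeff_bilinear m m'
  have h1 := hτ.zCoeff_bilinear_deriv σ m m'
  have hd (P : Prop) [Decidable P] (x y : TField) : (if P then x / y else 0) =
    (if P then x else 0) / y := by split_ifs <;> simp
  simp only [hd]
  -- Differentiating the denominator adds the same multiple of the undifferentiated equation to all
  -- three terms.
  linear_combination h1 / ι (τ m) - h0 * (dt σ (ι (τ m)) / ι (τ m) ^ 2)

theorem wave_eq_zero (j : Fin 3) {n : ℤ} {m : Lattice} (h : (dir j : ℤ) * (n - lead j m) < 0) :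
    wave τ j n m = 0 := by
  rw [wave, zCoeff_of_neg _ h, zero_div, mul_zero]

theorem dual_eq_zero (j : Fin 3) {n : ℤ} {m : Lattice}
    (h : 0 < (dir j : ℤ) * (1 + (n - lead j m))) : dual τ j m n = 0 := by
  rw [dual, zCoeff_of_neg _ (by linarith), mul_zero]

theorem wave_lead (j : Fin 3) (m : Lattice) :
    wave τ j (lead j m) m = sgn j m * (ι (τ (m + latShift j)) / ι (τ m)) := by
  rw [wave, sub_self, mul_zero]
  have := zCoeff_natCast (miwa j (-1) (τ (m + latShift j))) 0
  rw [coeff_zero_miwa] at this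
  rw [← this, Nat.cast_zero]

theorem dual_lead (j : Fin 3) (m : Lattice) :
    dual τ j m (lead j m - 1) = sgn j m * ι (τ (m - latShift j)) := by
  rw [dual]
  have := zCoeff_natCast (miwa j 1 (τ (m - latShift j))) 0
  rw [coeff_zero_miwa] at this
  rw [← this, Nat.cast_zero]
  congr 2
  ring

theorem dual_lead_ne_zero (hτ : ∀ m, τ m ≠ 0) (j : Fin 3) (m : Lattice) {n : ℤ}
    (h : n = lead j m - 1) : dual τ j m n ≠ 0 := by
  rw [h, dual_lead]
  exact mul_ne_zero (sgn_cast_ne_zero j m) (ι_ne_zero (hτ _))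

/-! ### Uniqueness of solutions of the bilinear equation -/

/-- Forward substitution: once U vanishes below r, equation r contains only the unknown U r, with
the nonzero pivot χ r r. -/
theorem eq_zero_of_triangular (U : ℤ → TField) (χ : ℤ → ℤ → TField) (c : ℤ)
    (hU : ∀ n < c, U n = 0) (hχ : ∀ r n, r < n → χ r n = 0) (hχr : ∀ r, χ r r ≠ 0)
    (h : ∀ r, c ≤ r → ∑ᶠ n, U n * χ r n = 0) : U = 0 := by
  have key : ∀ k : ℕ, ∀ n < c + k, U n = 0 := by
    intro k
    induction k with
    | zero => simpa using hU
    | succ k ih =>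
      intro n hn
      rcases lt_or_ge n (c + k) with hn' | hn'
      · exact ih n hn'
      · have hr := h n (by omega)
        rw [finsum_eq_single _ n] at hr
        · exact (mul_eq_zero.mp hr).resolve_right (hχr n)
        · intro x hx
          rcases lt_or_gt_of_ne hx with hx | hx
          · rw [ih x (by push_cast at hn; omega), zero_mul]
          · rw [hχ n x hx, mul_zero]
  funext n
  exact key (n - c + 1).toNat n (by omega)

theorem eq_zero_of_triangular' (U : ℤ → TField) (χ : ℤ → ℤ → TField) (c : ℤ)
    (hU : ∀ n, c < n → U n = 0) (hχ : ∀ r n, n < r → χ r n = 0) (hχr : ∀ r, χ r r ≠ 0)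
    (h : ∀ r ≤ c, ∑ᶠ n, U n * χ r n = 0) : U = 0 := by
  have := eq_zero_of_triangular (fun n => U (-n)) (fun r n => χ (-r) (-n)) (-c)
    (fun n hn => hU _ (by omega)) (fun r n hn => hχ _ _ (by omega)) (fun r => hχr _)
    (fun r hr => by
      rw [← h (-r) (by omega)]
      exact finsum_comp_equiv (Equiv.neg ℤ) (f := fun n => U n * χ (-r) n))
  funext n
  simpa using congrFun this (-n)

/-- A product of two series of total order ≥ 0 at z = 0 has no residue. Choosing m' so that this
removes the unwanted terms isolates U 0, then U 2, then U 1; the nonzero leading coefficients of the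
dual functions are the pivots. -/
theorem eq_zero_of_pairing (hτ : ∀ m, τ m ≠ 0) (U : Fin 3 → ℤ → TField) (M : Lattice)
    (h0 : ∀ n, lead 0 M ≤ n → U 0 n = 0) (h1 : ∀ n < lead 1 M, U 1 n = 0)
    (h2 : ∀ n < lead 2 M, U 2 n = 0)
    (h : ∀ m', ∑ᶠ n, U 0 n * dual τ 0 m' n =
      ∑ᶠ n, U 1 n * dual τ 1 m' n + ∑ᶠ n, U 2 n * dual τ 2 m' n) : ∀ j, U j = 0 := by
  simp only [lead, Matrix.cons_val] at h0 h1 h2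
  -- If m'₂ = M₂, the orders M₂ of U 1 and -M₂ of its dual cancel, whatever m'₁ is.
  have z1 (x : ℤ) : ∑ᶠ n, U 1 n * dual τ 1 ![x, M 1] n = 0 := by
    refine finsum_eq_zero_of_forall_eq_zero fun n => ?_
    rcases lt_or_ge n (M 1) with hn | hn
    · rw [h1 n hn, zero_mul]
    · rw [dual_eq_zero 1 (by simp [dir, lead]; omega), mul_zero]
  have u0 : U 0 = 0 := by
    refine eq_zero_of_triangular' (U 0) (fun r n => dual τ 0 ![r + 1, M 1] n) (M 0 - 1)
      (fun n hn => h0 n (by omega)) (fun r n hn => dual_eq_zero 0 (by simp [dir, lead]; omega))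
      (fun r => dual_lead_ne_zero hτ 0 _ (by simp [lead])) fun r hr => ?_
    rw [h, z1, zero_add]
    -- The third product has order at least M₁ - r - 1, which is nonnegative as r ≤ M₁ - 1.
    refine finsum_eq_zero_of_forall_eq_zero fun n => ?_
    rcases lt_or_ge n (M 0 - M 1) with hn | hn
    · rw [h2 n hn, zero_mul]
    · rw [dual_eq_zero 2 (by simp [dir, lead]; omega), mul_zero]
  have u2 : U 2 = 0 := by
    -- Since U 0 is gone, m'₁ is unrestricted; this choice places the pivot of the third dual
    -- function at r.
    refine eq_zero_of_triangular (U 2) (fun r n => dual τ 2 ![r + 1 + M 1, M 1] n) (M 0 - M 1)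
      h2 (fun r n hn => dual_eq_zero 2 (by simp [dir, lead]; omega))
      (fun r => dual_lead_ne_zero hτ 2 _ (by simp [lead])) fun r hr => ?_
    have := h ![r + 1 + M 1, M 1]
    simpa [z1, u0] using this.symm
  have u1 : U 1 = 0 := by
    refine eq_zero_of_triangular (U 1) (fun r n => dual τ 1 ![0, r + 1] n) (M 1)
      h1 (fun r n hn => dual_eq_zero 1 (by simp [dir, lead]; omega))
      (fun r => dual_lead_ne_zero hτ 1 _ (by simp [lead])) fun r hr => ?_
    have := h ![0, r + 1]
    simpa [u2, u0] using this.symm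
  intro j
  fin_cases j
  · exact u0
  · exact u1
  · exact u2

/-- Fubini for finite sums under joint finiteness. It yields associativity of products,
compatibility of actions with products, and the exchange of an action with the residue pairing. -/
theorem finsum_mul_finsum_assoc {κ κ' F : Type*} [Field F] (f : κ → F) (g : κ → κ' → F)
    (h : κ' → F) (hfin : {p : κ × κ' | f p.1 * (g p.1 p.2 * h p.2) ≠ 0}.Finite) :
    ∑ᶠ k, (∑ᶠ l, f l * g l k) * h k = ∑ᶠ l, f l * ∑ᶠ k, g l k * h k := by
  have e1 (k : κ') : (∑ᶠ l, f l * g l k) * h k = ∑ᶠ l, f l * (g l k * h k) := by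
    rw [mul_comm, ← smul_eq_mul, smul_finsum]
    refine finsum_congr fun l => ?_
    rw [smul_eq_mul]; ring
  have e2 (l : κ) : f l * ∑ᶠ k, g l k * h k = ∑ᶠ k, f l * (g l k * h k) := by
    rw [← smul_eq_mul, smul_finsum]; rfl
  rw [finsum_congr e1, finsum_congr e2,
    ← finsum_curry (fun p : κ × κ' => f p.1 * (g p.1 p.2 * h p.2)) hfin,
    ← finsum_comp_equiv (Equiv.prodComm κ' κ), finsum_curry]
  · rfl
  · exact hfin.preimage (Equiv.prodComm κ' κ).injective.injOn

/-! ### Coefficients of formal operators. -/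

namespace Op

@[ext] theorem ext {A B : Op} (h : ∀ j m, A j m = B j m) : A = B := funext fun j => funext (h j)

theorem add_apply (A B : Op) (j m : Lattice) : (A + B) j m = A j m + B j m := rfl
theorem sub_apply (A B : Op) (j m : Lattice) : (A - B) j m = A j m - B j m := rfl
theorem neg_apply (A : Op) (j m : Lattice) : (-A) j m = -A j m := rfl
theorem zero_apply (j m : Lattice) : (0 : Op) j m = 0 := rfl
theorem one_apply (j m : Lattice) : (1 : Op) j m = if j = 0 then 1 else 0 := rfl
theorem mul_apply (A B : Op) (j m : Lattice) :
    (A * B) j m = ∑ᶠ k : Lattice, A k m * B (j - k) (m + k) := rfl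

theorem ne_zero_of_apply {A : Op} {j m : Lattice} (h : A j m ≠ 0) : A j ≠ 0 :=
  fun h0 => h (by rw [h0]; rfl)

theorem exists_apply_ne_zero {A : Op} {j : Lattice} (h : A j ≠ 0) : ∃ m, A j m ≠ 0 := by
  by_contra hn
  push Not at hn
  exact h (funext hn)

theorem exists_of_mul_ne_zero {A B : Op} {j : Lattice} (h : (A * B) j ≠ 0) :
    ∃ k, A k ≠ 0 ∧ B (j - k) ≠ 0 := by
  obtain ⟨m, hm⟩ := exists_apply_ne_zero h
  rw [mul_apply] at hm
  obtain ⟨k, hk⟩ : ∃ k, A k m * B (j - k) (m + k) ≠ 0 := by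
    by_contra hn
    push Not at hn
    exact hm (finsum_eq_zero_of_forall_eq_zero hn)
  exact ⟨k, ne_zero_of_apply (left_ne_zero_of_mul hk), ne_zero_of_apply (right_ne_zero_of_mul hk)⟩

theorem units_abs_le (ε : ℤˣ) (x : ℤ) : (ε : ℤ) * x ≤ |x| ∧ |x| = |(ε : ℤ) * x| := by
  rcases Int.units_eq_one_or ε with rfl | rfl <;> simp [le_abs_self, neg_le_abs]

/-! ### Finiteness of products -/

/-- The set given by `K` is bounded below in the direction `ε` of the axis `α` along each line
parallel to this axis, locally uniformly. -/
def BddBelowAlong (α : Fin 2) (ε : ℤˣ) (K : Lattice → Prop) : Prop :=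
  ∀ M : ℤ, ∃ c : ℤ, ∀ k, K k → (∀ β, β ≠ α → |k β| ≤ M) → c ≤ (ε : ℤ) * k α

theorem finite_box (α : Fin 2) (ε : ℤˣ) (R c d : ℤ) :
    {k : Lattice | (∀ β, β ≠ α → |k β| ≤ R) ∧ c ≤ (ε : ℤ) * k α ∧ (ε : ℤ) * k α ≤ d}.Finite := by
  refine (Set.finite_Icc (fun _ => -(|R| + |c| + |d|) : Lattice)
    (fun _ => |R| + |c| + |d|)).subset ?_
  rintro k ⟨h1, h2, h3⟩
  have key (β : Fin 2) : |k β| ≤ |R| + |c| + |d| := by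
    have a1 := le_abs_self R
    have a2 := neg_abs_le c
    have a3 := le_abs_self d
    have a4 := abs_nonneg c
    have a5 := abs_nonneg d
    have a6 := abs_nonneg R
    by_cases hβ : β = α
    · subst hβ
      rw [(units_abs_le ε (k β)).2, abs_le]
      constructor <;> linarith
    · have := h1 β hβ
      linarith
  exact ⟨fun β => (abs_le.mp (key β)).1, fun β => (abs_le.mp (key β)).2⟩

theorem IsMixed.finite {α : Fin 2} {ε : ℤˣ} {A : Op} (hA : IsMixed α ε A) {K : Lattice → Prop}
    (hK : BddBelowAlong α ε K) : {k : Lattice | A k ≠ 0 ∧ K k}.Finite := by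
  obtain ⟨N, hN⟩ := hA
  obtain ⟨c, hc⟩ := hK N
  exact (finite_box α ε N c N).subset fun k hk =>
    ⟨(hN k hk.1).1, hc k hk.2 (hN k hk.1).1, (hN k hk.1).2⟩

theorem IsMixed.finite_pairs {α : Fin 2} {ε : ℤˣ} {A B : Op} (hA : IsMixed α ε A)
    (hB : IsMixed α ε B) {K : Lattice → Prop} (hK : BddBelowAlong α ε K) :
    {p : Lattice × Lattice | A p.1 ≠ 0 ∧ B (p.2 - p.1) ≠ 0 ∧ K p.2}.Finite := by
  obtain ⟨N, hN⟩ := hA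
  obtain ⟨N', hN'⟩ := hB
  obtain ⟨c, hc⟩ := hK (N + N')
  -- In the direction ε, k is at least c and k - l at most N', so l is at least c - N'.
  refine ((finite_box α ε N (c - N') N).prod (finite_box α ε (N + N') c (N + N'))).subset ?_
  rintro ⟨l, k⟩ ⟨h1, h2, h3⟩
  have b1 := hN l h1
  have b2 := hN' _ h2
  have b3 : ∀ β, β ≠ α → |k β| ≤ N + N' := fun β hβ => by
    have h := abs_add_le (l β) (k β - l β)
    rw [add_sub_cancel] at h
    have h1 := b1.1 β hβ
    have h2 := b2.1 β hβ
    rw [Pi.sub_apply] at h2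
    linarith
  have b4 := hc k h3 b3
  have b5 := b2.2
  rw [Pi.sub_apply, mul_sub] at b5
  exact ⟨⟨b1.1, by dsimp only; linarith, b1.2⟩, b3, b4, by dsimp only; linarith [b1.2]⟩

theorem IsMixed.bddBelowAlong {α : Fin 2} {ε : ℤˣ} {C : Op} (hC : IsMixed α ε C) (j : Lattice) :
    BddBelowAlong α ε fun k => C (j - k) ≠ 0 := by
  obtain ⟨N, hN⟩ := hC
  refine fun M => ⟨(ε : ℤ) * j α - N, fun k hk _ => ?_⟩
  have := (hN _ hk).2
  rw [Pi.sub_apply, mul_sub] at this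
  linarith

theorem IsMixed.mul_support_finite {α : Fin 2} {ε : ℤˣ} {A B : Op} (hA : IsMixed α ε A)
    (hB : IsMixed α ε B) (j m : Lattice) :
    (Function.support fun k => A k m * B (j - k) (m + k)).Finite :=
  (hA.finite (hB.bddBelowAlong j)).subset fun _ hk =>
    ⟨ne_zero_of_apply (left_ne_zero_of_mul hk), ne_zero_of_apply (right_ne_zero_of_mul hk)⟩

theorem IsMixed.mul_assoc {α : Fin 2} {ε : ℤˣ} {A B C : Op} (hA : IsMixed α ε A)
    (hB : IsMixed α ε B) (hC : IsMixed α ε C) : A * B * C = A * (B * C) := by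
  ext j m
  have h := finsum_mul_finsum_assoc (fun l => A l m) (fun l k => B (k - l) (m + l))
    (fun k => C (j - k) (m + k)) ((hA.finite_pairs hB (hC.bddBelowAlong j)).subset fun p hp =>
      ⟨ne_zero_of_apply (left_ne_zero_of_mul hp),
        ne_zero_of_apply (left_ne_zero_of_mul (right_ne_zero_of_mul hp)),
        ne_zero_of_apply (right_ne_zero_of_mul (right_ne_zero_of_mul hp))⟩)
  simp only [mul_apply]
  rw [h]
  refine finsum_congr fun l => ?_
  rw [← finsum_comp_equiv (Equiv.addLeft l)]
  congr 1
  refine finsum_congr fun k => ?_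
  rw [Equiv.coe_addLeft, add_sub_cancel_left, sub_sub, add_assoc]

/-! ### Actions on functions of the lattice -/

/-- The action of an operator on a function of `m`. -/
def act (A : Op) (φ : Lattice → TField) (m : Lattice) : TField := ∑ᶠ k, A k m * φ (m + k)

/-- The functions on which `𝓔^ε_{(α+1)}` acts. -/
def Admissible (α : Fin 2) (ε : ℤˣ) (φ : Lattice → TField) : Prop :=
  BddBelowAlong α ε fun m => φ m ≠ 0

theorem Admissible.translate {α : Fin 2} {ε : ℤˣ} {φ : Lattice → TField} (h : Admissible α ε φ)
    (m : Lattice) : BddBelowAlong α ε fun k => φ (m + k) ≠ 0 := by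
  intro M
  -- Translation by m changes the transverse coordinate by at most |m 0| + |m 1|.
  obtain ⟨c, hc⟩ := h (M + |m 0| + |m 1|)
  refine ⟨c - (ε : ℤ) * m α, fun k hk hM => ?_⟩
  have := hc _ hk fun β hβ => by
    have h1 := hM β hβ
    have h2 := abs_add_le (m β) (k β)
    have h3 := abs_nonneg (m 0)
    have h4 := abs_nonneg (m 1)
    rw [Pi.add_apply]
    fin_cases β <;> simp at h1 h2 ⊢ <;> linarith
  rw [Pi.add_apply, mul_add] at this
  linarith

theorem act_support_finite {α : Fin 2} {ε : ℤˣ} {A : Op} {φ : Lattice → TField}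
    (hA : IsMixed α ε A) (hφ : Admissible α ε φ) (m : Lattice) :
    (Function.support fun k => A k m * φ (m + k)).Finite :=
  (hA.finite (hφ.translate m)).subset fun _ hk =>
    ⟨ne_zero_of_apply (left_ne_zero_of_mul hk), right_ne_zero_of_mul hk⟩

theorem act_mul {α : Fin 2} {ε : ℤˣ} {A B : Op} {φ : Lattice → TField} (hA : IsMixed α ε A)
    (hB : IsMixed α ε B) (hφ : Admissible α ε φ) : act (A * B) φ = act A (act B φ) := by
  funext m
  have h := finsum_mul_finsum_assoc (fun l => A l m) (fun l k => B (k - l) (m + l))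
    (fun k => φ (m + k)) ((hA.finite_pairs hB (hφ.translate m)).subset fun p hp =>
      ⟨ne_zero_of_apply (left_ne_zero_of_mul hp),
        ne_zero_of_apply (left_ne_zero_of_mul (right_ne_zero_of_mul hp)),
        right_ne_zero_of_mul (right_ne_zero_of_mul hp)⟩)
  simp only [act, mul_apply]
  rw [h]
  refine finsum_congr fun l => ?_
  rw [← finsum_comp_equiv (Equiv.addLeft l)]
  congr 1
  refine finsum_congr fun k => ?_
  rw [Equiv.coe_addLeft, add_sub_cancel_left, add_assoc]

theorem act_add {α : Fin 2} {ε : ℤˣ} {A B : Op} {φ : Lattice → TField} (hA : IsMixed α ε A)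
    (hB : IsMixed α ε B) (hφ : Admissible α ε φ) : act (A + B) φ = act A φ + act B φ := by
  funext m
  rw [Pi.add_apply, act, act, act, ← finsum_add_distrib (act_support_finite hA hφ m)
    (act_support_finite hB hφ m)]
  exact finsum_congr fun k => add_mul _ _ _

theorem act_zero_right (A : Op) : act A (fun _ => 0) = fun _ => 0 := by
  funext m
  exact finsum_eq_zero_of_forall_eq_zero fun k => mul_zero _

/-! ### The ring of mixed operators -/

theorem IsMixed.zero (α : Fin 2) (ε : ℤˣ) : IsMixed α ε 0 := ⟨0, fun _ h => absurd rfl h⟩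

theorem IsMixed.add {α : Fin 2} {ε : ℤˣ} {A B : Op} (hA : IsMixed α ε A) (hB : IsMixed α ε B) :
    IsMixed α ε (A + B) := by
  obtain ⟨N, hN⟩ := hA
  obtain ⟨N', hN'⟩ := hB
  refine ⟨max N N', fun j hj => ?_⟩
  by_cases h : A j = 0
  · have h' : B j ≠ 0 := fun h' => hj (by
      change A j + B j = 0
      rw [h, h', add_zero])
    exact ⟨fun β hβ => ((hN' j h').1 β hβ).trans (le_max_right _ _),
      (hN' j h').2.trans (le_max_right _ _)⟩
  · exact ⟨fun β hβ => ((hN j h).1 β hβ).trans (le_max_left _ _),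
      (hN j h).2.trans (le_max_left _ _)⟩

theorem neg_ne_zero_iff {A : Op} {j : Lattice} : (-A) j ≠ 0 ↔ A j ≠ 0 := by
  change -(A j) ≠ 0 ↔ _
  exact neg_ne_zero

theorem IsMixed.neg {α : Fin 2} {ε : ℤˣ} {A : Op} (hA : IsMixed α ε A) : IsMixed α ε (-A) := by
  obtain ⟨N, hN⟩ := hA
  exact ⟨N, fun j hj => hN j (neg_ne_zero_iff.mp hj)⟩

theorem IsMixed.sub {α : Fin 2} {ε : ℤˣ} {A B : Op} (hA : IsMixed α ε A) (hB : IsMixed α ε B) :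
    IsMixed α ε (A - B) := by
  rw [sub_eq_add_neg]
  exact hA.add hB.neg

theorem IsMixed.mul {α : Fin 2} {ε : ℤˣ} {A B : Op} (hA : IsMixed α ε A) (hB : IsMixed α ε B) :
    IsMixed α ε (A * B) := by
  obtain ⟨N, hN⟩ := hA
  obtain ⟨N', hN'⟩ := hB
  refine ⟨N + N', fun j hj => ?_⟩
  obtain ⟨k, h1, h2⟩ := exists_of_mul_ne_zero hj
  have b1 := hN k h1
  have b2 := hN' _ h2
  refine ⟨fun β hβ => ?_, ?_⟩
  · have h := abs_add_le (k β) (j β - k β)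
    rw [add_sub_cancel] at h
    have h1 := b1.1 β hβ
    have h2 := b2.1 β hβ
    rw [Pi.sub_apply] at h2
    linarith
  · have h1 := b1.2
    have h2 := b2.2
    rw [Pi.sub_apply, mul_sub] at h2
    linarith

theorem IsSeries.isMixed {α : Fin 2} {ε : ℤˣ} {A : Op} (hA : IsSeries α ε A) : IsMixed α ε A := by
  obtain ⟨N, hN⟩ := hA
  refine ⟨max N 0, fun j hj => ⟨fun β hβ => ?_, (hN j hj).2.trans (le_max_left _ _)⟩⟩
  rw [(hN j hj).1 β hβ, abs_zero]
  exact le_max_right _ _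

theorem IsSeries.zero (α : Fin 2) (ε : ℤˣ) : IsSeries α ε 0 := ⟨0, fun _ h => absurd rfl h⟩

theorem IsSeries.add {α : Fin 2} {ε : ℤˣ} {A B : Op} (hA : IsSeries α ε A)
    (hB : IsSeries α ε B) : IsSeries α ε (A + B) := by
  obtain ⟨N, hN⟩ := hA
  obtain ⟨N', hN'⟩ := hB
  refine ⟨max N N', fun j hj => ?_⟩
  by_cases h : A j = 0
  · have h' : B j ≠ 0 := fun h' => hj (by
      change A j + B j = 0
      rw [h, h', add_zero])
    exact ⟨(hN' j h').1, (hN' j h').2.trans (le_max_right _ _)⟩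
  · exact ⟨(hN j h).1, (hN j h).2.trans (le_max_left _ _)⟩

theorem IsSeries.neg {α : Fin 2} {ε : ℤˣ} {A : Op} (hA : IsSeries α ε A) :
    IsSeries α ε (-A) := by
  obtain ⟨N, hN⟩ := hA
  exact ⟨N, fun j hj => hN j (neg_ne_zero_iff.mp hj)⟩

theorem IsSeries.mul {α : Fin 2} {ε : ℤˣ} {A B : Op} (hA : IsSeries α ε A)
    (hB : IsSeries α ε B) : IsSeries α ε (A * B) := by
  obtain ⟨N, hN⟩ := hA
  obtain ⟨N', hN'⟩ := hB
  refine ⟨N + N', fun j hj => ?_⟩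
  obtain ⟨k, h1, h2⟩ := exists_of_mul_ne_zero hj
  have b1 := hN k h1
  have b2 := hN' _ h2
  refine ⟨fun β hβ => ?_, ?_⟩
  · have h1 := b1.1 β hβ
    have h2 := b2.1 β hβ
    rw [Pi.sub_apply] at h2
    linarith
  · have h1 := b1.2
    have h2 := b2.2
    rw [Pi.sub_apply, mul_sub] at h2
    linarith

theorem isSeries_ofFun (α : Fin 2) (ε : ℤˣ) (f : Lattice → TField) : IsSeries α ε (ofFun f) := by
  refine ⟨0, fun j hj => ?_⟩
  have h : j = 0 := by
    by_contra h
    exact hj (funext fun m => if_neg h)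
  simp [h]

theorem isSeries_one (α : Fin 2) (ε : ℤˣ) : IsSeries α ε 1 := isSeries_ofFun α ε _

theorem Lam_apply (α : Fin 2) (n : ℤ) (j m : Lattice) :
    Lam α n j m = if j = Pi.single α n then 1 else 0 := rfl

theorem isSeries_Lam (α : Fin 2) (ε : ℤˣ) (n : ℤ) : IsSeries α ε (Lam α n) := by
  refine ⟨(ε : ℤ) * n, fun j hj => ?_⟩
  have h : j = Pi.single α n := by
    by_contra h
    exact hj (funext fun m => if_neg h)
  subst h
  exact ⟨fun β hβ => Pi.single_eq_of_ne hβ _, by rw [Pi.single_eq_same]⟩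

theorem isMixed_Lam (α γ : Fin 2) (ε : ℤˣ) (n : ℤ) : IsMixed α ε (Lam γ n) := by
  refine ⟨|n|, fun j hj => ?_⟩
  have h : j = Pi.single γ n := by
    by_contra h
    exact hj (funext fun m => if_neg h)
  have key (β : Fin 2) : |j β| ≤ |n| := by
    rw [h, Pi.single_apply]
    split_ifs <;> simp
  exact ⟨fun β _ => key β, (units_abs_le ε _).1.trans (key α)⟩

theorem ofFun_mul_apply (f : Lattice → TField) (A : Op) (j m : Lattice) :
    (ofFun f * A) j m = f m * A j m := by
  rw [mul_apply, finsum_eq_single _ 0]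
  · simp [ofFun]
  · intro k hk
    simp [ofFun, hk]

theorem mul_ofFun_apply (f : Lattice → TField) (A : Op) (j m : Lattice) :
    (A * ofFun f) j m = A j m * f (m + j) := by
  rw [mul_apply, finsum_eq_single _ j]
  · simp [ofFun]
  · intro k hk
    simp [ofFun, sub_eq_zero, hk.symm]

theorem Lam_mul_apply (α : Fin 2) (n : ℤ) (A : Op) (j m : Lattice) :
    (Lam α n * A) j m = A (j - Pi.single α n) (m + Pi.single α n) := by
  rw [mul_apply, finsum_eq_single _ (Pi.single α n)]
  · simp [Lam_apply]
  · intro k hk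
    simp [Lam_apply, hk]

theorem mul_Lam_apply (α : Fin 2) (n : ℤ) (A : Op) (j m : Lattice) :
    (A * Lam α n) j m = A (j - Pi.single α n) m := by
  rw [mul_apply, finsum_eq_single _ (j - Pi.single α n)]
  · simp [Lam_apply]
  · intro k hk
    rw [Lam_apply, if_neg, mul_zero]
    intro h
    apply hk
    rw [← h]
    abel

protected theorem one_mul (A : Op) : 1 * A = A := by
  ext j m
  exact (ofFun_mul_apply _ A j m).trans (by simp)

protected theorem mul_one (A : Op) : A * 1 = A := by
  ext j m
  exact (mul_ofFun_apply _ A j m).trans (by simp)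

theorem Lam_mul_Lam (α β : Fin 2) (x y : ℤ) (j m : Lattice) :
    (Lam α x * Lam β y) j m = if j = Pi.single α x + Pi.single β y then 1 else 0 := by
  rw [Lam_mul_apply, Lam_apply]
  simp only [sub_eq_iff_eq_add, add_comm]

theorem Lam_zero (α : Fin 2) : Lam α 0 = 1 := by
  ext j m
  rw [Lam_apply, one_apply, Pi.single_zero]

theorem Lam_mul_Lam_self (α : Fin 2) (x y : ℤ) : Lam α x * Lam α y = Lam α (x + y) := by
  ext j m
  rw [Lam_mul_Lam, Lam_apply, Pi.single_add]

theorem Lam_comm (α β : Fin 2) (x y : ℤ) : Lam α x * Lam β y = Lam β y * Lam α x := by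
  ext j m
  rw [Lam_mul_Lam, Lam_mul_Lam, add_comm]

/-- The additive group underlying the ring `𝓔^ε_{(α+1)}`. -/
def mixedAddSubgroup (α : Fin 2) (ε : ℤˣ) : AddSubgroup Op where
  carrier := {A | IsMixed α ε A}
  add_mem' := IsMixed.add
  zero_mem' := IsMixed.zero α ε
  neg_mem' := IsMixed.neg

/-- The ring `𝓔^ε_{(α+1)}`. -/
abbrev Mixed (α : Fin 2) (ε : ℤˣ) : Type := mixedAddSubgroup α ε

variable {α : Fin 2} {ε : ℤˣ}

theorem Mixed.isMixed (A : Mixed α ε) : IsMixed α ε (A : Op) := A.2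

instance : Mul (Mixed α ε) := ⟨fun A B => ⟨A.1 * B.1, A.isMixed.mul B.isMixed⟩⟩

instance : One (Mixed α ε) := ⟨⟨1, (isSeries_one α ε).isMixed⟩⟩

theorem IsMixed.mul_add {A B C : Op} (hA : IsMixed α ε A)
    (hB : IsMixed α ε B) (hC : IsMixed α ε C) : A * (B + C) = A * B + A * C := by
  ext j m
  rw [add_apply, mul_apply, mul_apply, mul_apply,
    ← finsum_add_distrib (hA.mul_support_finite hB j m) (hA.mul_support_finite hC j m)]
  exact finsum_congr fun k => _root_.mul_add _ _ _

theorem IsMixed.add_mul {A B C : Op} (hA : IsMixed α ε A)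
    (hB : IsMixed α ε B) (hC : IsMixed α ε C) : (A + B) * C = A * C + B * C := by
  ext j m
  rw [add_apply, mul_apply, mul_apply, mul_apply,
    ← finsum_add_distrib (hA.mul_support_finite hC j m) (hB.mul_support_finite hC j m)]
  exact finsum_congr fun k => _root_.add_mul _ _ _

protected theorem mul_zero (A : Op) : A * 0 = 0 := by
  ext j m
  rw [mul_apply]
  exact finsum_eq_zero_of_forall_eq_zero fun k => by rw [zero_apply, MulZeroClass.mul_zero]

protected theorem zero_mul (A : Op) : 0 * A = 0 := by
  ext j m
  rw [mul_apply]
  exact finsum_eq_zero_of_forall_eq_zero fun k => by rw [zero_apply, MulZeroClass.zero_mul]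

/-- The product on all of `Op` is meaningful only where its sums are finite. Inside this ring they
are, and operator identities are proved here before being read back in `Op`. -/
instance : Ring (Mixed α ε) where
  mul_assoc A B C := Subtype.ext (A.isMixed.mul_assoc B.isMixed C.isMixed)
  one_mul A := Subtype.ext (Op.one_mul A.1)
  mul_one A := Subtype.ext (Op.mul_one A.1)
  left_distrib A B C := Subtype.ext (A.isMixed.mul_add B.isMixed C.isMixed)
  right_distrib A B C := Subtype.ext (A.isMixed.add_mul B.isMixed C.isMixed)
  zero_mul A := Subtype.ext (Op.zero_mul A.1)
  mul_zero A := Subtype.ext (Op.mul_zero A.1)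
  neg_add_cancel A := neg_add_cancel A
  zsmul := (inferInstance : AddCommGroup (Mixed α ε)).zsmul
  zsmul_zero' := (inferInstance : AddCommGroup (Mixed α ε)).zsmul_zero'
  zsmul_succ' := (inferInstance : AddCommGroup (Mixed α ε)).zsmul_succ'
  zsmul_neg' := (inferInstance : AddCommGroup (Mixed α ε)).zsmul_neg'
  sub_eq_add_neg := (inferInstance : AddCommGroup (Mixed α ε)).sub_eq_add_neg

namespace Mixed

theorem coe_mul (A B : Mixed α ε) : ((A * B : Mixed α ε) : Op) = A.1 * B.1 := rfl

theorem coe_pow (A : Mixed α ε) (n : ℕ) : ((A ^ n : Mixed α ε) : Op) = Op.pow A.1 n := by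
  induction n with
  | zero => rfl
  | succ n ih => rw [pow_succ, coe_mul, ih]; rfl

/-- The subring `𝓔^{0,ε}_{(α+1)}`. -/
def seriesSubring (α : Fin 2) (ε : ℤˣ) : Subring (Mixed α ε) where
  carrier := {A | IsSeries α ε A.1}
  add_mem' := IsSeries.add
  zero_mem' := IsSeries.zero α ε
  neg_mem' := IsSeries.neg
  mul_mem' := IsSeries.mul
  one_mem' := isSeries_one α ε

/-- The shift `Λ_{γ+1}^n` in the ring of mixed operators. -/
def lam (γ : Fin 2) (n : ℤ) : Mixed α ε := ⟨Lam γ n, isMixed_Lam α γ ε n⟩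

theorem lam_mul_lam (γ : Fin 2) (x y : ℤ) : (lam γ x * lam γ y : Mixed α ε) = lam γ (x + y) :=
  Subtype.ext (Lam_mul_Lam_self γ x y)

theorem lam_zero (γ : Fin 2) : (lam γ 0 : Mixed α ε) = 1 := Subtype.ext (Lam_zero γ)

theorem lam_pow (γ : Fin 2) (x : ℤ) (n : ℕ) : (lam γ x : Mixed α ε) ^ n = lam γ (n * x) := by
  induction n with
  | zero => simp [lam_zero]
  | succ n ih =>
    rw [pow_succ, ih, lam_mul_lam]
    congr 1
    push_cast
    ring

end Mixed

/-! ### Derivatives with respect to the times -/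

theorem deriv_apply (s : TimeIdx) (A : Op) (j m : Lattice) : A.deriv s j m = dt s (A j m) := rfl

theorem deriv_ne_zero {s : TimeIdx} {A : Op} {j : Lattice} (h : A.deriv s j ≠ 0) : A j ≠ 0 := by
  intro h0
  apply h
  funext m
  change dt s (A j m) = 0
  rw [h0]
  exact dt_zero s

theorem IsMixed.deriv {A : Op} (hA : IsMixed α ε A) (s : TimeIdx) : IsMixed α ε (A.deriv s) := by
  obtain ⟨N, hN⟩ := hA
  exact ⟨N, fun j hj => hN j (deriv_ne_zero hj)⟩

theorem IsSeries.deriv {A : Op} (hA : IsSeries α ε A) (s : TimeIdx) :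
    IsSeries α ε (A.deriv s) := by
  obtain ⟨N, hN⟩ := hA
  exact ⟨N, fun j hj => hN j (deriv_ne_zero hj)⟩

theorem IsMixed.deriv_mul {A B : Op} (hA : IsMixed α ε A) (hB : IsMixed α ε B) (s : TimeIdx) :
    (A * B).deriv s = A.deriv s * B + A * B.deriv s := by
  ext j m
  rw [deriv_apply, mul_apply, dt_finsum _ _ (hA.mul_support_finite hB j m), add_apply, mul_apply,
    mul_apply, ← finsum_add_distrib ((hA.deriv s).mul_support_finite hB j m)
      (hA.mul_support_finite (hB.deriv s) j m)]
  refine finsum_congr fun k => ?_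
  rw [dt_mul, deriv_apply, deriv_apply]
  ring

theorem deriv_Lam (s : TimeIdx) (γ : Fin 2) (n : ℤ) : (Lam γ n).deriv s = 0 := by
  ext j m
  rw [deriv_apply, Lam_apply, zero_apply]
  split_ifs
  · exact dt_one s
  · exact dt_zero s

theorem deriv_one (s : TimeIdx) : (1 : Op).deriv s = 0 := by
  rw [← Lam_zero 0, deriv_Lam]

/-- If `∂S = C S - S Λ^p`, then `L = S Λ^q S⁻¹` satisfies the Lax equation `∂L = [C, L]`. -/
theorem lax_of_sato {s : TimeIdx} {S T C M : Op} (q : ℤ) (hS : IsMixed α ε S)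
    (hT : IsMixed α ε T) (hC : IsMixed α ε C) (hM : IsMixed α ε M)
    (hST : S * T = 1) (hTS : T * S = 1) (hMq : M * Lam α q = Lam α q * M)
    (h : C * S = S.deriv s + S * M) :
    (S * Lam α q * T).deriv s = C.comm (S * Lam α q * T) := by
  have hΛ := isMixed_Lam α α ε q
  -- Differentiating S T = 1 gives ∂T = -T ∂S T, into which ∂S = C S - S M is inserted.
  have hT' : T.deriv s = M * T - T * C := by
    have h1 := congrArg (Op.deriv s) hST
    rw [hS.deriv_mul hT, deriv_one] at h1
    let S' : Mixed α ε := ⟨S, hS⟩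
    let T' : Mixed α ε := ⟨T, hT⟩
    let C' : Mixed α ε := ⟨C, hC⟩
    let M' : Mixed α ε := ⟨M, hM⟩
    let dS : Mixed α ε := ⟨S.deriv s, hS.deriv s⟩
    let dT : Mixed α ε := ⟨T.deriv s, hT.deriv s⟩
    have k1 : dS * T' + S' * dT = 0 := Subtype.ext h1
    have k2 : C' * S' = dS + S' * M' := Subtype.ext h
    have k3 : S' * T' = 1 := Subtype.ext hST
    have k4 : T' * S' = 1 := Subtype.ext hTS
    have k5 : dT = M' * T' - T' * C' := by
      calc dT = T' * S' * dT := by rw [k4, _root_.one_mul]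
        _ = -(T' * dS * T') := by
          rw [_root_.mul_assoc, eq_neg_of_add_eq_zero_right k1, _root_.mul_neg, _root_.mul_assoc]
        _ = -(T' * (C' * S' - S' * M') * T') := by rw [k2, add_sub_cancel_right]
        _ = T' * S' * M' * T' - T' * C' * (S' * T') := by noncomm_ring
        _ = M' * T' - T' * C' := by rw [k4, k3, _root_.one_mul, _root_.mul_one]
    exact congrArg Subtype.val k5
  rw [(hS.mul hΛ).deriv_mul hT, hS.deriv_mul hΛ, deriv_Lam, Op.mul_zero, add_zero, hT', comm]
  let S' : Mixed α ε := ⟨S, hS⟩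
  let T' : Mixed α ε := ⟨T, hT⟩
  let C' : Mixed α ε := ⟨C, hC⟩
  let M' : Mixed α ε := ⟨M, hM⟩
  let L' : Mixed α ε := ⟨Lam α q, hΛ⟩
  let dS : Mixed α ε := ⟨S.deriv s, hS.deriv s⟩
  have k2 : C' * S' = dS + S' * M' := Subtype.ext h
  have k6 : M' * L' = L' * M' := Subtype.ext hMq
  have k7 : dS * L' * T' + S' * L' * (M' * T' - T' * C') =
      C' * (S' * L' * T') - S' * L' * T' * C' := by
    calc dS * L' * T' + S' * L' * (M' * T' - T' * C')
        = (C' * S' - S' * M') * L' * T' + S' * L' * (M' * T' - T' * C') := by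
          rw [k2, add_sub_cancel_right]
      -- M enters only through its commutator with Λ^q, which is zero.
      _ = C' * (S' * L' * T') - S' * L' * T' * C' - S' * (M' * L' - L' * M') * T' := by
          noncomm_ring
      _ = C' * (S' * L' * T') - S' * L' * T' * C' := by
          rw [k6, sub_self, MulZeroClass.mul_zero, MulZeroClass.zero_mul, sub_zero]
  exact congrArg Subtype.val k7

/-! ### Inverses of series -/

theorem units_mul_mul (δ : ℤˣ) (x : ℤ) : (δ : ℤ) * (δ * x) = x := by
  rw [← _root_.mul_assoc, ← Units.val_mul, Int.units_mul_self, Units.val_one, _root_.one_mul]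

theorem series_single (α : Fin 2) (δ : ℤˣ) (a : ℕ → Lattice → TField) (p : ℕ) (m : Lattice) :
    series α δ a (Pi.single α ((δ : ℤ) * p)) m = a p m := by
  have h : (∀ β, β ≠ α → (Pi.single α ((δ : ℤ) * p) : Lattice) β = 0) ∧
      0 ≤ (δ : ℤ) * (Pi.single α ((δ : ℤ) * p) : Lattice) α :=
    ⟨fun β hβ => Pi.single_eq_of_ne hβ _, by rw [Pi.single_eq_same, units_mul_mul]; omega⟩
  rw [series, if_pos h, Pi.single_eq_same, units_mul_mul, Int.toNat_natCast]

theorem eq_single_of_series_ne_zero {α : Fin 2} {δ : ℤˣ} {a : ℕ → Lattice → TField} {j m : Lattice}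
    (h : series α δ a j m ≠ 0) : ∃ p : ℕ, j = Pi.single α ((δ : ℤ) * p) := by
  rw [series] at h
  split_ifs at h with hj
  · refine ⟨((δ : ℤ) * j α).toNat, funext fun β => ?_⟩
    by_cases hβ : β = α
    · subst hβ
      rw [Pi.single_eq_same, Int.toNat_of_nonneg hj.2, units_mul_mul]
    · rw [Pi.single_eq_of_ne hβ, hj.1 β hβ]
  · exact absurd rfl h

theorem isSeries_series (α : Fin 2) (ε : ℤˣ) (a : ℕ → Lattice → TField) :
    IsSeries α ε (series α (-ε) a) := by
  refine ⟨0, fun j hj => ?_⟩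
  obtain ⟨m, hm⟩ := exists_apply_ne_zero hj
  obtain ⟨p, rfl⟩ := eq_single_of_series_ne_zero hm
  refine ⟨fun β hβ => Pi.single_eq_of_ne hβ _, ?_⟩
  rw [Pi.single_eq_same, Units.val_neg, neg_mul, mul_neg, units_mul_mul]
  omega

theorem single_mul_injective (α : Fin 2) (δ : ℤˣ) :
    Function.Injective fun p : ℕ => (Pi.single α ((δ : ℤ) * p) : Lattice) := by
  intro p q h
  have := mul_left_cancel₀ δ.ne_zero (Pi.single_injective α h)
  exact_mod_cast this

theorem series_mul_series (α : Fin 2) (δ : ℤˣ) (a b : ℕ → Lattice → TField) :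
    series α δ a * series α δ b = series α δ fun n m =>
      ∑ p ∈ Finset.range (n + 1), a p m * b (n - p) (m + Pi.single α ((δ : ℤ) * p)) := by
  have sub_single (x y : ℤ) : (Pi.single α x - Pi.single α y : Lattice) = Pi.single α (x - y) :=
    (Pi.single_sub (f := fun _ : Fin 2 => ℤ) α x y).symm
  ext j m
  by_cases hj : ∃ n : ℕ, j = Pi.single α ((δ : ℤ) * n)
  · obtain ⟨n, rfl⟩ := hj
    rw [series_single, mul_apply, finsum_eq_sum_of_support_subset _
      (s := (Finset.range (n + 1)).map ⟨_, single_mul_injective α δ⟩), Finset.sum_map]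
    · refine Finset.sum_congr rfl fun p hp => ?_
      rw [Finset.mem_range] at hp
      rw [Function.Embedding.coeFn_mk, series_single, sub_single, ← mul_sub,
        ← Nat.cast_sub (by omega), series_single]
    · intro k hk
      obtain ⟨p, rfl⟩ := eq_single_of_series_ne_zero (left_ne_zero_of_mul hk)
      obtain ⟨q, hq⟩ := eq_single_of_series_ne_zero (right_ne_zero_of_mul hk)
      rw [sub_single, ← mul_sub] at hq
      have := mul_left_cancel₀ δ.ne_zero (Pi.single_injective α hq)
      simp only [Finset.coe_map, Function.Embedding.coeFn_mk, Finset.coe_range]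
      exact ⟨p, by rw [Set.mem_Iio]; omega, rfl⟩
  · have h : series α δ (fun n m => ∑ p ∈ Finset.range (n + 1),
        a p m * b (n - p) (m + Pi.single α ((δ : ℤ) * p))) j m = 0 := by
      by_contra h
      exact hj (eq_single_of_series_ne_zero h)
    rw [h, mul_apply]
    refine finsum_eq_zero_of_forall_eq_zero fun k => ?_
    by_contra hk
    obtain ⟨p, hp⟩ := eq_single_of_series_ne_zero (left_ne_zero_of_mul hk)
    obtain ⟨q, hq⟩ := eq_single_of_series_ne_zero (right_ne_zero_of_mul hk)
    apply hj
    refine ⟨p + q, ?_⟩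
    rw [sub_eq_iff_eq_add] at hq
    rw [hq, hp, ← Pi.single_add]
    congr 1
    push_cast
    ring

/-- The coefficients of the right inverse of a series. -/
def invCoeff (α : Fin 2) (δ : ℤˣ) (a : ℕ → Lattice → TField) : ℕ → Lattice → TField
  | 0, m => (a 0 m)⁻¹
  | n + 1, m => -(a 0 m)⁻¹ * ∑ p : Fin (n + 1),
      a (p + 1) m * invCoeff α δ a (n - p) (m + Pi.single α ((δ : ℤ) * (p + 1 : ℕ)))
  termination_by n => n

theorem series_mul_invCoeff (α : Fin 2) (δ : ℤˣ) (a : ℕ → Lattice → TField) (ha : ∀ m, a 0 m ≠ 0) :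
    series α δ a * series α δ (invCoeff α δ a) = 1 := by
  rw [series_mul_series]
  have h : (fun (n : ℕ) (m : Lattice) => ∑ p ∈ Finset.range (n + 1),
      a p m * invCoeff α δ a (n - p) (m + Pi.single α ((δ : ℤ) * p))) =
      fun n _ => if n = 0 then 1 else 0 := by
    funext n m
    cases n with
    | zero => simp [invCoeff, ha m]
    | succ n =>
      rw [Finset.sum_range_succ', if_neg (Nat.succ_ne_zero n), Nat.cast_zero, MulZeroClass.mul_zero,
        Pi.single_zero, add_zero, Nat.sub_zero, invCoeff,
        ← Fin.sum_univ_eq_sum_range (fun p => a (p + 1) m * invCoeff α δ a (n + 1 - (p + 1))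
          (m + (Pi.single α ((δ : ℤ) * ((p + 1 : ℕ) : ℤ)) : Lattice)))]
      simp only [Nat.add_sub_add_right]
      rw [← _root_.mul_assoc, mul_neg, mul_inv_cancel₀ (ha m), neg_one_mul, add_neg_cancel]
  rw [h]
  ext j m
  by_cases hj : ∃ n : ℕ, j = Pi.single α ((δ : ℤ) * n)
  · obtain ⟨n, rfl⟩ := hj
    rw [series_single, one_apply]
    congr 1
    rw [Pi.single_eq_zero_iff]
    simp
  · rw [one_apply, if_neg]
    · by_contra h
      exact hj (eq_single_of_series_ne_zero h)
    · rintro rfl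
      exact hj ⟨0, by simp⟩

/-- The recursion gives a right inverse T, and T again has a right inverse because its leading
coefficient is nonzero. By associativity that one is the original series, so T is two-sided. -/
theorem exists_isInv_series (α : Fin 2) (ε : ℤˣ) (a : ℕ → Lattice → TField)
    (ha : ∀ m, a 0 m ≠ 0) : ∃ T, IsInv α ε (series α (-ε) a) T := by
  have h1 := series_mul_invCoeff α (-ε) a ha
  have h2 := series_mul_invCoeff α (-ε) (invCoeff α (-ε) a) fun m => by
    rw [invCoeff]; exact inv_ne_zero (ha m)
  refine ⟨_, isSeries_series α ε (invCoeff α (-ε) a), h1, ?_⟩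
  have hs (b) : IsMixed α ε (series α (-ε) b) := (isSeries_series α ε b).isMixed
  have h3 : series α (-ε) a = series α (-ε) (invCoeff α (-ε) (invCoeff α (-ε) a)) := by
    rw [← Op.mul_one (series α (-ε) a), ← h2, ← (hs _).mul_assoc (hs _) (hs _), h1, Op.one_mul]
  conv_lhs => rw [h3]
  exact h2

theorem IsInv.unique {S T T' : Op} (hS : IsMixed α ε S) (h : IsInv α ε S T)
    (h' : IsInv α ε S T') : T' = T := by
  rw [← Op.mul_one T', ← h.2.1, ← h'.1.isMixed.mul_assoc hS h.1.isMixed, h'.2.2, Op.one_mul]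

theorem existsUnique_isInv_series (α : Fin 2) (ε : ℤˣ) (a : ℕ → Lattice → TField)
    (ha : ∀ m, a 0 m ≠ 0) : ∃! T, IsInv α ε (series α (-ε) a) T := by
  obtain ⟨T, hT⟩ := exists_isInv_series α ε a ha
  exact ⟨T, hT, fun T' hT' => hT.unique (isSeries_series α ε a).isMixed hT'⟩

theorem isInv_inv {S : Op} (h : ∃ T, IsInv α ε S T) : IsInv α ε S (inv α ε S) :=
  Classical.epsilon_spec h

/-! ### Division by an operator of degree one in the other shift -/

theorem isInv_Lam (α : Fin 2) (ε : ℤˣ) (n : ℤ) : IsInv α ε (Lam α n) (Lam α (-n)) :=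
  ⟨isSeries_Lam α ε _, by rw [Lam_mul_Lam_self, add_neg_cancel, Lam_zero],
    by rw [Lam_mul_Lam_self, neg_add_cancel, Lam_zero]⟩

theorem IsInv.mul {S S' T T' : Op} (hS : IsSeries α ε S) (hS' : IsSeries α ε S')
    (h : IsInv α ε S T) (h' : IsInv α ε S' T') : IsInv α ε (S * S') (T' * T) := by
  have s := hS.isMixed
  have s' := hS'.isMixed
  have t := h.1.isMixed
  have t' := h'.1.isMixed
  refine ⟨h'.1.mul h.1, ?_, ?_⟩
  · rw [s.mul_assoc s' (t'.mul t), ← s'.mul_assoc t' t, h'.2.1, Op.one_mul, h.2.1]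
  · rw [t'.mul_assoc t (s.mul s'), ← t.mul_assoc s s', h.2.2, Op.one_mul, h'.2.2]

theorem isInv_ofFun (α : Fin 2) (ε : ℤˣ) {f : Lattice → TField} (hf : ∀ m, f m ≠ 0) :
    IsInv α ε (ofFun f) (ofFun fun m => (f m)⁻¹) := by
  refine ⟨isSeries_ofFun α ε _, ?_, ?_⟩ <;> ext j m <;>
    rw [ofFun_mul_apply, one_apply, ofFun] <;> split_ifs <;> simp [hf m]

theorem isSeries_binomial (α : Fin 2) (ε : ℤˣ) (f g : Lattice → TField) :
    IsSeries α ε (ofFun f + ofFun g * Lam α 1) :=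
  (isSeries_ofFun α ε f).add ((isSeries_ofFun α ε g).mul (isSeries_Lam α ε 1))

theorem series_ite_eq (α : Fin 2) (δ : ℤˣ) (f g : Lattice → TField) :
    series α δ (fun n m => if n = 0 then f m else if n = 1 then g m else 0) =
      ofFun f + ofFun g * Lam α δ := by
  have hδ : (δ : ℤ) ≠ 0 := δ.ne_zero
  ext j m
  rw [add_apply, ofFun_mul_apply, Lam_apply, ofFun]
  by_cases hj : ∃ n : ℕ, j = Pi.single α ((δ : ℤ) * n)
  · obtain ⟨n, rfl⟩ := hj
    rw [series_single]
    have h0 : (Pi.single α ((δ : ℤ) * n) : Lattice) = 0 ↔ n = 0 := by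
      rw [Pi.single_eq_zero_iff]
      simp [hδ]
    have h : (Pi.single α ((δ : ℤ) * n) : Lattice) = Pi.single α (δ : ℤ) ↔ n = 1 := by
      rw [(Pi.single_injective α).eq_iff, mul_eq_left₀ hδ]
      norm_cast
    simp only [h0, h]
    rcases n with _ | _ | n <;> simp
  · rw [if_neg, if_neg, MulZeroClass.mul_zero, add_zero]
    · by_contra h
      exact hj (eq_single_of_series_ne_zero h)
    · rintro rfl
      exact hj ⟨1, by simp⟩
    · rintro rfl
      exact hj ⟨0, by simp⟩

/-- Either term may be taken as the leading one: f for expansion in Λ, and g after factoring out Λ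
for expansion in Λ⁻¹. -/
theorem exists_isInv_binomial (α : Fin 2) (ε : ℤˣ) {f g : Lattice → TField} (hf : ∀ m, f m ≠ 0)
    (hg : ∀ m, g m ≠ 0) : ∃ T, IsInv α ε (ofFun f + ofFun g * Lam α 1) T := by
  rcases Int.units_eq_one_or ε with rfl | rfl
  · have h : ofFun f + ofFun g * Lam α 1 =
        series α (-1) (fun n m => if n = 0 then g m else if n = 1 then f m else 0) * Lam α 1 := by
      rw [series_ite_eq, IsMixed.add_mul (isSeries_ofFun α 1 g).isMixed
        ((isSeries_ofFun α 1 f).mul (isSeries_Lam α 1 _)).isMixed (isSeries_Lam α 1 1).isMixed,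
        (isSeries_ofFun α 1 f).isMixed.mul_assoc (isSeries_Lam α 1 _).isMixed
          (isSeries_Lam α 1 1).isMixed, Lam_mul_Lam_self]
      have : ((-1 : ℤˣ) : ℤ) + 1 = 0 := rfl
      rw [this, Lam_zero, Op.mul_one, add_comm]
    obtain ⟨T, hT⟩ := exists_isInv_series α 1
      (fun n m => if n = 0 then g m else if n = 1 then f m else 0) (fun m => by simpa using hg m)
    rw [h]
    exact ⟨_, IsInv.mul (isSeries_series α 1 _) (isSeries_Lam α 1 1) hT (isInv_Lam α 1 1)⟩
  · have h : ofFun f + ofFun g * Lam α 1 =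
        series α (- -1) (fun n m => if n = 0 then f m else if n = 1 then g m else 0) := by
      rw [series_ite_eq]; rfl
    rw [h]
    exact exists_isInv_series α (-1) _ (fun m => by simpa using hf m)

/-- The other one of the two axes. -/
def other (α : Fin 2) : Fin 2 := 1 - α

theorem other_ne (α : Fin 2) : other α ≠ α := by
  fin_cases α <;> decide

theorem eq_other {α β : Fin 2} (h : β ≠ α) : β = other α := by
  revert h; fin_cases α <;> fin_cases β <;> decide

theorem lattice_ext (α : Fin 2) {j k : Lattice} (h1 : j α = k α)
    (h2 : j (other α) = k (other α)) : j = k := by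
  funext β
  by_cases h : β = α
  · rw [h, h1]
  · rw [eq_other h, h2]

theorem part_apply (γ : Fin 2) (P : ℤ → Prop) (A : Op) (j m : Lattice) [Decidable (P (j γ))] :
    part γ P A j m = if P (j γ) then A j m else 0 := by
  unfold part
  congr

theorem part_ne_zero {γ : Fin 2} {P : ℤ → Prop} {A : Op} {j : Lattice} (h : part γ P A j ≠ 0) :
    P (j γ) ∧ A j ≠ 0 := by
  classical
  obtain ⟨m, hm⟩ := exists_apply_ne_zero h
  rw [part_apply] at hm
  split_ifs at hm with hP
  · exact ⟨hP, ne_zero_of_apply hm⟩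
  · exact absurd rfl hm

theorem IsMixed.part {A : Op} (hA : IsMixed α ε A) (γ : Fin 2) (P : ℤ → Prop) :
    IsMixed α ε (part γ P A) := by
  obtain ⟨N, hN⟩ := hA
  exact ⟨N, fun j hj => hN j (part_ne_zero hj).2⟩

theorem IsSeries.part {A : Op} (hA : IsSeries α ε A) (γ : Fin 2) (P : ℤ → Prop) :
    IsSeries α ε (part γ P A) := by
  obtain ⟨N, hN⟩ := hA
  exact ⟨N, fun j hj => hN j (part_ne_zero hj).2⟩

/-- All terms of `A` have degree `r` in `Λ_{γ+1}`. -/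
def IsHomog (γ : Fin 2) (r : ℤ) (A : Op) : Prop := ∀ j, A j ≠ 0 → j γ = r

theorem part_mul {γ : Fin 2} {r : ℤ} {Q W : Op} (hW : IsHomog γ r W) (n : ℤ) :
    part γ (· = n) (Q * W) = part γ (· = n - r) Q * W := by
  ext j m
  rw [part_apply, mul_apply, mul_apply]
  split_ifs with h
  · refine finsum_congr fun k => ?_
    rw [part_apply]
    by_cases hk : W (j - k) = 0
    · rw [hk]; simp
    · have := hW _ hk
      rw [Pi.sub_apply] at this
      rw [if_pos (by omega)]
  · symm
    refine finsum_eq_zero_of_forall_eq_zero fun k => ?_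
    rw [part_apply]
    by_cases hk : W (j - k) = 0
    · rw [hk]; simp
    · have := hW _ hk
      rw [Pi.sub_apply] at this
      rw [if_neg (by omega), MulZeroClass.zero_mul]

theorem part_add (γ : Fin 2) (P : ℤ → Prop) (A B : Op) :
    part γ P (A + B) = part γ P A + part γ P B := by
  classical
  ext j m
  rw [add_apply, part_apply, part_apply, part_apply]
  split_ifs
  · rfl
  · rw [add_zero]

theorem IsSeries.isHomog {A : Op} (hA : IsSeries α ε A) : IsHomog (other α) 0 A := by
  obtain ⟨N, hN⟩ := hA
  exact fun j hj => (hN j hj).1 _ (other_ne α)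

theorem IsHomog.mul_Lam {γ : Fin 2} {A : Op} (hA : IsHomog γ 0 A) (n : ℤ) :
    IsHomog γ n (A * Lam γ n) := by
  intro j hj
  obtain ⟨m, hm⟩ := exists_apply_ne_zero hj
  rw [mul_Lam_apply] at hm
  have := hA _ (ne_zero_of_apply hm)
  rw [Pi.sub_apply, Pi.single_eq_same] at this
  omega

theorem eq_zero_of_mul_isUnit_right {Q W Z : Op} (hQ : IsMixed α ε Q) (hW : IsMixed α ε W)
    (hZ : IsMixed α ε Z) (hWZ : W * Z = 1) (h : Q * W = 0) : Q = 0 := by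
  rw [← Op.mul_one Q, ← hWZ, ← hQ.mul_assoc hW hZ, h, Op.zero_mul]

/-- The operator with the coefficients of `A` translated by `k`. -/
def translate (k : Lattice) (A : Op) : Op := fun j m => A j (m + k)

theorem IsSeries.translate {A : Op} (hA : IsSeries α ε A) (k : Lattice) :
    IsSeries α ε (translate k A) := by
  obtain ⟨N, hN⟩ := hA
  refine ⟨N, fun j hj => hN j ?_⟩
  obtain ⟨m, hm⟩ := exists_apply_ne_zero hj
  exact ne_zero_of_apply hm

theorem Lam_mul_eq (γ : Fin 2) (n : ℤ) (A : Op) :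
    Lam γ n * A = translate (Pi.single γ n) A * Lam γ n := by
  ext j m
  rw [Lam_mul_apply, mul_Lam_apply]
  rfl

variable {U V U' V' : Op}

/-- `A` is a sum of an element of `𝓔^{0,ε}_{(α+1)}` and a left multiple of `K`. -/
def Decomposable (α : Fin 2) (ε : ℤˣ) (K A : Op) : Prop :=
  ∃ P, IsSeries α ε P ∧ ∃ Q, IsMixed α ε Q ∧ A = P + Q * K

theorem Decomposable.add {K A B : Op} (hK : IsMixed α ε K) (hA : Decomposable α ε K A)
    (hB : Decomposable α ε K B) : Decomposable α ε K (A + B) := by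
  obtain ⟨P, hP, Q, hQ, rfl⟩ := hA
  obtain ⟨P', hP', Q', hQ', rfl⟩ := hB
  refine ⟨_, hP.add hP', _, hQ.add hQ', ?_⟩
  rw [hQ.add_mul hQ' hK]
  abel

theorem Decomposable.mul_left {K A C : Op} (hK : IsMixed α ε K) (hA : Decomposable α ε K A)
    (hC : IsSeries α ε C) : Decomposable α ε K (C * A) := by
  obtain ⟨P, hP, Q, hQ, rfl⟩ := hA
  refine ⟨_, hC.mul hP, _, hC.isMixed.mul hQ, ?_⟩
  rw [hC.isMixed.mul_add hP.isMixed (hQ.mul hK), hC.isMixed.mul_assoc hQ hK]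

/-- Write Y for the other shift and K = U Y + V. Modulo left multiples of K, Y ≡ -U⁻¹V and 1 ≡ -V⁻¹U
Y, so multiplying by powers of Y on the left raises or lowers the exponent by one; moving Y^n past a
series only translates its coefficients. -/
theorem decomposable_Lam (hU : IsSeries α ε U) (hV : IsSeries α ε V) (hUU : IsInv α ε U U')
    (hVV : IsInv α ε V V') (n : ℤ) :
    Decomposable α ε (U * Lam (other α) 1 + V) (Lam (other α) n) := by
  have hY (n : ℤ) : IsMixed α ε (Lam (other α) n) := isMixed_Lam α _ ε n
  have hK : IsMixed α ε (U * Lam (other α) 1 + V) := (hU.isMixed.mul (hY 1)).add hV.isMixed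
  have hu := hUU.1.isMixed
  have hv := hVV.1.isMixed
  have hU2 : U' * U = 1 := hUU.2.2
  have hV2 : V' * V = 1 := hVV.2.2
  let K' : Mixed α ε := ⟨_, hK⟩
  let u : Mixed α ε := ⟨U, hU.isMixed⟩
  let v : Mixed α ε := ⟨V, hV.isMixed⟩
  let u' : Mixed α ε := ⟨U', hu⟩
  let v' : Mixed α ε := ⟨V', hv⟩
  let Y (n : ℤ) : Mixed α ε := Mixed.lam (other α) n
  have kK : K' = u * Y 1 + v := rfl
  have ku : u' * u = 1 := Subtype.ext hU2
  have kv : v' * v = 1 := Subtype.ext hV2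
  have kY (x y : ℤ) : Y x * Y y = Y (x + y) := Mixed.lam_mul_lam _ x y
  have up (n : ℤ) (ih : Decomposable α ε (U * Lam (other α) 1 + V) (Lam (other α) n)) :
      Decomposable α ε (U * Lam (other α) 1 + V) (Lam (other α) (n + 1)) := by
    have hA := Lam_mul_eq (other α) n (U' * V)
    have hA' := (hUU.1.mul hV).translate (Pi.single (other α) n)
    generalize translate (Pi.single (other α) n) (U' * V) = A' at hA hA'
    have e : Lam (other α) (n + 1) =
        -A' * Lam (other α) n + (0 + Lam (other α) n * U' * (U * Lam (other α) 1 + V)) := by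
      let a' : Mixed α ε := ⟨A', hA'.isMixed⟩
      have ka : Y n * (u' * v) = a' * Y n := Subtype.ext hA
      have : Y (n + 1) = -a' * Y n + (0 + Y n * u' * K') := by
        rw [neg_mul, ← ka, kK, ← kY]
        calc Y n * Y 1 = Y n * (u' * u) * Y 1 := by rw [ku, _root_.mul_one]
          _ = _ := by noncomm_ring
      exact congrArg Subtype.val this
    rw [e]
    exact (ih.mul_left hK hA'.neg).add hK ⟨0, IsSeries.zero α ε, _, (hY n).mul hu, rfl⟩
  have down (n : ℤ) (ih : Decomposable α ε (U * Lam (other α) 1 + V) (Lam (other α) n)) :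
      Decomposable α ε (U * Lam (other α) 1 + V) (Lam (other α) (n - 1)) := by
    have hA := Lam_mul_eq (other α) (n - 1) (V' * U)
    have hA' := (hVV.1.mul hU).translate (Pi.single (other α) (n - 1))
    generalize translate (Pi.single (other α) (n - 1)) (V' * U) = A' at hA hA'
    have e : Lam (other α) (n - 1) =
        -A' * Lam (other α) n + (0 + Lam (other α) (n - 1) * V' * (U * Lam (other α) 1 + V)) := by
      let a' : Mixed α ε := ⟨A', hA'.isMixed⟩
      have ka : Y (n - 1) * (v' * u) = a' * Y (n - 1) := Subtype.ext hA
      have : Y (n - 1) = -a' * Y n + (0 + Y (n - 1) * v' * K') := by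
        have k1 : Y n = Y (n - 1) * Y 1 := by rw [kY, sub_add_cancel]
        rw [neg_mul, k1, ← _root_.mul_assoc a', ← ka, kK]
        calc Y (n - 1) = Y (n - 1) * (v' * v) := by rw [kv, _root_.mul_one]
          _ = _ := by noncomm_ring
      exact congrArg Subtype.val this
    rw [e]
    exact (ih.mul_left hK hA'.neg).add hK ⟨0, IsSeries.zero α ε, _, (hY _).mul hv, rfl⟩
  induction n using Int.induction_on with
  | zero =>
    rw [Lam_zero]
    exact ⟨1, isSeries_one α ε, 0, IsMixed.zero α ε, by rw [Op.zero_mul, add_zero]⟩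
  | succ n ih => exact up _ ih
  | pred n ih => exact down _ ih

theorem Decomposable.of_bounded (hU : IsSeries α ε U) (hV : IsSeries α ε V)
    (hUU : IsInv α ε U U') (hVV : IsInv α ε V V') (N : ℕ) : ∀ A, IsMixed α ε A →
      (∀ j, A j ≠ 0 → |j (other α)| ≤ N) → Decomposable α ε (U * Lam (other α) 1 + V) A := by
  classical
  have hK : IsMixed α ε (U * Lam (other α) 1 + V) :=
    (hU.isMixed.mul (isMixed_Lam α _ ε 1)).add hV.isMixed
  -- The component of degree n is a series times the n-th power of the other shift.
  have hom (n : ℤ) (A : Op) (hA : IsMixed α ε A) :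
      Decomposable α ε (U * Lam (other α) 1 + V) (part (other α) (· = n) A) := by
    have e : part (other α) (· = n) A =
        part (other α) (· = n) A * Lam (other α) (-n) * Lam (other α) n := by
      have hA' : IsMixed α ε (part (other α) (· = n) A) := hA.part _ _
      rw [hA'.mul_assoc (isMixed_Lam α _ ε _) (isMixed_Lam α _ ε _), Lam_mul_Lam_self,
        neg_add_cancel, Lam_zero, Op.mul_one]
    rw [e]
    refine (decomposable_Lam hU hV hUU hVV n).mul_left hK ?_
    obtain ⟨N, hN⟩ := hA
    refine ⟨N, fun j hj => ?_⟩
    obtain ⟨m, hm⟩ := exists_apply_ne_zero hj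
    rw [mul_Lam_apply] at hm
    obtain ⟨h1, h2⟩ := part_ne_zero (ne_zero_of_apply hm)
    rw [Pi.sub_apply, Pi.single_eq_same] at h1
    have h3 := (hN _ h2).2
    rw [Pi.sub_apply, Pi.single_eq_of_ne (other_ne α).symm, sub_zero] at h3
    refine ⟨fun β hβ => ?_, h3⟩
    rw [eq_other hβ]
    omega
  induction N with
  | zero =>
    intro A hA hb
    have e : A = part (other α) (· = 0) A := by
      ext j m
      rw [part_apply]
      split_ifs with h
      · rfl
      · by_contra hj
        have := hb j (ne_zero_of_apply hj)
        rw [Nat.cast_zero, abs_nonpos_iff] at this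
        exact h this
    rw [e]
    exact hom 0 A hA
  | succ N ih =>
    intro A hA hb
    have e : A = part (other α) (fun x => |x| ≤ N) A +
        (part (other α) (· = N + 1) A + part (other α) (· = -(N + 1)) A) := by
      ext j m
      rw [add_apply, add_apply, part_apply, part_apply, part_apply]
      by_cases hj : A j m = 0
      · simp [hj]
      · have hb' := hb j (ne_zero_of_apply hj)
        push_cast at hb'
        rw [abs_le] at hb'
        by_cases h1 : |j (other α)| ≤ N
        · have h1' := abs_le.mp h1
          rw [if_pos h1, if_neg (by omega), if_neg (by omega), add_zero, add_zero]
        · have h1' : ¬(-(N : ℤ) ≤ j (other α) ∧ j (other α) ≤ N) := fun h => h1 (abs_le.mpr h)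
          rw [if_neg h1]
          by_cases h2 : j (other α) = N + 1
          · rw [if_pos h2, if_neg (by omega), add_zero, zero_add]
          · rw [if_neg h2, if_pos (by omega), zero_add, zero_add]
    rw [e]
    exact (ih _ (hA.part _ _) fun j hj => (part_ne_zero hj).1).add hK
      ((hom _ A hA).add hK (hom _ A hA))

/-- With Y the other shift, the components Q_n of Q satisfy Q_{n-1} U Y + Q_n V = 0 for n ≠ 0. As
Q_n = 0 for large |n| and U Y, V are units, vanishing descends from above to n = 0 and ascends from
below to n = -1; the missing relation at n = 0 is not needed. -/
theorem eq_zero_of_mul_isSeries (hU : IsSeries α ε U) (hV : IsSeries α ε V)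
    (hUU : IsInv α ε U U') (hVV : IsInv α ε V V') {Q : Op} (hQ : IsMixed α ε Q)
    (h : IsSeries α ε (Q * (U * Lam (other α) 1 + V))) : Q = 0 := by
  have hY (n : ℤ) : IsMixed α ε (Lam (other α) n) := isMixed_Lam α _ ε n
  have hUY := hU.isMixed.mul (hY 1)
  have rel (n : ℤ) (hn : n ≠ 0) : part (other α) (· = n - 1) Q * (U * Lam (other α) 1) +
      part (other α) (· = n) Q * V = 0 := by
    have h1 : part (other α) (· = n) (Q * (U * Lam (other α) 1 + V)) = 0 := by
      ext j m
      rw [part_apply, zero_apply]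
      split_ifs with hj
      · by_contra hne
        exact hn (hj ▸ h.isHomog j (ne_zero_of_apply hne))
      · rfl
    rw [hQ.mul_add hUY hV.isMixed, part_add, part_mul (hU.isHomog.mul_Lam 1),
      part_mul hV.isHomog, sub_zero] at h1
    exact h1
  have down (n : ℤ) (hn : n ≠ 0) (h0 : part (other α) (· = n) Q = 0) :
      part (other α) (· = n - 1) Q = 0 := by
    have h1 := rel n hn
    rw [h0, Op.zero_mul, add_zero] at h1
    refine eq_zero_of_mul_isUnit_right (hQ.part _ _) hUY ((hY (-1)).mul hUU.1.isMixed) ?_ h1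
    rw [hU.isMixed.mul_assoc (hY 1) ((hY _).mul hUU.1.isMixed),
      ← (hY 1).mul_assoc (hY _) hUU.1.isMixed, Lam_mul_Lam_self, add_neg_cancel, Lam_zero,
      Op.one_mul, hUU.2.1]
  have up (n : ℤ) (hn : n ≠ 0) (h0 : part (other α) (· = n - 1) Q = 0) :
      part (other α) (· = n) Q = 0 := by
    have h1 := rel n hn
    rw [h0, Op.zero_mul, zero_add] at h1
    exact eq_zero_of_mul_isUnit_right (hQ.part _ _) hV.isMixed hVV.1.isMixed hVV.2.1 h1
  obtain ⟨N, hN⟩ := id hQ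
  have far (n : ℤ) (hn : N < |n|) : part (other α) (· = n) Q = 0 := by
    ext j m
    by_contra hne
    obtain ⟨h1, h2⟩ := part_ne_zero (ne_zero_of_apply hne)
    have := (hN j h2).1 _ (other_ne α)
    rw [h1] at this
    omega
  have pos (k : ℕ) : ∀ n : ℤ, 0 ≤ n → N < n + k → part (other α) (· = n) Q = 0 := by
    induction k with
    | zero =>
      intro n h0 hn
      exact far n (by rw [abs_of_nonneg h0]; simpa using hn)
    | succ k ih =>
      intro n h0 hn
      have := down (n + 1) (by omega) (ih (n + 1) (by omega) (by push_cast at hn; omega))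
      rwa [add_sub_cancel_right] at this
  have neg (k : ℕ) : ∀ n : ℤ, n < 0 → N < -n + k → part (other α) (· = n) Q = 0 := by
    induction k with
    | zero =>
      intro n h0 hn
      exact far n (by rw [abs_of_neg h0]; simpa using hn)
    | succ k ih =>
      intro n h0 hn
      exact up n (by omega) (ih (n - 1) (by omega) (by push_cast at hn; omega))
  have all (n : ℤ) : part (other α) (· = n) Q = 0 := by
    rcases lt_or_ge n 0 with h0 | h0
    · exact neg (N + n + 1).toNat n h0 (by omega)
    · exact pos (N - n + 1).toNat n h0 (by omega)
  ext j m
  have := congrFun (congrFun (all (j (other α))) j) m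
  rwa [part_apply, if_pos rfl] at this

end Op

open Op

variable {α : Fin 2} {ε : ℤˣ}

/-! ### Division by H and the projections. -/

theorem ρ_ne_zero (hτ : ∀ m, τ m ≠ 0) (m : Lattice) : ρ τ m ≠ 0 :=
  mul_ne_zero (div_ne_zero (ι_ne_zero (hτ _)) (ι_ne_zero (hτ _)))
    (div_ne_zero (ι_ne_zero (hτ _)) (ι_ne_zero (hτ _)))

theorem H_eq (τ : Lattice → TSeries) (α : Fin 2) : H τ =
    (![Lam 0 1, Lam 1 1 - 1] α) * Lam (other α) 1 + (![ofFun (ρ τ) - Lam 0 1, ofFun (ρ τ)] α) := by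
  have l (γ : Fin 2) : IsMixed 0 1 (Lam γ 1) := isMixed_Lam 0 γ 1 1
  have o : IsMixed 0 1 (-1) := (isSeries_one 0 1).isMixed.neg
  have h1 : Lam 0 1 * (Lam 1 1 - 1) = Lam 0 1 * Lam 1 1 - Lam 0 1 := by
    let a (γ : Fin 2) : Mixed 0 1 := ⟨Lam γ 1, l γ⟩
    have : a 0 * (a 1 - 1) = a 0 * a 1 - a 0 := by noncomm_ring
    exact congrArg Subtype.val this
  have h2 : (Lam 1 1 - 1) * Lam 0 1 = Lam 0 1 * Lam 1 1 - Lam 0 1 := by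
    rw [Lam_comm 0 1]
    let a (γ : Fin 2) : Mixed 0 1 := ⟨Lam γ 1, l γ⟩
    have : (a 1 - 1) * a 0 = a 1 * a 0 - a 0 := by noncomm_ring
    exact congrArg Subtype.val this
  fin_cases α
  · change Lam 0 1 * (Lam 1 1 - 1) + ofFun (ρ τ) = Lam 0 1 * Lam 1 1 + (ofFun (ρ τ) - Lam 0 1)
    rw [h1]
    abel
  · change Lam 0 1 * (Lam 1 1 - 1) + ofFun (ρ τ) = (Lam 1 1 - 1) * Lam 0 1 + ofFun (ρ τ)
    rw [h1, h2]

theorem ofFun_const_mul_Lam_neg (γ : Fin 2) (n : ℤ) :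
    ofFun (fun _ => -1) * Lam γ n = -Lam γ n := by
  ext j m
  rw [ofFun_mul_apply, neg_apply, neg_one_mul]

/-- The coefficients Λ₁ and ρ - Λ₁ for α = 0, and Λ₂ - 1 and ρ for α = 1, are monomials or binomials
with nonvanishing coefficients, hence units in both expansion directions. -/
theorem exists_H_eq (hτ : ∀ m, τ m ≠ 0) (α : Fin 2) (ε : ℤˣ) : ∃ U V U' V' : Op,
    IsSeries α ε U ∧ IsSeries α ε V ∧ IsInv α ε U U' ∧ IsInv α ε V V' ∧
      H τ = U * Lam (other α) 1 + V := by
  have h := H_eq τ α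
  revert h
  fin_cases α
  · intro h
    have hV : ofFun (ρ τ) - Lam 0 1 = ofFun (ρ τ) + ofFun (fun _ => -1) * Lam 0 1 := by
      rw [ofFun_const_mul_Lam_neg, sub_eq_add_neg]
    obtain ⟨V', hV'⟩ := exists_isInv_binomial 0 ε (ρ_ne_zero hτ) (g := fun _ => -1)
      (fun _ => neg_ne_zero.mpr one_ne_zero)
    exact ⟨Lam 0 1, ofFun (ρ τ) + ofFun (fun _ => -1) * Lam 0 1, _, V', isSeries_Lam 0 ε 1,
      isSeries_binomial _ _ _ _, isInv_Lam 0 ε 1, hV', hV ▸ h⟩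
  · intro h
    have hU : Lam 1 1 - 1 = ofFun (fun _ => -1) + ofFun (fun _ => 1) * Lam 1 1 := by
      have h1 : ofFun (fun _ => -1) = -1 := by
        rw [← Lam_zero 1, ← ofFun_const_mul_Lam_neg, Lam_zero, Op.mul_one]
      have h2 : (ofFun fun _ => 1) = 1 := rfl
      rw [h1, h2, Op.one_mul]
      abel
    obtain ⟨U', hU'⟩ := exists_isInv_binomial 1 ε (f := fun _ => -1) (g := fun _ => 1)
      (fun _ => neg_ne_zero.mpr one_ne_zero) (fun _ => one_ne_zero)
    exact ⟨ofFun (fun _ => -1) + ofFun (fun _ => 1) * Lam 1 1, ofFun (ρ τ), U', _,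
      isSeries_binomial _ _ _ _, isSeries_ofFun _ _ _, hU', isInv_ofFun 1 ε (ρ_ne_zero hτ), hU ▸ h⟩

theorem isMixed_H (τ : Lattice → TSeries) (α : Fin 2) (ε : ℤˣ) : IsMixed α ε (H τ) :=
  ((isMixed_Lam α 0 ε 1).mul ((isMixed_Lam α 1 ε 1).sub (isSeries_one α ε).isMixed)).add
    (isSeries_ofFun α ε _).isMixed

theorem existsUnique_isProj (hτ : ∀ m, τ m ≠ 0) {A : Op} (hA : IsMixed α ε A) :
    ∃! P, IsProj τ α ε A P := by
  obtain ⟨U, V, U', V', hU, hV, hUU, hVV, hH⟩ := exists_H_eq hτ α ε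
  obtain ⟨N, hN⟩ := id hA
  obtain ⟨P, hP, Q, hQ, hPQ⟩ := Decomposable.of_bounded hU hV hUU hVV N.toNat A hA fun j hj =>
    ((hN j hj).1 _ (other_ne α)).trans (Int.self_le_toNat N)
  refine ⟨P, ⟨hP, Q, hQ, by rw [hH, hPQ]⟩, ?_⟩
  rintro P₁ ⟨hP₁, Q₁, hQ₁, hPQ₁⟩
  have hK : IsMixed α ε (U * Lam (other α) 1 + V) :=
    (hU.isMixed.mul (isMixed_Lam α _ ε 1)).add hV.isMixed
  rw [hH, hPQ] at hPQ₁
  have e : (Q₁ + -Q) * (U * Lam (other α) 1 + V) = P + -P₁ := by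
    let q : Mixed α ε := ⟨Q, hQ⟩
    let q₁ : Mixed α ε := ⟨Q₁, hQ₁⟩
    let p : Mixed α ε := ⟨P, hP.isMixed⟩
    let p₁ : Mixed α ε := ⟨P₁, hP₁.isMixed⟩
    let k : Mixed α ε := ⟨_, hK⟩
    have h : p + q * k = p₁ + q₁ * k := Subtype.ext hPQ₁
    have : (q₁ + -q) * k = p + -p₁ := by
      calc (q₁ + -q) * k = (p₁ + q₁ * k) - q * k - p₁ := by noncomm_ring
        _ = p + -p₁ := by rw [← h]; abel
    exact congrArg Subtype.val this
  have h0 := eq_zero_of_mul_isSeries hU hV hUU hVV (hQ₁.add hQ.neg) (by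
    rw [e]; exact hP.add hP₁.neg)
  rw [h0, Op.zero_mul] at e
  exact (add_neg_eq_zero.mp e.symm).symm

theorem isProj_proj (hτ : ∀ m, τ m ≠ 0) {A : Op} (hA : IsMixed α ε A) :
    IsProj τ α ε A (proj τ α ε A) :=
  Classical.epsilon_spec (existsUnique_isProj hτ hA).exists

/-! ### Laurent polynomials -/

namespace Op

theorem IsLaurentPoly.finite {A : Op} (hA : IsLaurentPoly A) : {k | A k ≠ 0}.Finite := by
  obtain ⟨N, hN⟩ := hA
  exact (Set.finite_Icc (fun _ => -N : Lattice) (fun _ => N)).subset fun k hk =>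
    ⟨fun β => (abs_le.mp (hN k hk β)).1, fun β => (abs_le.mp (hN k hk β)).2⟩

theorem IsLaurentPoly.isMixed {A : Op} (hA : IsLaurentPoly A) (α : Fin 2) (ε : ℤˣ) :
    IsMixed α ε A := by
  obtain ⟨N, hN⟩ := hA
  exact ⟨N, fun j hj => ⟨fun β _ => hN j hj β, (units_abs_le ε _).1.trans (hN j hj α)⟩⟩

theorem IsLaurentPoly.isSeries {A : Op} (hA : IsLaurentPoly A)
    (h : ∀ j, A j ≠ 0 → j (other α) = 0) (ε : ℤˣ) : IsSeries α ε A := by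
  obtain ⟨N, hN⟩ := hA
  exact ⟨N, fun j hj => ⟨fun β hβ => eq_other hβ ▸ h j hj,
    (units_abs_le ε _).1.trans (hN j hj α)⟩⟩

theorem IsSeries.isLaurentPoly {A : Op} (hA : IsSeries α ε A) {c : ℤ}
    (h : ∀ j, A j ≠ 0 → c ≤ (ε : ℤ) * j α) : IsLaurentPoly A := by
  obtain ⟨N, hN⟩ := hA
  refine ⟨max |c| |N|, fun j hj β => ?_⟩
  by_cases hβ : β = α
  · subst hβ
    rw [(units_abs_le ε _).2]
    exact abs_le_max_abs_abs (h j hj) (hN j hj).2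
  · rw [(hN j hj).1 β hβ, abs_zero]
    exact (abs_nonneg c).trans (le_max_left _ _)

theorem isLaurentPoly_of_finite {A : Op} (h : {k | A k ≠ 0}.Finite) : IsLaurentPoly A := by
  obtain ⟨N₀, h0⟩ := (h.image fun k => |k 0|).bddAbove
  obtain ⟨N₁, h1⟩ := (h.image fun k => |k 1|).bddAbove
  refine ⟨max N₀ N₁, fun j hj β => ?_⟩
  fin_cases β
  · exact (h0 ⟨j, hj, rfl⟩).trans (le_max_left _ _)
  · exact (h1 ⟨j, hj, rfl⟩).trans (le_max_right _ _)

theorem IsSeries.sub {A B : Op} (hA : IsSeries α ε A) (hB : IsSeries α ε B) :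
    IsSeries α ε (A - B) := by
  rw [sub_eq_add_neg]
  exact hA.add hB.neg

theorem act_neg (A : Op) (φ : Lattice → TField) : act (-A) φ = -act A φ := by
  funext m
  rw [Pi.neg_apply, act, act, ← finsum_neg_distrib]
  exact finsum_congr fun k => neg_mul _ _

theorem act_Lam (γ : Fin 2) (n : ℤ) (φ : Lattice → TField) (m : Lattice) :
    act (Lam γ n) φ m = φ (m + Pi.single γ n) := by
  rw [act, finsum_eq_single _ (Pi.single γ n)]
  · simp [Lam_apply]
  · intro k hk
    simp [Lam_apply, hk]

theorem act_ofFun (f : Lattice → TField) (φ : Lattice → TField) (m : Lattice) :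
    act (ofFun f) φ m = f m * φ m := by
  rw [act, finsum_eq_single _ 0]
  · simp [ofFun]
  · intro k hk
    simp [ofFun, hk]

theorem act_eq_zero {A : Op} {φ : Lattice → TField} {m : Lattice}
    (h : ∀ k, A k ≠ 0 → φ (m + k) = 0) : act A φ m = 0 := by
  refine finsum_eq_zero_of_forall_eq_zero fun k => ?_
  by_cases hk : A k = 0
  · rw [hk]; simp
  · rw [h k hk, MulZeroClass.mul_zero]

end Op

/-! ### Wave operators -/

/-- `S` is the series in `Λ_{α+1}^{-ε}` with the same coefficients as the `j`-th wave function. -/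
structure IsWaveOp (τ : Lattice → TSeries) (j : Fin 3) (α : Fin 2) (ε : ℤˣ) (S : Op) : Prop where
  exists_coeff : ∃ a, S = series α (-ε) a ∧ (∀ m, a 0 m ≠ 0) ∧
    ∀ n (k : ℕ) m, (k : ℤ) = dir j * (n - lead j m) → wave τ j n m = a k m
  dir_mul_lead : ∀ m x, (dir j : ℤ) * lead j (m + Pi.single α x) = dir j * lead j m - ε * x
  admissible : ∀ n, Admissible α ε (wave τ j n)

theorem dir_mul_nonneg_of_wave_ne_zero {j : Fin 3} {n : ℤ} {m : Lattice} (h : wave τ j n m ≠ 0) :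
    0 ≤ (dir j : ℤ) * (n - lead j m) := by
  by_contra hn
  exact h (wave_eq_zero j (by omega))

theorem isWaveOp_S₁ (hτ : ∀ m, τ m ≠ 0) : IsWaveOp τ 0 0 1 (S₁ τ) where
  exists_coeff := by
    refine ⟨_, rfl, fun m => ?_, fun n k m hk => ?_⟩
    · rw [coeff_zero_miwa]
      exact div_ne_zero (ι_ne_zero (hτ _)) (ι_ne_zero (hτ _))
    · rw [wave, ← hk, zCoeff_natCast]
      simp [sgn, latShift]
  dir_mul_lead m x := by simp [dir, lead]; ring
  admissible n M := by
    refine ⟨n, fun m hm hM => ?_⟩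
    have := dir_mul_nonneg_of_wave_ne_zero hm
    simp [dir, lead] at this ⊢
    omega

theorem isWaveOp_S₂ (hτ : ∀ m, τ m ≠ 0) : IsWaveOp τ 1 1 (-1) (S₂ τ) where
  exists_coeff := by
    refine ⟨fun k m => ι (PowerSeries.coeff k (miwa 1 (-1) (τ (m + e)))) / ι (τ m),
      by rw [neg_neg]; rfl, fun m => ?_, fun n k m hk => ?_⟩
    · dsimp only
      rw [coeff_zero_miwa]
      exact div_ne_zero (ι_ne_zero (hτ _)) (ι_ne_zero (hτ _))
    · rw [wave, ← hk, zCoeff_natCast]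
      simp [sgn, latShift]
  dir_mul_lead m x := by simp [dir, lead]
  admissible n M := by
    refine ⟨-n, fun m hm hM => ?_⟩
    have := dir_mul_nonneg_of_wave_ne_zero hm
    simp [dir, lead] at this ⊢
    omega

theorem a₃_zero_ne_zero (hτ : ∀ m, τ m ≠ 0) (m : Lattice) : a₃ τ 0 m ≠ 0 := by
  rw [a₃, coeff_zero_miwa]
  exact mul_ne_zero (sgn_cast_ne_zero 2 m) (div_ne_zero (ι_ne_zero (hτ _)) (ι_ne_zero (hτ _)))

theorem wave_two_eq_a₃ (n : ℤ) (k : ℕ) (m : Lattice) (hk : (k : ℤ) = dir 2 * (n - lead 2 m)) :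
    wave τ 2 n m = a₃ τ k m := by
  rw [wave, ← hk, zCoeff_natCast]
  rfl

theorem isWaveOp_S₃ (hτ : ∀ m, τ m ≠ 0) : IsWaveOp τ 2 0 (-1) (S₃ τ) where
  exists_coeff := ⟨a₃ τ, by rw [neg_neg]; rfl, a₃_zero_ne_zero hτ, wave_two_eq_a₃⟩
  dir_mul_lead m x := by simp [dir, lead]; ring
  admissible n M := by
    -- A nonzero coefficient forces m₁ ≤ n + m₂ ≤ n + M.
    refine ⟨-n - M, fun m hm hM => ?_⟩
    have := dir_mul_nonneg_of_wave_ne_zero hm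
    have h1 := (abs_le.mp (hM 1 (by decide))).2
    simp [dir, lead] at this ⊢
    omega

theorem isWaveOp_S₃' (hτ : ∀ m, τ m ≠ 0) : IsWaveOp τ 2 1 1 (S₃' τ) where
  exists_coeff := ⟨a₃ τ, rfl, a₃_zero_ne_zero hτ, wave_two_eq_a₃⟩
  dir_mul_lead m x := by simp [dir, lead]; ring
  admissible n M := by
    refine ⟨-n - M, fun m hm hM => ?_⟩
    have := dir_mul_nonneg_of_wave_ne_zero hm
    have h1 := (abs_le.mp (hM 0 (by decide))).1
    simp [dir, lead] at this ⊢
    omega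

section WaveOp

variable {j : Fin 3} {S : Op} {q : ℤ}

theorem IsWaveOp.isSeries (hS : IsWaveOp τ j α ε S) : IsSeries α ε S := by
  obtain ⟨a, rfl, -, -⟩ := hS.exists_coeff
  exact isSeries_series α ε a

theorem IsWaveOp.existsUnique_isInv (hS : IsWaveOp τ j α ε S) : ∃! T, IsInv α ε S T := by
  obtain ⟨a, rfl, ha, -⟩ := hS.exists_coeff
  exact existsUnique_isInv_series α ε a ha

theorem IsWaveOp.isInv_inv (hS : IsWaveOp τ j α ε S) : IsInv α ε S (inv α ε S) :=
  Op.isInv_inv hS.existsUnique_isInv.exists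

/-- This is Ψ_j = S z^{lead}, read coefficientwise: a shift of m acts on z^{lead} as multiplication
by a power of z. -/
theorem IsWaveOp.wave_eq (hS : IsWaveOp τ j α ε S) (n : ℤ) (m : Lattice) :
    wave τ j n m = S (Pi.single α (-ε * (dir j * (n - lead j m)))) m := by
  obtain ⟨a, rfl, -, h⟩ := hS.exists_coeff
  rcases lt_or_ge ((dir j : ℤ) * (n - lead j m)) 0 with hn | hn
  · rw [wave_eq_zero j hn]
    by_contra h0
    obtain ⟨p, hp⟩ := eq_single_of_series_ne_zero (Ne.symm h0)
    have h1 := Pi.single_injective α hp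
    rw [Units.val_neg] at h1
    have := mul_left_cancel₀ (neg_ne_zero.mpr ε.ne_zero) h1
    omega
  · obtain ⟨k, hk⟩ := Int.eq_ofNat_of_zero_le hn
    rw [h n k m hk.symm, hk]
    exact (series_single α (-ε) a k m).symm

/-- C(S z^{lead}) = (C S) z^{lead}; the coefficients of Ψ_j thus encode operator products. -/
theorem IsWaveOp.act_wave (hS : IsWaveOp τ j α ε S) {C : Op} (hC : IsSeries α ε C) (n : ℤ)
    (m : Lattice) :
    act C (wave τ j n) m = (C * S) (Pi.single α (-ε * (dir j * (n - lead j m)))) m := by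
  obtain ⟨N, hN⟩ := hC
  rw [act, mul_apply]
  refine finsum_congr fun k => ?_
  by_cases hk : C k = 0
  · rw [hk]; simp
  · have e : k = Pi.single α (k α) := by
      refine lattice_ext α (by rw [Pi.single_eq_same]) ?_
      rw [Pi.single_eq_of_ne (other_ne α), (hN k hk).1 _ (other_ne α)]
    rw [hS.wave_eq]
    congr 2
    rw [e, ← Pi.single_sub (f := fun _ : Fin 2 => ℤ)]
    congr 1
    have := hS.dir_mul_lead m (k α)
    have h2 := units_mul_mul ε (k α)
    linear_combination (ε : ℤ) * this - h2

theorem mul_self_units (ε : ℤˣ) : (ε : ℤ) * ε = 1 := by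
  rw [← Units.val_mul, Int.units_mul_self, Units.val_one]

/-- Multiplying Ψ_j by a power of z is multiplying S by a power of the shift on the right. -/
theorem IsWaveOp.wave_shift (hS : IsWaveOp τ j α ε S) (n k : ℤ) (m : Lattice) :
    wave τ j (n + dir j * k) m =
      (S * Lam α (ε * k)) (Pi.single α (-ε * (dir j * (n - lead j m)))) m := by
  rw [mul_Lam_apply, ← Pi.single_sub (f := fun _ : Fin 2 => ℤ), hS.wave_eq]
  congr 2
  linear_combination (-(ε : ℤ) * k) * mul_self_units (dir j)

/-- The operator form of `∂/∂t_σ` acting on the exponential factor of the `j`-th wave function. -/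
def expFactor (α : Fin 2) (ε : ℤˣ) (j : Fin 3) (σ : TimeIdx) : Op :=
  if σ.1 = j then Lam α (ε * (σ.2 : ℕ)) else 0

theorem isSeries_expFactor (σ : TimeIdx) : IsSeries α ε (expFactor α ε j σ) := by
  unfold expFactor
  split_ifs
  · exact isSeries_Lam α ε _
  · exact IsSeries.zero α ε

theorem IsWaveOp.sato (hS : IsWaveOp τ j α ε S) {C : Op} (hC : IsSeries α ε C) (σ : TimeIdx)
    (h : ∀ n m, act C (wave τ j n) m = flowD σ j (wave τ j) n m) :
    C * S = S.deriv σ + S * expFactor α ε j σ := by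
  have hs := hS.isSeries
  ext i m
  by_cases hi : i (other α) = 0
  · obtain ⟨n, rfl⟩ : ∃ n : ℤ, i = Pi.single α (-ε * (dir j * (n - lead j m))) := by
      -- For fixed m, the degrees n in z correspond bijectively to the powers of the shift, so the
      -- equations for all n give the whole operator identity.
      refine ⟨lead j m - ε * dir j * i α, lattice_ext α ?_ ?_⟩
      · rw [Pi.single_eq_same]
        linear_combination (-(dir j : ℤ) * dir j * i α) * mul_self_units ε -
          i α * mul_self_units (dir j)
      · rw [Pi.single_eq_of_ne (other_ne α), hi]
    rw [← hS.act_wave hC, h, flowD, add_apply, deriv_apply, ← hS.wave_eq, hS.wave_shift, expFactor]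
    split_ifs
    · rfl
    · rw [Op.mul_zero, zero_apply]
  · have z {A : Op} (hA : IsSeries α ε A) : A i m = 0 := by
      by_contra h0
      exact hi (hA.isHomog i (ne_zero_of_apply h0))
    rw [z (hC.mul hs), z ((hs.deriv σ).add (hs.mul (isSeries_expFactor σ)))]

theorem IsWaveOp.lax (hS : IsWaveOp τ j α ε S) {C : Op} (hC : IsSeries α ε C) (σ : TimeIdx)
    (h : ∀ n m, act C (wave τ j n) m = flowD σ j (wave τ j) n m) (q : ℤ) :
    (S * Lam α q * inv α ε S).deriv σ = C.comm (S * Lam α q * inv α ε S) := by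
  have hi := hS.isInv_inv
  refine lax_of_sato q hS.isSeries.isMixed hi.1.isMixed hC.isMixed
    (isSeries_expFactor (j := j) σ).isMixed hi.2.1 hi.2.2 ?_ (hS.sato hC σ h)
  unfold expFactor
  split_ifs
  · exact Lam_comm α α _ _
  · rw [Op.zero_mul, Op.mul_zero]

theorem IsWaveOp.isSeries_lax (hS : IsWaveOp τ j α ε S) (q : ℤ) :
    IsSeries α ε (S * Lam α q * inv α ε S) :=
  (hS.isSeries.mul (isSeries_Lam α ε q)).mul hS.isInv_inv.1

/-- Read on the wave function, L^k S = S Λ^{qk} says that Ψ_j is an eigenfunction of L^k whose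
eigenvalue is a power of z. -/
theorem IsWaveOp.lax_pow (hS : IsWaveOp τ j α ε S) (q : ℤ) (k : ℕ) :
    IsSeries α ε (Op.pow (S * Lam α q * inv α ε S) k) ∧
      Op.pow (S * Lam α q * inv α ε S) k * S = S * Lam α (q * k) := by
  have hi := hS.isInv_inv
  let s : Mixed α ε := ⟨S, hS.isSeries.isMixed⟩
  let t : Mixed α ε := ⟨inv α ε S, hi.1.isMixed⟩
  let l : Mixed α ε := s * Mixed.lam α q * t
  have ts : t * s = 1 := Subtype.ext hi.2.2
  have hl : (l : Op) = S * Lam α q * inv α ε S := rfl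
  rw [← hl, ← Mixed.coe_pow]
  refine ⟨(Mixed.seriesSubring α ε).pow_mem (x := l) (hS.isSeries_lax q) k, ?_⟩
  have : l ^ k * s = s * Mixed.lam α (q * k) := by
    rw [mul_comm q, ← Mixed.lam_pow]
    induction k with
    | zero => simp
    | succ k ih =>
      calc l ^ (k + 1) * s = l ^ k * s * Mixed.lam α q * (t * s) := by
            rw [pow_succ]; simp only [l]; noncomm_ring
        _ = _ := by rw [ts, _root_.mul_one, ih, _root_.mul_assoc, pow_succ]
  exact congrArg Subtype.val this

/-- The behaviour at the leading order of the flow generated by a truncation `B` of `L^k`. -/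
theorem IsWaveOp.flowD_sub_act (hS : IsWaveOp τ j α ε S) {k : ℕ+} {B R : Op}
    (hB : IsSeries α ε B) (hR : IsSeries α ε R) (hq : q = ε)
    (hL : Op.pow (S * Lam α q * inv α ε S) k = B + R) (n : ℤ) (m : Lattice) :
    flowD (j, k) j (wave τ j) n m - act B (wave τ j n) m =
      dt (j, k) (wave τ j n m) + act R (wave τ j n) m := by
  obtain ⟨h1, h2⟩ := hS.lax_pow q k
  have h3 : act (B + R) (wave τ j n) m = wave τ j (n + dir j * (k : ℕ)) m := by
    rw [← hL, hS.act_wave h1, h2, hS.wave_shift, hq]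
  rw [act_add hB.isMixed hR.isMixed (hS.admissible n), Pi.add_apply] at h3
  rw [flowD, if_pos rfl, ← h3]
  ring

theorem IsWaveOp.act_wave_eq_zero (hS : IsWaveOp τ j α ε S) {R : Op} (hR : IsSeries α ε R) {c : ℤ}
    (hRc : ∀ i, R i ≠ 0 → (ε : ℤ) * i α ≤ c) {n : ℤ} {m : Lattice}
    (h : (dir j : ℤ) * (n - lead j m) + c < 0) : act R (wave τ j n) m = 0 := by
  refine act_eq_zero fun k hk => wave_eq_zero j ?_
  have e : k = Pi.single α (k α) := by
    refine lattice_ext α (by rw [Pi.single_eq_same]) ?_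
    rw [Pi.single_eq_of_ne (other_ne α), hR.isHomog k hk]
  have h1 := hS.dir_mul_lead m (k α)
  rw [← e] at h1
  have h2 := hRc k hk
  rw [mul_sub] at h ⊢
  linarith

end WaveOp

/-! ### The linear equations for the wave functions -/

/-- A series bounded on one side meets a dual function bounded on the other side in finitely many
degrees. -/
theorem pairing_support_finite (j : Fin 3) (m' : Lattice) {φ : ℤ → TField} {c : ℤ}
    (h : ∀ n, (dir j : ℤ) * n < c → φ n = 0) :
    (Function.support fun n => φ n * dual τ j m' n).Finite := by
  have hfin : {n : ℤ | c ≤ (dir j : ℤ) * n ∧ (dir j : ℤ) * n ≤ dir j * (lead j m' - 1)}.Finite := by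
    rcases dir_cases j with hj | hj
    · refine (Set.finite_Icc c (lead j m' - 1)).subset fun n hn => ?_
      obtain ⟨h1, h2⟩ := hn
      rw [hj] at h1 h2
      exact ⟨by omega, by omega⟩
    · refine (Set.finite_Icc (lead j m' - 1) (-c)).subset fun n hn => ?_
      obtain ⟨h1, h2⟩ := hn
      rw [hj] at h1 h2
      exact ⟨by omega, by omega⟩
  refine hfin.subset fun n hn => ⟨?_, ?_⟩
  · by_contra hc
    exact left_ne_zero_of_mul hn (h n (by omega))
  · by_contra hc
    refine right_ne_zero_of_mul hn (dual_eq_zero j ?_)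
    rw [mul_sub] at hc
    rw [mul_add, mul_sub]
    linarith

theorem wave_bounded (j : Fin 3) (m : Lattice) (n : ℤ) (h : (dir j : ℤ) * n < dir j * lead j m) :
    wave τ j n m = 0 := wave_eq_zero j (by rw [mul_sub]; linarith)

theorem flowD_bounded (σ : TimeIdx) (j : Fin 3) (m : Lattice) (n : ℤ)
    (h : (dir j : ℤ) * n < dir j * lead j m - (σ.2 : ℕ)) : flowD σ j (wave τ j) n m = 0 := by
  rw [flowD, wave_bounded j m n (by omega), wave_bounded, ite_self, dt_zero, add_zero]
  rw [mul_add, ← mul_assoc, dir_mul_self, one_mul]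
  omega

theorem exists_act_bounded {B : Op} (hB : IsLaurentPoly B) (j : Fin 3) (m : Lattice) :
    ∃ c, ∀ n, (dir j : ℤ) * n < c → act B (wave τ j n) m = 0 := by
  obtain ⟨c, hc⟩ := (hB.finite.image fun k => (dir j : ℤ) * lead j (m + k)).bddBelow
  refine ⟨c, fun n hn => act_eq_zero fun k hk => wave_bounded j _ n ?_⟩
  exact hn.trans_le (hc ⟨k, hk, rfl⟩)

theorem finsum_act_mul_dual {B : Op} (hB : IsLaurentPoly B) (j : Fin 3) (m m' : Lattice) :
    ∑ᶠ n, act B (wave τ j n) m * dual τ j m' n =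
      ∑ᶠ k, B k m * ∑ᶠ n, wave τ j n (m + k) * dual τ j m' n := by
  refine finsum_mul_finsum_assoc (fun k => B k m) (fun k n => wave τ j n (m + k))
    (fun n => dual τ j m' n) ?_
  refine (hB.finite.biUnion fun k _ => (pairing_support_finite (τ := τ) j m'
    (wave_bounded (τ := τ) j (m + k))).image (Prod.mk k)).subset ?_
  rintro ⟨k, n⟩ hp
  exact Set.mem_biUnion (ne_zero_of_apply (left_ne_zero_of_mul hp))
    ⟨n, right_ne_zero_of_mul hp, rfl⟩

/-- With m' fixed, this is a linear combination of the pairings at the points m + k. Laurent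
polynomials give finite combinations, so they act on all three wave functions, although these are
expanded in different directions. -/
theorem IsTau.pairing_act (hτ : IsTau τ) {B : Op} (hB : IsLaurentPoly B) (m m' : Lattice) :
    ∑ᶠ n, act B (wave τ 0 n) m * dual τ 0 m' n =
      ∑ᶠ n, act B (wave τ 1 n) m * dual τ 1 m' n + ∑ᶠ n, act B (wave τ 2 n) m * dual τ 2 m' n := by
  simp only [finsum_act_mul_dual hB]
  have hfin (j : Fin 3) : (Function.support fun k => B k m *
      ∑ᶠ n, wave τ j n (m + k) * dual τ j m' n).Finite :=
    hB.finite.subset fun k hk => ne_zero_of_apply (left_ne_zero_of_mul hk)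
  rw [← finsum_add_distrib (hfin 1) (hfin 2)]
  exact finsum_congr fun k => by rw [hτ.pairing, mul_add]

/-- Both the flow and B preserve the pairing relation, so the differences form a triple to which
`eq_zero_of_pairing` applies at M = m. Linear equations thus reduce to conditions on orders in z. -/
theorem IsTau.act_wave_eq_flowD (hτ : IsTau τ) {B : Op} (hB : IsLaurentPoly B) (σ : TimeIdx)
    (h0 : ∀ m n, lead 0 m ≤ n → flowD σ 0 (wave τ 0) n m - act B (wave τ 0 n) m = 0)
    (h1 : ∀ m, ∀ n < lead 1 m, flowD σ 1 (wave τ 1) n m - act B (wave τ 1 n) m = 0)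
    (h2 : ∀ m, ∀ n < lead 2 m, flowD σ 2 (wave τ 2) n m - act B (wave τ 2 n) m = 0)
    (j : Fin 3) (n : ℤ) (m : Lattice) :
    act B (wave τ j n) m = flowD σ j (wave τ j) n m := by
  have key := eq_zero_of_pairing hτ.ne_zero
    (fun j n => flowD σ j (wave τ j) n m - act B (wave τ j n) m) m (h0 m) (h1 m) (h2 m) ?_ j
  · exact (sub_eq_zero.mp (congrFun key n)).symm
  · intro m'
    have e (j : Fin 3) : ∑ᶠ n, (flowD σ j (wave τ j) n m - act B (wave τ j n) m) * dual τ j m' n =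
        ∑ᶠ n, flowD σ j (wave τ j) n m * dual τ j m' n -
          ∑ᶠ n, act B (wave τ j n) m * dual τ j m' n := by
      obtain ⟨c, hc⟩ := exists_act_bounded (τ := τ) hB j m
      rw [← finsum_sub_distrib (pairing_support_finite j m' (flowD_bounded σ j m))
        (pairing_support_finite j m' hc)]
      exact finsum_congr fun n => sub_mul _ _ _
    rw [e, e, e, hτ.pairing_flowD, hτ.pairing_act hB]
    ring

theorem isLaurentPoly_H (τ : Lattice → TSeries) : IsLaurentPoly (H τ) := by
  refine isLaurentPoly_of_finite ((Set.toFinite {0, Pi.single 0 1,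
    Pi.single 0 1 + Pi.single 1 1}).subset fun k hk => ?_)
  rw [Set.mem_ofPred_eq, H_eq τ 0] at hk
  obtain ⟨m, hm⟩ := exists_apply_ne_zero hk
  change (Lam 0 1 * Lam 1 1 + (ofFun (ρ τ) - Lam 0 1)) k m ≠ 0 at hm
  rw [add_apply, sub_apply, Lam_mul_Lam, Lam_apply, ofFun] at hm
  by_contra hn
  simp only [Set.mem_insert_iff, Set.mem_singleton_iff, not_or] at hn
  simp [hn.1, hn.2.1, hn.2.2] at hm

theorem exists_admissible (hτ : ∀ m, τ m ≠ 0) (j : Fin 3) :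
    ∃ α ε, ∀ n, Admissible α ε (wave τ j n) := by
  fin_cases j
  · exact ⟨_, _, (isWaveOp_S₁ hτ).admissible⟩
  · exact ⟨_, _, (isWaveOp_S₂ hτ).admissible⟩
  · exact ⟨_, _, (isWaveOp_S₃ hτ).admissible⟩

theorem single_zero_one_add : (Pi.single 0 1 + Pi.single 1 1 : Lattice) = e := by
  funext β
  fin_cases β <;> simp [e]

theorem single_zero_one : (Pi.single 0 1 : Lattice) = e₁ := by
  funext β
  fin_cases β <;> simp [e₁]

theorem act_H (hτ : ∀ m, τ m ≠ 0) (j : Fin 3) (n : ℤ) (m : Lattice) : act (H τ) (wave τ j n) m =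
    wave τ j n (m + e) - wave τ j n (m + e₁) + ρ τ m * wave τ j n m := by
  obtain ⟨α, ε, h⟩ := exists_admissible hτ j
  have hH : H τ = Lam 0 1 * Lam 1 1 + (ofFun (ρ τ) + -Lam 0 1) := by
    rw [← sub_eq_add_neg]
    exact H_eq τ 0
  have l (γ : Fin 2) : IsMixed α ε (Lam γ 1) := isMixed_Lam α γ ε 1
  have o : IsMixed α ε (ofFun (ρ τ)) := (isSeries_ofFun α ε _).isMixed
  rw [hH, act_add ((l 0).mul (l 1)) (o.add (l 0).neg) (h n), act_add o (l 0).neg (h n),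
    act_mul (l 0) (l 1) (h n), act_neg, Pi.add_apply, Pi.add_apply, Pi.neg_apply, act_Lam, act_Lam,
    act_ofFun, act_Lam, add_assoc m, single_zero_one_add, single_zero_one]
  ring

/-- Uniqueness is applied at m + e₁, where the order bounds for Ψ₁ and Ψ₃ demand one cancellation
each. -/
theorem IsTau.act_H_wave (hτ : IsTau τ) (j : Fin 3) (n : ℤ) (m : Lattice) :
    act (H τ) (wave τ j n) m = 0 := by
  have le (m : Lattice) : lead 0 (m + e) = m 0 + 1 ∧ lead 1 (m + e) = m 1 + 1 ∧
      lead 2 (m + e) = m 0 - m 1 ∧ lead 0 (m + e₁) = m 0 + 1 ∧ lead 1 (m + e₁) = m 1 ∧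
      lead 2 (m + e₁) = m 0 + 1 - m 1 := by
    simp [lead, e, e₁]
  obtain ⟨l1, l2, l3, l4, l5, l6⟩ := le m
  have d0 : (dir 0 : ℤ) = -1 := rfl
  have d1 : (dir 1 : ℤ) = 1 := rfl
  have d2 : (dir 2 : ℤ) = 1 := rfl
  have f0 : lead 0 m = m 0 := rfl
  have f1 : lead 1 m = m 1 := rfl
  have f2 : lead 2 m = m 0 - m 1 := rfl
  have key := eq_zero_of_pairing hτ.ne_zero (fun j n => act (H τ) (wave τ j n) m) (m + e₁)
    ?_ ?_ ?_ (hτ.pairing_act (isLaurentPoly_H τ) m) j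
  · exact congrFun key n
  · intro n hn
    rw [l4] at hn
    simp only [act_H hτ.ne_zero]
    rw [wave_eq_zero 0 (m := m) (by rw [d0, f0]; omega), mul_zero, add_zero]
    -- At z^{m₁+1} the leading coefficients of Ψ₁(m+e) and Ψ₁(m+e₁) are both 1 and cancel.
    rcases hn.eq_or_lt with rfl | hn
    · have w1 := wave_lead (τ := τ) 0 (m + e)
      have w2 := wave_lead (τ := τ) 0 (m + e₁)
      rw [l1] at w1
      rw [l4] at w2
      rw [w1, w2]
      simp [sgn, latShift, ι_ne_zero (hτ.ne_zero _)]
    · rw [wave_eq_zero 0 (by rw [d0, l1]; omega), wave_eq_zero 0 (by rw [d0, l4]; omega), sub_zero]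
  · intro n hn
    rw [l5] at hn
    simp only [act_H hτ.ne_zero]
    rw [wave_eq_zero 1 (m := m) (by rw [d1, f1]; omega), wave_eq_zero 1 (by rw [d1, l2]; omega),
      wave_eq_zero 1 (by rw [d1, l5]; omega)]
    ring
  · intro n hn
    rw [l6] at hn
    simp only [act_H hτ.ne_zero]
    rw [wave_eq_zero 2 (m := m + e₁) (by rw [d2, l6]; omega), sub_zero]
    -- At z^{m₁-m₂} the terms Ψ₃(m+e) and ρΨ₃(m) cancel: their signs (-1)^{m₂} are opposite, and ρ
    -- is the ratio of the remaining tau quotients.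
    rcases (show n ≤ m 0 - m 1 by omega).eq_or_lt with rfl | hn
    · have w1 := wave_lead (τ := τ) 2 (m + e)
      have w2 := wave_lead (τ := τ) 2 m
      rw [l3] at w1
      rw [f2] at w2
      rw [w1, w2]
      have hs : sgn 2 (m + e) = -sgn 2 m := by
        simp [sgn, e, Int.negOnePow_succ]
      have n1 := ι_ne_zero (hτ.ne_zero m)
      have n2 := ι_ne_zero (hτ.ne_zero (m + e₁))
      have n3 := ι_ne_zero (hτ.ne_zero (m + e))
      rw [hs, ρ]
      simp only [latShift, Matrix.cons_val]
      push_cast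
      field_simp
      ring
    · rw [wave_eq_zero 2 (by rw [d2, l3]; omega), wave_eq_zero 2 (m := m) (by rw [d2, f2]; omega)]
      ring

/-- A differs from its projection by a left multiple of H, which annihilates the wave function. -/
theorem IsTau.act_proj (hτ : IsTau τ) {A : Op} (hA : IsMixed α ε A) {j : Fin 3} {n : ℤ}
    (hφ : Admissible α ε (wave τ j n)) (m : Lattice) :
    act (proj τ α ε A) (wave τ j n) m = act A (wave τ j n) m := by
  obtain ⟨hP, Q, hQ, hPQ⟩ := isProj_proj hτ.ne_zero hA
  have hH : act (H τ) (wave τ j n) = fun _ => 0 := funext (hτ.act_H_wave j n)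
  conv_rhs => rw [hPQ]
  rw [act_add hP.isMixed (hQ.mul (isMixed_H τ α ε)) hφ, act_mul hQ (isMixed_H τ α ε) hφ, hH,
    act_zero_right, Pi.add_apply, add_zero]

theorem IsWaveOp.lax_proj (hτ : IsTau τ) {j : Fin 3} {S : Op} (hS : IsWaveOp τ j α ε S) {B : Op}
    (hB : IsMixed α ε B) (σ : TimeIdx)
    (h : ∀ n m, act B (wave τ j n) m = flowD σ j (wave τ j) n m) (q : ℤ) :
    (S * Lam α q * inv α ε S).deriv σ = (proj τ α ε B).comm (S * Lam α q * inv α ε S) :=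
  hS.lax (isProj_proj hτ.ne_zero hB).1 σ
    (fun n m => (hτ.act_proj hB (hS.admissible n) m).trans (h n m)) q

/-! ### Truncations -/

namespace Op

/-- Binomial inversion, obtained by comparing coefficients in X^n = ((X - 1) + 1)^n. -/
theorem sum_neg_one_pow_mul_choose_mul_choose (N n l : ℕ) (hn : n ≤ N) :
    ∑ k ∈ Finset.range (N + 1), ((-1) ^ (k + l) * ((k.choose l : ℕ) : TField)) *
      ((n.choose k : ℕ) : TField) = if l = n then 1 else 0 := by
  have h : (Polynomial.X : Polynomial TField) ^ n = ∑ k ∈ Finset.range (n + 1),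
      (Polynomial.X + Polynomial.C (-1)) ^ k * ((n.choose k : ℕ) : Polynomial TField) := by
    have := add_pow (Polynomial.X + Polynomial.C (-1 : TField)) 1 n
    simpa using this
  have h1 := congrArg (fun p => Polynomial.coeff p l) h
  simp only [Polynomial.coeff_X_pow, Polynomial.finsetSum_coeff, Polynomial.coeff_mul_natCast,
    Polynomial.coeff_X_add_C_pow] at h1
  rw [h1]
  symm
  refine Finset.sum_subset_zero_on_sdiff (Finset.range_mono (by omega)) (fun k hk => ?_)
    fun k _ => ?_
  · rw [Finset.mem_sdiff, Finset.mem_range, Finset.mem_range] at hk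
    rw [Nat.choose_eq_zero_of_lt (show n < k by omega), Nat.cast_zero, MulZeroClass.mul_zero]
  · congr 1
    rcases lt_or_ge k l with hkl | hkl
    · rw [Nat.choose_eq_zero_of_lt hkl, Nat.cast_zero, MulZeroClass.mul_zero,
        MulZeroClass.mul_zero]
    · obtain ⟨d, rfl⟩ := Nat.exists_eq_add_of_le hkl
      rw [Nat.add_sub_cancel_left, show l + d + l = 2 * l + d by ring, pow_add, pow_mul]
      simp

variable {A : Op} {N : ℕ}

theorem deltaCoeff_eq (hN : ∀ j, A j ≠ 0 → (ε : ℤ) * j α ≤ N) (k : ℕ) (m : Lattice) :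
    deltaCoeff α ε A k m = ∑ n ∈ Finset.range (N + 1),
      ((n.choose k : ℕ) : TField) * A (Pi.single α ((ε : ℤ) * (n : ℤ))) m := by
  refine finsum_eq_sum_of_support_subset _ fun n hn => ?_
  have := hN _ (ne_zero_of_apply (right_ne_zero_of_mul hn))
  rw [Pi.single_eq_same, units_mul_mul] at this
  simp only [Finset.coe_range, Set.mem_Iio]
  omega

/-- Dropping the Δ^0 term of a polynomial in Q subtracts its value at Q = 1. Negative powers of Q
contribute only negative powers of Δ, so just the constant coefficient of the nonnegative part
changes. -/
theorem deltaPartPos_eq (hN : ∀ j, A j ≠ 0 → (ε : ℤ) * j α ≤ N) :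
    deltaPartPos α ε A = series α ε fun l m => A (Pi.single α ((ε : ℤ) * (l : ℤ))) m -
      if l = 0 then ∑ n ∈ Finset.range (N + 1), A (Pi.single α ((ε : ℤ) * (n : ℤ))) m else 0 := by
  unfold deltaPartPos
  congr 1
  funext l m
  have hsup : (Function.support fun k : ℕ => if 1 ≤ k then
      (-1) ^ (k + l) * ((k.choose l : ℕ) : TField) * deltaCoeff α ε A k m else 0) ⊆
        (Finset.range (N + 1) : Finset ℕ) := by
    intro k hk
    simp only [Finset.coe_range, Set.mem_Iio]
    by_contra hkN
    apply hk
    dsimp only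
    rw [deltaCoeff_eq hN, Finset.sum_eq_zero, MulZeroClass.mul_zero, ite_self]
    intro n hn
    rw [Finset.mem_range] at hn
    rw [Nat.choose_eq_zero_of_lt (show n < k by omega), Nat.cast_zero, MulZeroClass.zero_mul]
  rw [finsum_eq_sum_of_support_subset _ hsup]
  -- Including k = 0 returns the original coefficient; the k = 0 term is then split off and affects
  -- l = 0 only.
  have full : ∑ k ∈ Finset.range (N + 1),
      (-1) ^ (k + l) * ((k.choose l : ℕ) : TField) * deltaCoeff α ε A k m =
        A (Pi.single α ((ε : ℤ) * (l : ℤ))) m := by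
    simp only [deltaCoeff_eq hN, Finset.mul_sum]
    rw [Finset.sum_comm]
    have inner (n : ℕ) (hn : n ∈ Finset.range (N + 1)) : ∑ k ∈ Finset.range (N + 1),
        (-1) ^ (k + l) * ((k.choose l : ℕ) : TField) *
          (((n.choose k : ℕ) : TField) * A (Pi.single α ((ε : ℤ) * (n : ℤ))) m) =
        if l = n then A (Pi.single α ((ε : ℤ) * (n : ℤ))) m else 0 := by
      rw [Finset.mem_range] at hn
      simp only [← _root_.mul_assoc]
      rw [← Finset.sum_mul, sum_neg_one_pow_mul_choose_mul_choose N n l (by omega)]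
      split_ifs <;> simp
    rw [Finset.sum_congr rfl inner, Finset.sum_ite_eq]
    split_ifs with hl
    · rfl
    · by_contra h0
      have := hN _ (ne_zero_of_apply (Ne.symm h0))
      rw [Pi.single_eq_same, units_mul_mul] at this
      rw [Finset.mem_range] at hl
      omega
  rw [Finset.sum_range_succ'] at full ⊢
  rw [← full]
  simp only [deltaCoeff_eq hN 0]
  have h1 (k : ℕ) : 1 ≤ k + 1 := by omega
  simp only [h1, if_true]
  rcases l with _ | l <;> simp

/-- The properties of the part of order at least one in `Δ`. -/
theorem deltaPartPos_spec (hA : IsSeries α ε A) : IsLaurentPoly (deltaPartPos α ε A) ∧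
    (∀ j, deltaPartPos α ε A j ≠ 0 → j (other α) = 0 ∧ 0 ≤ (ε : ℤ) * j α) ∧
    (∀ j, (A - deltaPartPos α ε A) j ≠ 0 → (ε : ℤ) * j α ≤ 0) ∧
    ∀ m, ∑ᶠ j, deltaPartPos α ε A j m = 0 := by
  obtain ⟨N₀, h0⟩ := hA
  obtain ⟨N, hN⟩ : ∃ N : ℕ, ∀ j, A j ≠ 0 → (ε : ℤ) * j α ≤ N :=
    ⟨N₀.toNat, fun j hj => (h0 j hj).2.trans (Int.self_le_toNat N₀)⟩
  rw [deltaPartPos_eq hN]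
  set b : ℕ → Lattice → TField := fun l m => A (Pi.single α ((ε : ℤ) * (l : ℤ))) m -
    if l = 0 then ∑ n ∈ Finset.range (N + 1), A (Pi.single α ((ε : ℤ) * (n : ℤ))) m else 0 with hb
  have hbN (l : ℕ) (m : Lattice) (h : b l m ≠ 0) : l ≤ N := by
    by_contra hl
    apply h
    simp only [hb]
    rw [if_neg (by omega), sub_zero]
    by_contra h0
    have := hN _ (ne_zero_of_apply h0)
    rw [Pi.single_eq_same, units_mul_mul] at this
    omega
  have supp (j m : Lattice) (h : series α ε b j m ≠ 0) :
      ∃ l : ℕ, l ≤ N ∧ j = Pi.single α ((ε : ℤ) * l) := by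
    obtain ⟨l, rfl⟩ := eq_single_of_series_ne_zero h
    rw [series_single] at h
    exact ⟨l, hbN l m h, rfl⟩
  refine ⟨⟨N, fun j hj β => ?_⟩, fun j hj => ?_, fun j hj => ?_, fun m => ?_⟩
  · obtain ⟨m, hm⟩ := exists_apply_ne_zero hj
    obtain ⟨l, hl, rfl⟩ := supp j m hm
    by_cases hβ : β = α
    · subst hβ
      rw [Pi.single_eq_same, abs_mul, Int.isUnit_iff_abs_eq.mp ε.isUnit, _root_.one_mul,
        Nat.abs_cast]
      exact_mod_cast hl
    · rw [Pi.single_eq_of_ne hβ, abs_zero]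
      omega
  · obtain ⟨m, hm⟩ := exists_apply_ne_zero hj
    obtain ⟨l, hl, rfl⟩ := supp j m hm
    refine ⟨Pi.single_eq_of_ne (other_ne α) _, ?_⟩
    rw [Pi.single_eq_same, units_mul_mul]
    omega
  · by_contra hpos
    obtain ⟨m, hm⟩ := exists_apply_ne_zero hj
    rw [sub_apply] at hm
    by_cases hj' : ∃ l : ℕ, j = Pi.single α ((ε : ℤ) * l)
    · obtain ⟨l, rfl⟩ := hj'
      rw [Pi.single_eq_same, units_mul_mul] at hpos
      rw [series_single] at hm
      simp only [hb] at hm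
      rw [if_neg (by omega), sub_zero, sub_self] at hm
      exact hm rfl
    · have hz : series α ε b j m = 0 := by
        by_contra h
        exact hj' (eq_single_of_series_ne_zero h)
      rw [hz, sub_zero] at hm
      have hs := (h0 j (ne_zero_of_apply hm)).1
      apply hj'
      refine ⟨((ε : ℤ) * j α).toNat, lattice_ext α ?_ ?_⟩
      · rw [Pi.single_eq_same, Int.toNat_of_nonneg (by omega), units_mul_mul]
      · rw [Pi.single_eq_of_ne (other_ne α), hs _ (other_ne α)]
  · rw [finsum_eq_sum_of_support_subset _
      (s := (Finset.range (N + 1)).map ⟨_, single_mul_injective α ε⟩), Finset.sum_map]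
    · simp only [Function.Embedding.coeFn_mk, series_single, hb]
      rw [Finset.sum_sub_distrib, Finset.sum_ite_eq', if_pos (by simp), sub_self]
    · intro j hj
      obtain ⟨l, hl, rfl⟩ := supp j m hj
      simp only [Finset.coe_map, Function.Embedding.coeFn_mk, Finset.coe_range]
      exact ⟨l, by rw [Set.mem_Iio]; omega, rfl⟩

end Op

/-! ### The four families of flows -/

theorem L₁_pow_isSeries (hτ : ∀ m, τ m ≠ 0) (k : ℕ) : IsSeries 0 1 (Op.pow (L₁ τ) k) :=
  ((isWaveOp_S₁ hτ).lax_pow 1 k).1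

theorem L₂_pow_isSeries (hτ : ∀ m, τ m ≠ 0) (k : ℕ) : IsSeries 1 (-1) (Op.pow (L₂ τ) k) :=
  ((isWaveOp_S₂ hτ).lax_pow (-1) k).1

theorem L₃_pow_isSeries (hτ : ∀ m, τ m ≠ 0) (k : ℕ) : IsSeries 0 (-1) (Op.pow (L₃ τ) k) :=
  ((isWaveOp_S₃ hτ).lax_pow (-1) k).1

theorem L₃'_pow_isSeries (hτ : ∀ m, τ m ≠ 0) (k : ℕ) : IsSeries 1 1 (Op.pow (L₃' τ) k) :=
  ((isWaveOp_S₃' hτ).lax_pow 1 k).1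

theorem isLaurentPoly_B₁ (hτ : ∀ m, τ m ≠ 0) (k : ℕ+) : IsLaurentPoly (B₁ τ k) :=
  ((L₁_pow_isSeries hτ k).part 0 _).isLaurentPoly (c := 0) fun j hj => by
    simpa using (part_ne_zero hj).1

theorem isLaurentPoly_B₃ (hτ : ∀ m, τ m ≠ 0) (k : ℕ+) : IsLaurentPoly (B₃ τ k) :=
  ((L₃_pow_isSeries hτ k).part 0 _).isLaurentPoly (c := 0) fun j hj => by
    have := (part_ne_zero hj).1
    simp
    omega

theorem isLaurentPoly_B₂ (hτ : ∀ m, τ m ≠ 0) (k : ℕ+) : IsLaurentPoly (B₂ τ k) :=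
  (deltaPartPos_spec (L₂_pow_isSeries hτ k)).1

theorem isLaurentPoly_B₃' (hτ : ∀ m, τ m ≠ 0) (k : ℕ+) : IsLaurentPoly (B₃' τ k) :=
  (deltaPartPos_spec (L₃'_pow_isSeries hτ k)).1

/-- A Laurent polynomial in one shift belongs to the series rings of both directions, so one B
serves two wave operators. -/
theorem isSeries_B₁ (hτ : ∀ m, τ m ≠ 0) (k : ℕ+) (ε : ℤˣ) : IsSeries 0 ε (B₁ τ k) :=
  (isLaurentPoly_B₁ hτ k).isSeries
    (fun _ hj => (L₁_pow_isSeries hτ k).isHomog _ (part_ne_zero hj).2) ε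

theorem isSeries_B₃ (hτ : ∀ m, τ m ≠ 0) (k : ℕ+) (ε : ℤˣ) : IsSeries 0 ε (B₃ τ k) :=
  (isLaurentPoly_B₃ hτ k).isSeries
    (fun _ hj => (L₃_pow_isSeries hτ k).isHomog _ (part_ne_zero hj).2) ε

theorem isSeries_B₂ (hτ : ∀ m, τ m ≠ 0) (k : ℕ+) (ε : ℤˣ) : IsSeries 1 ε (B₂ τ k) :=
  (isLaurentPoly_B₂ hτ k).isSeries
    (fun j hj => ((deltaPartPos_spec (L₂_pow_isSeries hτ k)).2.1 j hj).1) ε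

theorem isSeries_B₃' (hτ : ∀ m, τ m ≠ 0) (k : ℕ+) (ε : ℤˣ) : IsSeries 1 ε (B₃' τ k) :=
  (isLaurentPoly_B₃' hτ k).isSeries
    (fun j hj => ((deltaPartPos_spec (L₃'_pow_isSeries hτ k)).2.1 j hj).1) ε

/-- The leading coefficient of Ψ₁ is the constant 1, so the time derivative lowers its degree. -/
theorem dt_wave_zero_eq_zero (hτ : ∀ m, τ m ≠ 0) (σ : TimeIdx) {n : ℤ} {m : Lattice}
    (hn : lead 0 m ≤ n) : dt σ (wave τ 0 n m) = 0 := by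
  rcases hn.eq_or_lt with rfl | hn
  · rw [wave_lead]
    simp [sgn, latShift, ι_ne_zero (hτ m)]
  · rw [wave_eq_zero 0 (by rw [show (dir 0 : ℤ) = -1 from rfl]; omega), dt_zero]

theorem flowD_of_ne {σ : TimeIdx} {j : Fin 3} (h : σ.1 ≠ j) (n : ℤ) (m : Lattice) :
    flowD σ j (wave τ j) n m = dt σ (wave τ j n m) := by
  rw [flowD, if_neg h, add_zero]

theorem dt_wave_eq_zero (σ : TimeIdx) {j : Fin 3} {n : ℤ} {m : Lattice}
    (h : (dir j : ℤ) * (n - lead j m) < 0) : dt σ (wave τ j n m) = 0 := by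
  rw [wave_eq_zero j h, dt_zero]

/-- Without an exponential contribution, neither the time derivative nor an operator satisfying `hB`
produces terms beyond the leading order. -/
theorem flowD_sub_act_eq_zero {σ : TimeIdx} {j : Fin 3} (hσ : σ.1 ≠ j) {B : Op} {n : ℤ}
    {m : Lattice} (hn : (dir j : ℤ) * (n - lead j m) < 0)
    (hB : ∀ i, B i ≠ 0 → (dir j : ℤ) * lead j m ≤ dir j * lead j (m + i)) :
    flowD σ j (wave τ j) n m - act B (wave τ j n) m = 0 := by
  rw [flowD_of_ne hσ, dt_wave_eq_zero σ hn, act_eq_zero, sub_zero]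
  intro i hi
  refine wave_eq_zero j ?_
  have := hB i hi
  rw [mul_sub] at hn ⊢
  linarith

theorem dir_zero : (dir 0 : ℤ) = -1 := rfl
theorem dir_one : (dir 1 : ℤ) = 1 := rfl
theorem dir_two : (dir 2 : ℤ) = 1 := rfl
theorem lead_zero (m : Lattice) : lead 0 m = m 0 := rfl
theorem lead_one (m : Lattice) : lead 1 m = m 1 := rfl
theorem lead_two (m : Lattice) : lead 2 m = m 0 - m 1 := rfl

/-- An operator in `Λ_2` alone that annihilates constants lowers the order of the first wave
function. -/
theorem flowD_sub_act_zero_eq_zero (hτ : ∀ m, τ m ≠ 0) {σ : TimeIdx} (hσ : σ.1 ≠ 0) {B : Op}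
    (hB : ∀ j, B j ≠ 0 → j 0 = 0) (hB0 : ∀ m, ∑ᶠ j, B j m = 0) {n : ℤ} {m : Lattice}
    (hn : lead 0 m ≤ n) : flowD σ 0 (wave τ 0) n m - act B (wave τ 0 n) m = 0 := by
  rw [flowD_of_ne hσ, dt_wave_zero_eq_zero hτ σ hn, zero_sub, neg_eq_zero]
  have hl (k : Lattice) (hk : B k ≠ 0) : lead 0 (m + k) = lead 0 m := by
    rw [lead_zero, lead_zero, Pi.add_apply, hB k hk, add_zero]
  rcases hn.eq_or_lt with rfl | hn
  -- All translates in the sum have leading coefficient 1 at this degree, so B acts by the sum of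
  -- its coefficients.
  · rw [act, ← hB0 m]
    refine finsum_congr fun k => ?_
    by_cases hk : B k = 0
    · rw [hk]; simp
    · rw [← hl k hk, wave_lead]
      simp [sgn, latShift, ι_ne_zero (hτ (m + k))]
  · refine act_eq_zero fun k hk => wave_eq_zero 0 ?_
    rw [hl k hk, dir_zero]
    omega

/-- On Ψ₁ only the negative part of L₁^k remains, which lowers the degree. Powers Λ₁^i with i ≥ 0
leave m₂ fixed and do not decrease m₁ - m₂, as Ψ₂ and Ψ₃ require. -/
theorem IsTau.act_B₁ (hτ : IsTau τ) (k : ℕ+) (j : Fin 3) (n : ℤ) (m : Lattice) :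
    act (B₁ τ k) (wave τ j n) m = flowD (0, k) j (wave τ j) n m := by
  classical
  have h0 := hτ.ne_zero
  have hs := L₁_pow_isSeries h0 k
  have hB (i : Lattice) (hi : B₁ τ k i ≠ 0) : 0 ≤ i 0 ∧ i 1 = 0 :=
    ⟨(part_ne_zero hi).1, hs.isHomog _ (part_ne_zero hi).2⟩
  refine hτ.act_wave_eq_flowD (isLaurentPoly_B₁ h0 k) (0, k) (fun m n hn => ?_) (fun m n hn => ?_)
    (fun m n hn => ?_) j n m
  · have hR := hs.sub (isSeries_B₁ h0 k 1)
    rw [(isWaveOp_S₁ h0).flowD_sub_act (q := 1) (isSeries_B₁ h0 k 1) hR rfl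
      (add_sub_cancel _ _).symm, dt_wave_zero_eq_zero h0 _ hn, zero_add]
    -- The remainder has order at most -1, which excludes the leading degree n = m₁ as well.
    refine (isWaveOp_S₁ h0).act_wave_eq_zero hR (c := -1) (fun i hi => ?_) ?_
    · obtain ⟨m, hm⟩ := exists_apply_ne_zero hi
      rw [sub_apply, B₁, part_apply] at hm
      split_ifs at hm with hi0
      · simp at hm
      · simp
        omega
    · rw [dir_zero]
      omega
  · exact flowD_sub_act_eq_zero (by simp) (by rw [dir_one]; omega) fun i hi => by
      simp [dir_one, lead_one, (hB i hi).2]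
  · exact flowD_sub_act_eq_zero (by simp) (by rw [dir_two]; omega) fun i hi => by
      have := hB i hi
      simp [dir_two, lead_two]
      omega

/-- Negative powers of Λ₁ lower the degree of Ψ₁ and leave m₂ fixed. On Ψ₃ the remainder of L₃^k has
nonnegative powers of Λ₁ only, which do not decrease m₁ - m₂. -/
theorem IsTau.act_B₃ (hτ : IsTau τ) (k : ℕ+) (j : Fin 3) (n : ℤ) (m : Lattice) :
    act (B₃ τ k) (wave τ j n) m = flowD (2, k) j (wave τ j) n m := by
  classical
  have h0 := hτ.ne_zero
  have hs := L₃_pow_isSeries h0 k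
  have hB (i : Lattice) (hi : B₃ τ k i ≠ 0) : i 0 < 0 ∧ i 1 = 0 :=
    ⟨(part_ne_zero hi).1, hs.isHomog _ (part_ne_zero hi).2⟩
  refine hτ.act_wave_eq_flowD (isLaurentPoly_B₃ h0 k) (2, k) (fun m n hn => ?_) (fun m n hn => ?_)
    (fun m n hn => ?_) j n m
  · rw [flowD_of_ne (by simp), dt_wave_zero_eq_zero h0 _ hn, act_eq_zero, sub_zero]
    intro i hi
    refine wave_eq_zero 0 ?_
    have := hB i hi
    rw [lead_zero] at hn
    rw [dir_zero, lead_zero, Pi.add_apply]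
    omega
  · exact flowD_sub_act_eq_zero (by simp) (by rw [dir_one]; omega) fun i hi => by
      simp [dir_one, lead_one, (hB i hi).2]
  · have hR := hs.sub (isSeries_B₃ h0 k (-1))
    rw [(isWaveOp_S₃ h0).flowD_sub_act (q := -1) (isSeries_B₃ h0 k (-1)) hR rfl
      (add_sub_cancel _ _).symm, dt_wave_eq_zero _ (by rw [dir_two]; omega), zero_add]
    refine (isWaveOp_S₃ h0).act_wave_eq_zero hR (c := 0) (fun i hi => ?_) ?_
    · obtain ⟨m, hm⟩ := exists_apply_ne_zero hi
      rw [sub_apply, B₃, part_apply] at hm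
      split_ifs at hm with hi0
      · simp at hm
      · simp
        omega
    · rw [dir_two]
      omega

/-- B₂ has only powers Λ₂^{-l} with l ≥ 0, which do not decrease m₁ - m₂, and annihilates constants,
as Ψ₁ requires. On Ψ₂ the remainder of L₂^k has nonnegative powers of Λ₂, which do not decrease m₂.
-/
theorem IsTau.act_B₂ (hτ : IsTau τ) (k : ℕ+) (j : Fin 3) (n : ℤ) (m : Lattice) :
    act (B₂ τ k) (wave τ j n) m = flowD (1, k) j (wave τ j) n m := by
  have h0 := hτ.ne_zero
  have hs := L₂_pow_isSeries h0 k
  obtain ⟨-, hB, hR0, hB0⟩ := deltaPartPos_spec hs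
  refine hτ.act_wave_eq_flowD (isLaurentPoly_B₂ h0 k) (1, k) (fun m n hn => ?_) (fun m n hn => ?_)
    (fun m n hn => ?_) j n m
  · exact flowD_sub_act_zero_eq_zero h0 (by simp) (fun i hi => (hB i hi).1) hB0 hn
  · have hR := hs.sub (isSeries_B₂ h0 k (-1))
    rw [(isWaveOp_S₂ h0).flowD_sub_act (q := -1) (isSeries_B₂ h0 k (-1)) hR rfl
      (add_sub_cancel _ _).symm, dt_wave_eq_zero _ (by rw [dir_one]; omega), zero_add]
    exact (isWaveOp_S₂ h0).act_wave_eq_zero hR hR0 (by rw [dir_one]; omega)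
  · exact flowD_sub_act_eq_zero (by simp) (by rw [dir_two]; omega) fun i hi => by
      have h1 : i 0 = 0 := (hB i hi).1
      have h2 := (hB i hi).2
      simp [dir_two, lead_two] at h2 ⊢
      omega

/-- The roles of Ψ₂ and Ψ₃ are exchanged: nonnegative powers of Λ₂ do not decrease m₂, and the
remainder, with nonpositive powers of Λ₂, does not decrease m₁ - m₂. -/
theorem IsTau.act_B₃' (hτ : IsTau τ) (k : ℕ+) (j : Fin 3) (n : ℤ) (m : Lattice) :
    act (B₃' τ k) (wave τ j n) m = flowD (2, k) j (wave τ j) n m := by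
  have h0 := hτ.ne_zero
  have hs := L₃'_pow_isSeries h0 k
  obtain ⟨-, hB, hR0, hB0⟩ := deltaPartPos_spec hs
  refine hτ.act_wave_eq_flowD (isLaurentPoly_B₃' h0 k) (2, k) (fun m n hn => ?_) (fun m n hn => ?_)
    (fun m n hn => ?_) j n m
  · exact flowD_sub_act_zero_eq_zero h0 (by simp) (fun i hi => (hB i hi).1) hB0 hn
  · exact flowD_sub_act_eq_zero (by simp) (by rw [dir_one]; omega) fun i hi => by
      have h2 := (hB i hi).2
      simp [dir_one, lead_one] at h2 ⊢
      omega
  · have hR := hs.sub (isSeries_B₃' h0 k 1)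
    rw [(isWaveOp_S₃' h0).flowD_sub_act (q := 1) (isSeries_B₃' h0 k 1) hR rfl
      (add_sub_cancel _ _).symm, dt_wave_eq_zero _ (by rw [dir_two]; omega), zero_add]
    exact (isWaveOp_S₃' h0).act_wave_eq_zero hR hR0 (by rw [dir_two]; omega)

end ThreeKP
end

/-! ### The Lax equations. -/

theorem mainTheorem1 (τ : ThreeKP.Lattice → ThreeKP.TSeries) (hτ : ThreeKP.IsTau τ) :
    -- the inverses of the wave operators exist and are unique
    ((∃! T, ThreeKP.Op.IsInv 0 1 (ThreeKP.S₁ τ) T) ∧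
      (∃! T, ThreeKP.Op.IsInv 1 (-1) (ThreeKP.S₂ τ) T) ∧
      (∃! T, ThreeKP.Op.IsInv 0 (-1) (ThreeKP.S₃ τ) T) ∧
      (∃! T, ThreeKP.Op.IsInv 1 1 (ThreeKP.S₃' τ) T)) ∧
    -- the four projections are well defined, and the operators `B` lie in their domains
    (∀ (α : Fin 2) (ε : ℤˣ) (A : ThreeKP.Op), ThreeKP.Op.IsMixed α ε A →
      ∃! P, ThreeKP.IsProj τ α ε A P) ∧
    (∀ k : ℕ+, ThreeKP.Op.IsLaurentPoly (ThreeKP.B₁ τ k) ∧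
      ThreeKP.Op.IsLaurentPoly (ThreeKP.B₂ τ k) ∧
      ThreeKP.Op.IsLaurentPoly (ThreeKP.B₃ τ k) ∧
      ThreeKP.Op.IsLaurentPoly (ThreeKP.B₃' τ k)) ∧
    -- the flow of the first family of times
    (∀ k : ℕ+,
      (ThreeKP.L₁ τ).deriv (0, k) = (ThreeKP.B₁ τ k).comm (ThreeKP.L₁ τ) ∧
      (ThreeKP.L₂ τ).deriv (0, k) =
        (ThreeKP.proj τ 1 (-1) (ThreeKP.B₁ τ k)).comm (ThreeKP.L₂ τ) ∧
      (ThreeKP.L₃ τ).deriv (0, k) = (ThreeKP.B₁ τ k).comm (ThreeKP.L₃ τ) ∧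
      (ThreeKP.L₃' τ).deriv (0, k) =
        (ThreeKP.proj τ 1 1 (ThreeKP.B₁ τ k)).comm (ThreeKP.L₃' τ)) ∧
    -- the flow of the second family of times
    (∀ k : ℕ+,
      (ThreeKP.L₁ τ).deriv (1, k) =
        (ThreeKP.proj τ 0 1 (ThreeKP.B₂ τ k)).comm (ThreeKP.L₁ τ) ∧
      (ThreeKP.L₂ τ).deriv (1, k) = (ThreeKP.B₂ τ k).comm (ThreeKP.L₂ τ) ∧
      (ThreeKP.L₃ τ).deriv (1, k) =
        (ThreeKP.proj τ 0 (-1) (ThreeKP.B₂ τ k)).comm (ThreeKP.L₃ τ) ∧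
      (ThreeKP.L₃' τ).deriv (1, k) = (ThreeKP.B₂ τ k).comm (ThreeKP.L₃' τ)) ∧
    -- the flow of the third family of times, in terms of `Λ_1`
    (∀ k : ℕ+,
      (ThreeKP.L₁ τ).deriv (2, k) = (ThreeKP.B₃ τ k).comm (ThreeKP.L₁ τ) ∧
      (ThreeKP.L₂ τ).deriv (2, k) =
        (ThreeKP.proj τ 1 (-1) (ThreeKP.B₃ τ k)).comm (ThreeKP.L₂ τ) ∧
      (ThreeKP.L₃ τ).deriv (2, k) = (ThreeKP.B₃ τ k).comm (ThreeKP.L₃ τ) ∧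
      (ThreeKP.L₃' τ).deriv (2, k) =
        (ThreeKP.proj τ 1 1 (ThreeKP.B₃ τ k)).comm (ThreeKP.L₃' τ)) ∧
    -- the flow of the third family of times, in terms of `Λ_2`
    (∀ k : ℕ+,
      (ThreeKP.L₁ τ).deriv (2, k) =
        (ThreeKP.proj τ 0 1 (ThreeKP.B₃' τ k)).comm (ThreeKP.L₁ τ) ∧
      (ThreeKP.L₂ τ).deriv (2, k) = (ThreeKP.B₃' τ k).comm (ThreeKP.L₂ τ) ∧
      (ThreeKP.L₃ τ).deriv (2, k) =
        (ThreeKP.proj τ 0 (-1) (ThreeKP.B₃' τ k)).comm (ThreeKP.L₃ τ) ∧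
      (ThreeKP.L₃' τ).deriv (2, k) = (ThreeKP.B₃' τ k).comm (ThreeKP.L₃' τ)) := by
  have h0 := hτ.ne_zero
  have w₁ := ThreeKP.isWaveOp_S₁ h0
  have w₂ := ThreeKP.isWaveOp_S₂ h0
  have w₃ := ThreeKP.isWaveOp_S₃ h0
  have w₃' := ThreeKP.isWaveOp_S₃' h0
  have b₁ := ThreeKP.isLaurentPoly_B₁ h0
  have b₂ := ThreeKP.isLaurentPoly_B₂ h0
  have b₃ := ThreeKP.isLaurentPoly_B₃ h0
  have b₃' := ThreeKP.isLaurentPoly_B₃' h0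
  refine ⟨⟨w₁.existsUnique_isInv, w₂.existsUnique_isInv, w₃.existsUnique_isInv,
    w₃'.existsUnique_isInv⟩, fun α ε A hA => ThreeKP.existsUnique_isProj h0 hA,
    fun k => ⟨b₁ k, b₂ k, b₃ k, b₃' k⟩, fun k => ?_, fun k => ?_, fun k => ?_, fun k => ?_⟩
  -- The projection enters exactly when the shift in B is not the one in the wave operator. Both
  -- forms of L₃ rest on the linear equation for Ψ₃, which can be written as a series in either
  -- shift applied to z^{m₁-m₂}.
  · exact ⟨w₁.lax (ThreeKP.isSeries_B₁ h0 k _) _ (hτ.act_B₁ k 0) _,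
      w₂.lax_proj hτ ((b₁ k).isMixed _ _) _ (hτ.act_B₁ k 1) _,
      w₃.lax (ThreeKP.isSeries_B₁ h0 k _) _ (hτ.act_B₁ k 2) _,
      w₃'.lax_proj hτ ((b₁ k).isMixed _ _) _ (hτ.act_B₁ k 2) _⟩
  · exact ⟨w₁.lax_proj hτ ((b₂ k).isMixed _ _) _ (hτ.act_B₂ k 0) _,
      w₂.lax (ThreeKP.isSeries_B₂ h0 k _) _ (hτ.act_B₂ k 1) _,
      w₃.lax_proj hτ ((b₂ k).isMixed _ _) _ (hτ.act_B₂ k 2) _,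
      w₃'.lax (ThreeKP.isSeries_B₂ h0 k _) _ (hτ.act_B₂ k 2) _⟩
  · exact ⟨w₁.lax (ThreeKP.isSeries_B₃ h0 k _) _ (hτ.act_B₃ k 0) _,
      w₂.lax_proj hτ ((b₃ k).isMixed _ _) _ (hτ.act_B₃ k 1) _,
      w₃.lax (ThreeKP.isSeries_B₃ h0 k _) _ (hτ.act_B₃ k 2) _,
      w₃'.lax_proj hτ ((b₃ k).isMixed _ _) _ (hτ.act_B₃ k 2) _⟩
  · exact ⟨w₁.lax_proj hτ ((b₃' k).isMixed _ _) _ (hτ.act_B₃' k 0) _,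
      w₂.lax (ThreeKP.isSeries_B₃' h0 k _) _ (hτ.act_B₃' k 1) _,
      w₃.lax_proj hτ ((b₃' k).isMixed _ _) _ (hτ.act_B₃' k 2) _,
      w₃'.lax (ThreeKP.isSeries_B₃' h0 k _) _ (hτ.act_B₃' k 2) _⟩
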